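/- **Notation.** Let $G,\mathcal K,\kappa>0$ (gravitational constant, reference density, bulk modulus), $\nu\in(-1,1/2]$ (Poisson ratio) and $\gamma=4/3$. For $\beta>1$, $\beta\le 4/3$, put $y_{\mathrm b}=\big[1-\frac{\beta}{4}\frac{1+\nu}{1-\nu}\big]^{1/\beta}\in[0,1)$, $$\widehat p_{\mathrm{rad}}(\delta,\eta)=\kappa\Big[\tfrac{3(1-\nu)}{\beta(1+\nu)}\big((\delta/\eta)^\beta-y_{\mathrm b}^\beta\big)\eta^\gamma-\tfrac1\gamma\Big],\qquad \widehat p_{\mathrm{tan}}(\delta,\eta)=\widehat p_{\mathrm{rad}}(\delta,\eta)+3\kappa\,(1-\delta/\eta)\,Q(\delta/\eta)\,\eta^\gamma,$$ $$Q(y)=\tfrac{3(\beta-\gamma)(1-\nu)}{2\beta(\beta-1)(1+\nu)}\tfrac{1-y^\beta}{1-y}+\tfrac{3(\gamma-1)(1-\nu)}{2(\beta-1)(1+\nu)}-\tfrac12,\qquad B(y)=\tfrac{y+(\beta-1)y^{1+\beta}-\beta y^\beta}{\beta(\beta-1)},\qquad \theta=\tfrac{4\pi G\mathcal K^2}{9\kappa}\tfrac{1+\nu}{1-\nu}.$$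 $(\widehat p_{\mathrm{rad}},\widehat p_{\mathrm{tan}})$ is the polytropic elastic constitutive function: it is $C^2$ on $(0,\infty)^2$, satisfies $\widehat p_{\mathrm{rad}}(\delta,\delta)=\widehat p_{\mathrm{tan}}(\delta,\delta)$ and $\partial_\eta(\widehat p_{\mathrm{rad}}+2\widehat p_{\mathrm{tan}})(\delta,\delta)=0$ for all $\delta>0$, vanishes at $(1,1)$, and has there the first derivatives prescribed by linear elasticity with bulk modulus $\kappa$ and Poisson ratio $\nu$. *Profile system.* For $\alpha>0$, $$\delta_0'=\Big(\frac{\delta_0}{\eta_0}\Big)^{1-\beta}\Big(\frac{3(\beta-4/3)}{z}B(\delta_0/\eta_0)\,\eta_0-\theta z\,\eta_0^{-1/3}\delta_0(\eta_0+\alpha)\Big),\qquad \eta_0'=-\frac3z(\eta_0-\delta_0).$$ A strongly regular solution on $[0,Z)$, $Z\in(0,\infty]$, with central datum $\delta_0^c>0$ is a solution on $(0,Z)$ with $\delta_0>0$ and $\delta_0\in C^1$ on $[0,Z)$, $\lim_{z\to0^+}\delta_0'(z)=0$, $\eta_0$ continuous on $[0,Z)$ and $\delta_0(0)=\eta_0(0)=\delta_0^c$.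 Write $y_0=\delta_0/\eta_0$. *Scale factor.* $\omega\in C^2([0,\infty))$ is positive and solves $\omega^2\ddot\omega=\frac{4\pi G}{3}\mathcal K\alpha$, $\omega(0)=1$, $\dot\omega(0)=0$. *Balls.* A homologous self-gravitating polytropic elastic ball of radius $R(t)$ with scale factor $\omega$ is a quadruple $(\rho,p_{\mathrm{rad}},p_{\mathrm{tan}},u)$ of functions on $[0,\infty)\times[0,\infty)$, with $R\in C^1$, $R>0$, such that: (a) it is continuous on $\{t\ge0,\ 0\le r\le R(t)\}$, $C^1$ on $\{t\ge 0,\ 0\le r<R(t)\}$ and zero for $r>R(t)$; $\rho,p_{\mathrm{rad}},p_{\mathrm{tan}}>0$ for $0\le r<R(t)$; at $r=0$, $p_{\mathrm{rad}}=p_{\mathrm{tan}}$, $\partial_tp_{\mathrm{rad}}=\partial_tp_{\mathrm{tan}}$ and $u=\partial_tu=0$; and, as $r\to0^+$, $\partial_r\rho,\partial_rp_{\mathrm{rad}},\partial_rp_{\mathrm{tan}}\to0$, while $\partial_ru$ and $u/r$ tend to the same function of $t$, which is continuous; (b) for $0<r<R(t)$, with $m(t,r)=4\pi\int_0^r\rho(t,s)s^2ds$,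 $$\partial_t\rho+\tfrac1{r^2}\partial_r(r^2\rho u)=0,\qquad \rho(\partial_tu+u\partial_ru)=-\partial_rp_{\mathrm{rad}}+\tfrac2r(p_{\mathrm{tan}}-p_{\mathrm{rad}})-G\rho\frac m{r^2},$$ and $u(t,R(t))=\dot R(t)$, $p_{\mathrm{rad}}(t,R(t))=0$; (c) for $0<r<R(t)$, $p_{\mathrm{rad}}=\frac\kappa\gamma+\widehat p_{\mathrm{rad}}(\delta,\eta)$ and $p_{\mathrm{tan}}=\frac\kappa\gamma+\widehat p_{\mathrm{tan}}(\delta,\eta)$ with $\delta=\rho/\mathcal K$, $\eta=m/(\frac{4\pi}3\mathcal Kr^3)$; (d) $u(t,r)=\frac{\dot\omega(t)}{\omega(t)}r$ for $0\le r\le R(t)$. **Theorem 2.** Let $\alpha>0$ and $1<\beta\le4/3$. For every $\delta_0^c>0$ the profile system has a unique maximal strongly regular solution with central datum $\delta_0^c$; its maximal interval $[0,Z_{\max})$ satisfies $Z_{\max}<\infty$, and $0<y_0(z)<1$ for $z\in(0,Z_{\max})$, $y_0(z)\to0^+$ as $z\to Z_{\max}^-$. If moreover $(\nu,\beta)\ne(1/2,4/3)$,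 then there is a unique scale factor $\omega$, it is strictly increasing, there is a first solution $Z\in(0,Z_{\max})$ of $y_0(Z)=y_{\mathrm b}$ (with $y_0>y_{\mathrm b}$ on $[0,Z)$), and there is a homologous self-gravitating polytropic elastic ball with scale factor $\omega$, radius $R(t)=Z\omega(t)\to\infty$ as $t\to\infty$ (type A: $0<Z<Z_{\max}<\infty$), density $\rho(t,r)=\mathcal K\omega(t)^{-3}\delta_0(r/\omega(t))$ for $0\le r\le R(t)$, in particular central density $\rho(t,0)=\mathcal K\delta_0^c/\omega(t)^3$, and $p_{\mathrm{tan}}(t,r)\ge p_{\mathrm{rad}}(t,r)$ for all $t\ge0$, $0\le r<R(t)$. It is unique: any homologous self-gravitating polytropic elastic ball, of any radius, with this scale factor and with $\rho(0,0)=\mathcal K\delta_0^c$ has the same radius and coincides with it on $[0,\infty)\times[0,\infty)$. -/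

import Mathlib

open Set Filter Topology

noncomputable section

/-! ### Constitutive functions -/

/-- `(pr, pt)`, functions of `(δ, η) ∈ (0,∞)²`, is an elastic constitutive function for spherically
symmetric bodies with bulk modulus `κ` and Poisson ratio `ν`. -/
structure IsElasticConstitutive (κ ν : ℝ) (pr pt : ℝ → ℝ → ℝ) : Prop where
  bulk_pos : 0 < κ
  poisson_mem : ν ∈ Ioc (-1 : ℝ) (1 / 2)
  rad_contDiff : ContDiffOn ℝ 2 (fun p : ℝ × ℝ => pr p.1 p.2) (Ioi 0 ×ˢ Ioi 0)
  tan_contDiff : ContDiffOn ℝ 2 (fun p : ℝ × ℝ => pt p.1 p.2) (Ioi 0 ×ˢ Ioi 0)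
  isotropic : ∀ d : ℝ, 0 < d → pr d d = pt d d
  isotropic_deriv : ∀ d : ℝ, 0 < d → deriv (fun e => pr d e + 2 * pt d e) d = 0
  rad_natural : pr 1 1 = 0
  tan_natural : pt 1 1 = 0
  rad_delta : κ⁻¹ * deriv (fun d => pr d 1) 1 = 3 * (1 - ν) / (1 + ν)
  rad_eta : κ⁻¹ * deriv (fun e => pr 1 e) 1 = -(2 * (1 - 2 * ν) / (1 + ν))
  tan_delta : κ⁻¹ * deriv (fun d => pt d 1) 1 = 3 * ν / (1 + ν)
  tan_eta : κ⁻¹ * deriv (fun e => pt 1 e) 1 = (1 - 2 * ν) / (1 + ν)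

/-- The boundary shear `y_b` of the polytropic model. -/
def boundaryShear (ν γ β : ℝ) : ℝ :=
  (1 - β / (3 * γ) * ((1 + ν) / (1 - ν))) ^ (1 / β)

/-- The function `Q` entering the polytropic tangential pressure. -/
def polyQ (ν γ β y : ℝ) : ℝ :=
  if β = 1 then
    3 * (γ - 1) * (1 - ν) / (2 * (1 + ν)) * (y * Real.log y / (1 - y))
      + 3 * γ * (1 - ν) / (2 * (1 + ν)) - 1 / 2
  else
    3 * (β - γ) * (1 - ν) / (2 * β * (β - 1) * (1 + ν)) * ((1 - y ^ β) / (1 - y))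
      + 3 * (γ - 1) * (1 - ν) / (2 * (β - 1) * (1 + ν)) - 1 / 2

/-- The radial component of the polytropic elastic constitutive function. -/
def polyRad (κ ν γ β δ η : ℝ) : ℝ :=
  κ * (3 * (1 - ν) / (β * (1 + ν)) * ((δ / η) ^ β - boundaryShear ν γ β ^ β) * η ^ γ - 1 / γ)

/-- The tangential component of the polytropic elastic constitutive function. -/
def polyTan (κ ν γ β δ η : ℝ) : ℝ :=
  polyRad κ ν γ β δ η + κ * (3 * (1 - δ / η) * polyQ ν γ β (δ / η) * η ^ γ)

/-! ### Balls of matter -/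

/-- A spherically symmetric matter distribution: mass density, radial pressure, tangential pressure
and radial velocity, as functions of time and radius. -/
structure Matter where
  rho : ℝ → ℝ → ℝ
  pRad : ℝ → ℝ → ℝ
  pTan : ℝ → ℝ → ℝ
  u : ℝ → ℝ → ℝ

/-- The space-time region `{(t, r) : t ∈ I, 0 ≤ r ≤ R(t)}`. -/
def closedRegion (I : Set ℝ) (R : ℝ → ℝ) : Set (ℝ × ℝ) :=
  {p | p.1 ∈ I ∧ 0 ≤ p.2 ∧ p.2 ≤ R p.1}

/-- The space-time region `{(t, r) : t ∈ I, 0 ≤ r < R(t)}`. -/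
def innerRegion (I : Set ℝ) (R : ℝ → ℝ) : Set (ℝ × ℝ) :=
  {p | p.1 ∈ I ∧ 0 ≤ p.2 ∧ p.2 < R p.1}

/-- Continuity on the closed region and continuous differentiability on the inner region. -/
def IsRegularField (I : Set ℝ) (R : ℝ → ℝ) (f : ℝ → ℝ → ℝ) : Prop :=
  ContinuousOn (fun p : ℝ × ℝ => f p.1 p.2) (closedRegion I R) ∧
    ContDiffOn ℝ 1 (fun p : ℝ × ℝ => f p.1 p.2) (innerRegion I R)

/-- `M` is, on the time interval `I`, a ball of matter of radius `R` with strongly regular center.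
Time derivatives are one-sided at the end points of `I`. -/
structure IsBallOfMatter (I : Set ℝ) (R : ℝ → ℝ) (M : Matter) : Prop where
  radius_pos : ∀ t ∈ I, 0 < R t
  radius_contDiff : ContDiffOn ℝ 1 R I
  rho_pos : ∀ t ∈ I, ∀ r ∈ Ico 0 (R t), 0 < M.rho t r
  pRad_pos : ∀ t ∈ I, ∀ r ∈ Ico 0 (R t), 0 < M.pRad t r
  pTan_pos : ∀ t ∈ I, ∀ r ∈ Ico 0 (R t), 0 < M.pTan t r
  rho_reg : IsRegularField I R M.rho
  pRad_reg : IsRegularField I R M.pRad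
  pTan_reg : IsRegularField I R M.pTan
  u_reg : IsRegularField I R M.u
  vacuum : ∀ t ∈ I, ∀ r, R t < r →
    M.rho t r = 0 ∧ M.pRad t r = 0 ∧ M.pTan t r = 0 ∧ M.u t r = 0
  center_pressure : ∀ t ∈ I, M.pRad t 0 = M.pTan t 0
  center_pressure_deriv : ∀ t ∈ I,
    derivWithin (fun s => M.pRad s 0) I t = derivWithin (fun s => M.pTan s 0) I t
  center_velocity : ∀ t ∈ I, M.u t 0 = 0
  center_velocity_deriv : ∀ t ∈ I, derivWithin (fun s => M.u s 0) I t = 0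
  center_rho_r : ∀ t ∈ I, Tendsto (deriv (M.rho t)) (𝓝[>] 0) (𝓝 0)
  center_pRad_r : ∀ t ∈ I, Tendsto (deriv (M.pRad t)) (𝓝[>] 0) (𝓝 0)
  center_pTan_r : ∀ t ∈ I, Tendsto (deriv (M.pTan t)) (𝓝[>] 0) (𝓝 0)
  center_u_r : ∃ a : ℝ → ℝ, ContinuousOn a I ∧ ∀ t ∈ I,
    Tendsto (deriv (M.u t)) (𝓝[>] 0) (𝓝 (a t)) ∧
    Tendsto (fun r => M.u t r / r) (𝓝[>] 0) (𝓝 (a t))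

/-- The mass `m(t, r)` enclosed in the ball of radius `r`. -/
def enclosedMass (ρ : ℝ → ℝ → ℝ) (t r : ℝ) : ℝ :=
  4 * Real.pi * ∫ s in (0 : ℝ)..r, ρ t s * s ^ 2

/-- The equations of motion of a self-gravitating ball of matter (conservation of mass and balance
of momentum) in the matter interior, and the boundary conditions: the boundary is comoving and
surrounded by vacuum. -/
structure IsSelfGravitating (G : ℝ) (I : Set ℝ) (R : ℝ → ℝ) (M : Matter) : Prop where
  continuity : ∀ t ∈ I, ∀ r ∈ Ioo 0 (R t),
    derivWithin (fun s => M.rho s r) I t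
      + 1 / r ^ 2 * deriv (fun s => s ^ 2 * M.rho t s * M.u t s) r = 0
  momentum : ∀ t ∈ I, ∀ r ∈ Ioo 0 (R t),
    M.rho t r * (derivWithin (fun s => M.u s r) I t + M.u t r * deriv (M.u t) r)
      = -deriv (M.pRad t) r + 2 / r * (M.pTan t r - M.pRad t r)
        + M.rho t r * (-(G * enclosedMass M.rho t r / r ^ 2))
  boundary_comoving : ∀ t ∈ I, M.u t (R t) = derivWithin R I t
  boundary_vacuum : ∀ t ∈ I, M.pRad t (R t) = 0

/-- `M` satisfies the equation of state of elastic balls with constitutive function `(pr, pt)`,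
reference density `K` and reference pressure `P`; here `δ = ρ / K` and
`η = m / ((4π/3) K r³)`. -/
structure IsElasticBall (K P κ ν : ℝ) (pr pt : ℝ → ℝ → ℝ) (I : Set ℝ) (R : ℝ → ℝ) (M : Matter) :
    Prop where
  ball : IsBallOfMatter I R M
  density_pos : 0 < K
  pressure_nonneg : 0 ≤ P
  constitutive : IsElasticConstitutive κ ν pr pt
  eos_rad : ∀ t ∈ I, ∀ r ∈ Ioo 0 (R t),
    M.pRad t r =
      P + pr (M.rho t r / K) (enclosedMass M.rho t r / (4 * Real.pi / 3 * K * r ^ 3))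
  eos_tan : ∀ t ∈ I, ∀ r ∈ Ioo 0 (R t),
    M.pTan t r =
      P + pt (M.rho t r / K) (enclosedMass M.rho t r / (4 * Real.pi / 3 * K * r ^ 3))

/-- Polytropic elastic balls: the constitutive function is the polytropic one and the reference
pressure is `κ / γ`. -/
def IsPolytropicElasticBall (K κ ν γ β : ℝ) (I : Set ℝ) (R : ℝ → ℝ) (M : Matter) : Prop :=
  IsElasticBall K (κ / γ) κ ν (polyRad κ ν γ β) (polyTan κ ν γ β) I R M

/-! ### Homologous motion -/

/-- The velocity field is `u(t, r) = (ω'(t) / ω(t)) r` inside the ball, with `ω` positive, `C¹`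
and `ω(0) = 1`. -/
structure IsHomologousMotion (I : Set ℝ) (R ω : ℝ → ℝ) (M : Matter) : Prop where
  contDiff : ContDiffOn ℝ 1 ω I
  pos : ∀ t ∈ I, 0 < ω t
  init : ω 0 = 1
  velocity : ∀ t ∈ I, ∀ r ∈ Icc 0 (R t), M.u t r = derivWithin ω I t / ω t * r

/-- `M` is, on the time interval `I`, a homologous self-gravitating polytropic elastic ball of
radius `R` with scale factor `ω`. -/
structure IsHomologousBall (G K κ ν γ β : ℝ) (I : Set ℝ) (R ω : ℝ → ℝ) (M : Matter) : Prop where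
  elastic : IsPolytropicElasticBall K κ ν γ β I R M
  gravitating : IsSelfGravitating G I R M
  homologous : IsHomologousMotion I R ω M

/-- `ω` is a positive global solution of `ω² ω'' = (4πG/3) K α`, `ω(0) = 1`, `ω'(0) = 0`. -/
structure IsScaleFactor (G K α : ℝ) (ω : ℝ → ℝ) : Prop where
  contDiff : ContDiffOn ℝ 2 ω (Ici 0)
  pos : ∀ t, 0 ≤ t → 0 < ω t
  init : ω 0 = 1
  init_deriv : derivWithin ω (Ici 0) 0 = 0
  equation : ∀ t, 0 ≤ t →
    ω t ^ 2 * derivWithin (derivWithin ω (Ici 0)) (Ici 0) t = 4 * Real.pi * G / 3 * K * α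

/-! ### The profile system (for the polytropic exponent `4/3`) -/

/-- The function `B` of the profile system. -/
def profileB (β y : ℝ) : ℝ :=
  if β = 1 then y * (y - Real.log y - 1)
  else (y + (β - 1) * y ^ (1 + β) - β * y ^ β) / (β * (β - 1))

/-- The constant `θ` of the profile system. -/
def profileTheta (G K κ ν : ℝ) : ℝ :=
  4 * Real.pi * G * K ^ 2 / (9 * κ) * ((1 + ν) / (1 - ν))

/-- The interval `[0, Z)`, where `Z ∈ (0, ∞]`. -/
def profileInterval (Z : EReal) : Set ℝ := {z : ℝ | 0 ≤ z ∧ (z : EReal) < Z}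

/-- `(δ, η)` is a strongly regular solution on `[0, Z)` of the homologous profile system with
central datum `δc`. -/
structure IsStronglyRegularProfile (G K κ ν β α δc : ℝ) (Z : EReal) (δ η : ℝ → ℝ) : Prop where
  interval_pos : 0 < Z
  delta_center : δ 0 = δc
  eta_center : η 0 = δc
  delta_pos : ∀ z ∈ profileInterval Z, 0 < δ z
  delta_contDiff : ContDiffOn ℝ 1 δ (profileInterval Z)
  delta_deriv_center : Tendsto (deriv δ) (𝓝[>] 0) (𝓝 0)
  eta_continuous : ContinuousOn η (profileInterval Z)
  delta_equation : ∀ z ∈ profileInterval Z, 0 < z →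
    HasDerivAt δ ((δ z / η z) ^ (1 - β) *
      (3 * (β - 4 / 3) / z * profileB β (δ z / η z) * η z
        - profileTheta G K κ ν * z * η z ^ (-(1 / 3) : ℝ) * δ z * (η z + α))) z
  eta_equation : ∀ z ∈ profileInterval Z, 0 < z →
    HasDerivAt η (-(3 / z) * (η z - δ z)) z

/-- `(δ, η)` is the strongly regular solution with central datum `δc` and `[0, Zmax)` is its maximal
interval of existence: every strongly regular solution with the same datum is a restriction of it. -/
structure IsMaximalProfile (G K κ ν β α δc : ℝ) (Zmax : EReal) (δ η : ℝ → ℝ) : Prop where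
  solution : IsStronglyRegularProfile G K κ ν β α δc Zmax δ η
  maximal : ∀ (Z : EReal) (δ' η' : ℝ → ℝ), IsStronglyRegularProfile G K κ ν β α δc Z δ' η' →
    Z ≤ Zmax ∧ ∀ z ∈ profileInterval Z, δ' z = δ z ∧ η' z = η z

end

/-! # Homologous motion of self-gravitating polytropic elastic balls

The profile system is singular at the center `z = 0` and, since `β > 1`, also where the density
vanishes. Both difficulties disappear in the unknown `u = δ ^ (β - 1)`. The second equation says
that `η` is the mean of `δ` over the ball of radius `z` (`ballMean`), and with `Y = u η ^ (1 - β)`,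
that is `Y = y ^ (β - 1)`, the first one becomes `u' = -(β - 1) ((4 - 3β) / (β (β - 1)) η ^ (β - 1)
Φ(Y) / z + θ z η ^ (β - 4/3) (η + α))`, where `Φ = shearPotential β` is nonnegative, `C¹` up to `Y =
0`, and has a double zero at the central value `Y = 1`. While `1 - Y = O(z)`, the quotient `Φ(Y) /
z` is thus Lipschitz in `Y` uniformly in `z`, so after truncation of `u`, `η` and `Y` the right-hand
side is a causal Lipschitz operator (`exists_isCausalLipschitz_profileOperator`), and the integral
equation is uniquely solvable by a contraction in an exponentially weighted norm. A local solution
fixes the constants of the truncation for which the global one solves the actual equation. The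
gravitational term forces `u' ≤ -c z`, so `u` reaches `0` at a finite `Zmax` (`exists_profile`). As
`δ` decreases, `η > δ`, that is `y < 1`; and as `η` stays positive, `y → 0` at `Zmax`. A strongly
regular solution of the original system solves a truncated problem on every compact interval, whence
uniqueness and maximality (`exists_maximalProfile`).

The scale factor is explicit: `ω = cosh² ψ` with `t = (cosh ψ sinh ψ + ψ) / √(2c)`; it is unique
since scale factors stay in `[1, ∞)`, where the equation is Lipschitz.

For `γ = 4/3` the pressures of the state `(δ / ω³, η / ω³)` are those of `(δ, η)`, shifted by `κ /
γ`, divided by `ω⁴`. Hence the momentum equation for a homologous ball reduces at all times to one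
equation in `x = r / ω`, and `pressure_balance` shows it to be equivalent to the equation for `δ` in
the profile system. The radial pressure has the sign of `y - y_b`, so the radius is the first zero
`Z` of `y - y_b`, and `p_rad ≤ p_tan` follows from Bernoulli's inequality `1 - y ^ β ≤ β (1 - y)`
and `ν ≤ 1/2`. Conversely, for any homologous ball the initial state is a strongly regular solution,
hence part of the maximal profile; its radius is `Z` by the sign of the pressure; and conservation
of mass makes `ρ ω³` constant along trajectories, which determines the ball at later times
(`IsHomologousBall.eq_profile`).
-/

/-! ### Causal integral equations -/

lemma integral_exp_weight_le {lam z : ℝ} (hlam : 0 < lam) :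
    ∫ s in (0 : ℝ)..z, Real.exp (lam * s) ≤ Real.exp (lam * z) / lam := by
  have h : ∀ s ∈ uIcc 0 z, HasDerivAt (fun s => Real.exp (lam * s) / lam) (Real.exp (lam * s)) s := by
    intro s _
    have := (((hasDerivAt_id s).const_mul lam).exp).div_const lam
    simp only [id, mul_one] at this
    rwa [mul_div_cancel_right₀ _ hlam.ne'] at this
  rw [intervalIntegral.integral_eq_sub_of_hasDerivAt h
    ((by fun_prop : Continuous fun s => Real.exp (lam * s)).intervalIntegrable _ _)]
  have : 0 < Real.exp (lam * 0) / lam := by positivity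
  linarith

/-- The operator `Ψ`, acting on continuous functions, is causal and Lipschitz on `[0, T]`: the value
of `Ψ u` at `z` depends only on `u` on `[0, z]`, in a Lipschitz way. -/
structure IsCausalLipschitz (Ψ : (ℝ → ℝ) → ℝ → ℝ) (T L : ℝ) : Prop where
  continuous : ∀ u, Continuous u → Continuous (Ψ u)
  lip : ∀ u v, Continuous u → Continuous v → ∀ z ∈ Icc 0 T, ∀ M,
    (∀ s ∈ Icc 0 z, |u s - v s| ≤ M) → |Ψ u z - Ψ v z| ≤ L * M

namespace IsCausalLipschitz

variable {Ψ : (ℝ → ℝ) → ℝ → ℝ} {T L : ℝ}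

/-- Gain of a factor `L / lam` in the exponentially weighted norm. -/
lemma abs_integral_sub_le (h : IsCausalLipschitz Ψ T L) {u v : ℝ → ℝ} (hu : Continuous u)
    (hv : Continuous v) {lam M z : ℝ} (hlam : 0 < lam) (hL : 0 ≤ L) (hM : 0 ≤ M)
    (hz : z ∈ Icc 0 T)
    (huv : ∀ s ∈ Icc 0 z, |u s - v s| ≤ M * Real.exp (lam * s)) :
    |(∫ s in (0 : ℝ)..z, Ψ u s) - ∫ s in (0 : ℝ)..z, Ψ v s|
      ≤ L / lam * (M * Real.exp (lam * z)) := by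
  have cu := h.continuous u hu
  have cv := h.continuous v hv
  rw [← intervalIntegral.integral_sub (cu.intervalIntegrable _ _) (cv.intervalIntegrable _ _)]
  have h1 : |∫ s in (0 : ℝ)..z, (Ψ u s - Ψ v s)|
      ≤ ∫ s in (0 : ℝ)..z, L * M * Real.exp (lam * s) := by
    rw [← Real.norm_eq_abs]
    refine intervalIntegral.norm_integral_le_of_norm_le hz.1 (Eventually.of_forall ?_)
      ((by fun_prop : Continuous fun s => L * M * Real.exp (lam * s)).intervalIntegrable _ _)
    intro s hs
    rw [Real.norm_eq_abs, mul_assoc]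
    refine h.lip u v hu hv s ⟨hs.1.le, hs.2.trans hz.2⟩ _ fun r hr => ?_
    refine (huv r ⟨hr.1, hr.2.trans hs.2⟩).trans ?_
    have := hr.2
    gcongr
  rw [intervalIntegral.integral_const_mul] at h1
  have h2 := integral_exp_weight_le (z := z) hlam
  calc _ ≤ _ := h1
    _ ≤ L * M * (Real.exp (lam * z) / lam) := by gcongr
    _ = _ := by ring

lemma eqOn_of_integral_eq (h : IsCausalLipschitz Ψ T L) (hL : 0 ≤ L) {u v : ℝ → ℝ} {a : ℝ}
    (hu : Continuous u) (hv : Continuous v)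
    (hu' : ∀ z ∈ Icc 0 T, u z = a + ∫ s in (0 : ℝ)..z, Ψ u s)
    (hv' : ∀ z ∈ Icc 0 T, v z = a + ∫ s in (0 : ℝ)..z, Ψ v s) : EqOn u v (Icc 0 T) := by
  rcases (Icc 0 T).eq_empty_or_nonempty with he | hne
  · rw [he]; exact fun x hx => hx.elim
  set lam := 2 * L + 1
  have hlam : 0 < lam := by positivity
  obtain ⟨z, hz, hmax⟩ := isCompact_Icc.exists_isMaxOn (s := Icc (0 : ℝ) T) hne
    (f := fun s => |u s - v s| * Real.exp (-(lam * s)))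
    (by fun_prop : Continuous _).continuousOn
  set M := |u z - v z| * Real.exp (-(lam * z)) with hMdef
  have hM : 0 ≤ M := by positivity
  have key : ∀ s ∈ Icc 0 T, |u s - v s| ≤ M * Real.exp (lam * s) := by
    intro s hs
    have h1 : |u s - v s| * Real.exp (-(lam * s)) ≤ M := hmax hs
    rw [Real.exp_neg, ← div_eq_mul_inv, div_le_iff₀ (Real.exp_pos _)] at h1
    exact h1
  have h2 := h.abs_integral_sub_le hu hv hlam hL hM hz
    fun s hs => key s ⟨hs.1, hs.2.trans hz.2⟩
  have h3 : |u z - v z| = M * Real.exp (lam * z) := by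
    rw [hMdef, mul_assoc, ← Real.exp_add]; simp
  have h4 : L / lam ≤ 1 / 2 := by
    rw [div_le_div_iff₀ hlam two_pos]; simp only [lam]; linarith
  have h5 : M * Real.exp (lam * z) ≤ 1 / 2 * (M * Real.exp (lam * z)) := by
    calc _ = |u z - v z| := h3.symm
      _ = |(∫ s in (0 : ℝ)..z, Ψ u s) - ∫ s in (0 : ℝ)..z, Ψ v s| := by
        rw [hu' z hz, hv' z hz]; congr 1; ring
      _ ≤ _ := h2
      _ ≤ _ := by gcongr
  have h6 : M * Real.exp (lam * z) = 0 := le_antisymm (by linarith) (by positivity)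
  have h7 : M = 0 := by
    rcases mul_eq_zero.1 h6 with h | h
    · exact h
    · exact absurd h (Real.exp_pos _).ne'
  intro s hs
  have := key s hs
  rw [h7, zero_mul] at this
  exact sub_eq_zero.1 (abs_nonpos_iff.1 this)

lemma exists_integral_eq (h : IsCausalLipschitz Ψ T L) (hL : 0 ≤ L) (hT : 0 ≤ T) (a : ℝ) :
    ∃ u : ℝ → ℝ, Continuous u ∧ ∀ z ∈ Icc 0 T, u z = a + ∫ s in (0 : ℝ)..z, Ψ u s := by
  set lam := 2 * L + 1
  have hlam : 0 < lam := by positivity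
  let ext : C(Icc (0 : ℝ) T, ℝ) → ℝ → ℝ := fun f z => Real.exp (lam * z) * IccExtend hT f z
  have hext : ∀ f, Continuous (ext f) := fun f => by
    have := f.continuous.Icc_extend' (h := hT)
    fun_prop
  have hint : ∀ f, Continuous fun z => ∫ s in (0 : ℝ)..z, Ψ (ext f) s := fun f =>
    intervalIntegral.continuous_primitive
      (fun a b => (h.continuous _ (hext f)).intervalIntegrable a b) 0
  let F : C(Icc (0 : ℝ) T, ℝ) → C(Icc (0 : ℝ) T, ℝ) := fun f =>
    ⟨fun z => Real.exp (-(lam * z)) * (a + ∫ s in (0 : ℝ)..z, Ψ (ext f) s), by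
      have := (hint f).comp (continuous_subtype_val (p := fun x => x ∈ Icc 0 T))
      simp only [Function.comp_def] at this
      fun_prop⟩
  have hF : ContractingWith (1 / 2) F := by
    refine ⟨by rw [← NNReal.coe_lt_coe]; norm_num, LipschitzWith.of_dist_le_mul fun f g => ?_⟩
    rw [ContinuousMap.dist_le (by positivity)]
    intro z
    have h1 : ∀ s ∈ Icc 0 (z : ℝ), |ext f s - ext g s| ≤ dist f g * Real.exp (lam * s) := by
      intro s hs
      have hs' : s ∈ Icc 0 T := ⟨hs.1, hs.2.trans z.2.2⟩
      simp only [ext, IccExtend_of_mem hT _ hs']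
      rw [← mul_sub, abs_mul, abs_of_pos (Real.exp_pos _), mul_comm]
      gcongr
      exact ContinuousMap.dist_apply_le_dist (f := f) (g := g) _
    have h2 := h.abs_integral_sub_le (hext f) (hext g) hlam hL dist_nonneg z.2 h1
    have h4 : L / lam ≤ 1 / 2 := by
      rw [div_le_div_iff₀ hlam two_pos]; simp only [lam]; linarith
    have e : Real.exp (-(lam * z)) * Real.exp (lam * z) = 1 := by rw [← Real.exp_add]; simp
    calc dist (F f z) (F g z)
        = Real.exp (-(lam * z)) *
          |(∫ s in (0 : ℝ)..z, Ψ (ext f) s) - ∫ s in (0 : ℝ)..z, Ψ (ext g) s| := by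
          simp only [F, ContinuousMap.coe_mk, Real.dist_eq]
          rw [← mul_sub, abs_mul, abs_of_pos (Real.exp_pos _), add_sub_add_left_eq_sub]
      _ ≤ Real.exp (-(lam * z)) * (L / lam * (dist f g * Real.exp (lam * z))) := by gcongr
      _ = L / lam * dist f g * (Real.exp (-(lam * z)) * Real.exp (lam * z)) := by ring
      _ ≤ 1 / 2 * dist f g * (Real.exp (-(lam * z)) * Real.exp (lam * z)) := by gcongr
      _ = _ := by rw [e]; simp
  have : Nonempty C(Icc (0 : ℝ) T, ℝ) := ⟨0⟩
  obtain ⟨f, hf⟩ : ∃ f, F f = f := ⟨_, hF.fixedPoint_isFixedPt⟩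
  refine ⟨ext f, hext f, fun z hz => ?_⟩
  have h1 : ext f z = Real.exp (lam * z) * F f ⟨z, hz⟩ := by
    simp only [ext, IccExtend_of_mem hT _ hz, hf]
  rw [h1]
  simp only [F, ContinuousMap.coe_mk]
  rw [← mul_assoc, ← Real.exp_add]; simp

/-- A solution of the causal equation `u' = Ψ u` on `[0, T]`, continued as a `C¹` function to the
whole line, as a constant to the left of `0`. -/
lemma exists_hasDerivAt (h : IsCausalLipschitz Ψ T L) (hL : 0 ≤ L) (hT : 0 ≤ T)
    (h0 : ∀ u, Continuous u → Ψ u 0 = 0) (a : ℝ) :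
    ∃ u g : ℝ → ℝ, Continuous g ∧ (∀ z, HasDerivAt u (g z) z) ∧ u 0 = a ∧
      (∀ z ≤ 0, g z = 0) ∧ ∀ z ∈ Icc 0 T, g z = Ψ u z := by
  obtain ⟨v, hv, hv'⟩ := h.exists_integral_eq hL hT a
  have cΨ := h.continuous v hv
  have cg : Continuous fun z => Ψ v (max z 0) := by fun_prop
  have hd : ∀ z, HasDerivAt (fun z => a + ∫ s in (0 : ℝ)..z, Ψ v (max s 0)) (Ψ v (max z 0)) z :=
    fun z => (intervalIntegral.integral_hasDerivAt_right (cg.intervalIntegrable _ _)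
      cg.stronglyMeasurable.stronglyMeasurableAtFilter cg.continuousAt).const_add a
  refine ⟨_, fun z => Ψ v (max z 0), cg, hd, by simp, fun z hz => ?_, fun z hz => ?_⟩
  · simp [max_eq_right hz, h0 v hv]
  · have hu : Continuous fun z => a + ∫ s in (0 : ℝ)..z, Ψ v (max s 0) :=
      continuous_iff_continuousAt.2 fun z => (hd z).continuousAt
    have := h.lip v _ hv hu z hz 0 fun s hs => by
      rw [hv' s ⟨hs.1, hs.2.trans hz.2⟩]
      have : ∫ r in (0 : ℝ)..s, Ψ v r = ∫ r in (0 : ℝ)..s, Ψ v (max r 0) := by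
        refine intervalIntegral.integral_congr fun r hr => ?_
        rw [uIcc_of_le hs.1] at hr
        simp [max_eq_left hr.1]
      simp [this]
    rw [mul_zero] at this
    simp only [max_eq_left hz.1]
    exact sub_eq_zero.1 (abs_nonpos_iff.1 this)

lemma eqOn_of_hasDerivAt (h : IsCausalLipschitz Ψ T L) (hL : 0 ≤ L) {u v : ℝ → ℝ}
    (hu : Continuous u) (hv : Continuous v)
    (hu' : ∀ z ∈ Ioo 0 T, HasDerivAt u (Ψ u z) z) (hv' : ∀ z ∈ Ioo 0 T, HasDerivAt v (Ψ v z) z)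
    (h0 : u 0 = v 0) : EqOn u v (Icc 0 T) := by
  have key : ∀ w : ℝ → ℝ, Continuous w → (∀ z ∈ Ioo 0 T, HasDerivAt w (Ψ w z) z) →
      ∀ z ∈ Icc 0 T, w z = w 0 + ∫ s in (0 : ℝ)..z, Ψ w s := by
    intro w hw hw' z hz
    rw [intervalIntegral.integral_eq_sub_of_hasDerivAt_of_le hz.1 hw.continuousOn
      (fun s hs => hw' s ⟨hs.1, hs.2.trans_le hz.2⟩)
      ((h.continuous w hw).intervalIntegrable _ _)]
    ring
  exact h.eqOn_of_integral_eq hL hu hv (key u hu hu') (h0 ▸ key v hv hv')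

end IsCausalLipschitz

/-! ### Averages over balls -/

/-- The mean of the radial function `f` over the ball of radius `z` in three-dimensional space. -/
noncomputable def ballMean (f : ℝ → ℝ) (z : ℝ) : ℝ := 3 * ∫ τ in (0 : ℝ)..1, τ ^ 2 * f (z * τ)

lemma continuous_ballMean {f : ℝ → ℝ} (hf : Continuous f) : Continuous (ballMean f) := by
  unfold ballMean
  refine continuous_const.mul
    (intervalIntegral.continuous_parametric_intervalIntegral_of_continuous' ?_ _ _)
  fun_prop

lemma pow_mul_ballMean (f : ℝ → ℝ) (z : ℝ) :
    z ^ 3 * ballMean f z = 3 * ∫ s in (0 : ℝ)..z, s ^ 2 * f s := by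
  rcases eq_or_ne z 0 with rfl | hz
  · simp
  · have := intervalIntegral.integral_comp_mul_left (a := 0) (b := 1)
      (f := fun s => s ^ 2 * f s) hz
    simp only [mul_zero, mul_one, smul_eq_mul] at this
    have h2 : ∫ s in (0 : ℝ)..z, s ^ 2 * f s = z * ∫ τ in (0 : ℝ)..1, (z * τ) ^ 2 * f (z * τ) := by
      rw [this]; field_simp
    rw [h2, ballMean]
    have h3 : ∫ τ in (0 : ℝ)..1, (z * τ) ^ 2 * f (z * τ)
        = z ^ 2 * ∫ τ in (0 : ℝ)..1, τ ^ 2 * f (z * τ) := by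
      rw [← intervalIntegral.integral_const_mul]
      congr 1; ext τ; ring
    rw [h3]; ring

lemma ballMean_const (c z : ℝ) : ballMean (fun _ => c) z = c := by
  simp [ballMean]; norm_num; ring

lemma ballMean_zero (f : ℝ → ℝ) : ballMean f 0 = f 0 := by
  have := ballMean_const (f 0) 0
  simpa [ballMean] using this

lemma ballMean_congr {f g : ℝ → ℝ} {z : ℝ} (hz : 0 ≤ z) (h : ∀ s ∈ Icc 0 z, f s = g s) :
    ballMean f z = ballMean g z := by
  unfold ballMean
  congr 1
  refine intervalIntegral.integral_congr fun τ hτ => ?_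
  rw [uIcc_of_le zero_le_one] at hτ
  rw [h _ ⟨mul_nonneg hz hτ.1, mul_le_of_le_one_right hz hτ.2⟩]

lemma ballMean_mono {f g : ℝ → ℝ} {z : ℝ} (hf : Continuous f) (hg : Continuous g) (hz : 0 ≤ z)
    (h : ∀ s ∈ Icc 0 z, f s ≤ g s) : ballMean f z ≤ ballMean g z := by
  unfold ballMean
  gcongr
  refine intervalIntegral.integral_mono_on zero_le_one
    ((by fun_prop : Continuous fun τ => τ ^ 2 * f (z * τ)).intervalIntegrable _ _)
    ((by fun_prop : Continuous fun τ => τ ^ 2 * g (z * τ)).intervalIntegrable _ _) fun τ hτ => ?_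
  gcongr
  exact h _ ⟨mul_nonneg hz hτ.1, mul_le_of_le_one_right hz hτ.2⟩

lemma ballMean_le {f : ℝ → ℝ} {z c : ℝ} (hf : Continuous f) (hz : 0 ≤ z)
    (h : ∀ s ∈ Icc 0 z, f s ≤ c) : ballMean f z ≤ c := by
  simpa [ballMean_const] using ballMean_mono hf continuous_const hz h

lemma le_ballMean {f : ℝ → ℝ} {z c : ℝ} (hf : Continuous f) (hz : 0 ≤ z)
    (h : ∀ s ∈ Icc 0 z, c ≤ f s) : c ≤ ballMean f z := by
  simpa [ballMean_const] using ballMean_mono continuous_const hf hz h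

lemma ballMean_sub {f g : ℝ → ℝ} (hf : Continuous f) (hg : Continuous g) (z : ℝ) :
    ballMean f z - ballMean g z = ballMean (fun s => f s - g s) z := by
  unfold ballMean
  rw [← mul_sub, ← intervalIntegral.integral_sub
    ((by fun_prop : Continuous fun τ => τ ^ 2 * f (z * τ)).intervalIntegrable _ _)
    ((by fun_prop : Continuous fun τ => τ ^ 2 * g (z * τ)).intervalIntegrable _ _)]
  congr 2; ext τ; ring

lemma abs_ballMean_sub_le {f g : ℝ → ℝ} {z M : ℝ} (hf : Continuous f) (hg : Continuous g)
    (hz : 0 ≤ z) (h : ∀ s ∈ Icc 0 z, |f s - g s| ≤ M) : |ballMean f z - ballMean g z| ≤ M := by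
  rw [ballMean_sub hf hg, abs_le]
  exact ⟨le_ballMean (hf.sub hg) hz fun s hs => (abs_le.1 (h s hs)).1,
    ballMean_le (hf.sub hg) hz fun s hs => (abs_le.1 (h s hs)).2⟩

lemma hasDerivAt_ballMean {f : ℝ → ℝ} (hf : Continuous f) {z : ℝ} (hz : 0 < z) :
    HasDerivAt (ballMean f) (-(3 / z) * (ballMean f z - f z)) z := by
  have c : Continuous fun s => s ^ 2 * f s := by fun_prop
  have h1 : HasDerivAt (fun z => 3 * ∫ s in (0 : ℝ)..z, s ^ 2 * f s) (3 * (z ^ 2 * f z)) z :=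
    (intervalIntegral.integral_hasDerivAt_right (c.intervalIntegrable _ _)
      c.stronglyMeasurable.stronglyMeasurableAtFilter c.continuousAt).const_mul 3
  have h2 := h1.div (hasDerivAt_pow 3 z) (pow_ne_zero 3 hz.ne')
  have h3 : HasDerivAt (ballMean f) _ z := h2.congr_of_eventuallyEq (by
    filter_upwards [lt_mem_nhds hz] with s hs
    simp only [Pi.div_apply]
    rw [← pow_mul_ballMean f s]
    have := hs.ne'
    field_simp)
  convert h3 using 1
  rw [← pow_mul_ballMean f z]
  have := hz.ne'
  field_simp
  push_cast
  ring

/-- The integral over a ball of a function that is nonnegative outside a smaller ball is at least the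
integral over the latter. -/
lemma le_pow_mul_ballMean {f : ℝ → ℝ} (hf : Continuous f) {a z : ℝ} (haz : a ≤ z)
    (h : ∀ s ∈ Icc a z, 0 ≤ f s) : a ^ 3 * ballMean f a ≤ z ^ 3 * ballMean f z := by
  rw [pow_mul_ballMean, pow_mul_ballMean]
  have c : Continuous fun s => s ^ 2 * f s := by fun_prop
  have := intervalIntegral.integral_add_adjacent_intervals
    (c.intervalIntegrable 0 a) (c.intervalIntegrable (μ := MeasureTheory.volume) a z)
  have h2 : 0 ≤ ∫ s in a..z, s ^ 2 * f s :=
    intervalIntegral.integral_nonneg haz fun s hs => mul_nonneg (sq_nonneg _) (h s hs)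
  linarith

/-! ### Uniformly Lipschitz fields -/

/-- The truncation of `x` to the interval `[a, b]`. -/
def truncate (a b x : ℝ) : ℝ := max a (min b x)

lemma truncate_mem {a b : ℝ} (h : a ≤ b) (x : ℝ) : truncate a b x ∈ Icc a b :=
  ⟨le_max_left _ _, max_le h (min_le_left _ _)⟩

lemma truncate_of_mem {a b x : ℝ} (h : x ∈ Icc a b) : truncate a b x = x := by
  rw [truncate, min_eq_right h.2, max_eq_right h.1]

lemma abs_max_min_sub_le (a b x y : ℝ) : |max (min x a) b - max (min y a) b| ≤ |x - y| := by
  refine (abs_max_sub_max_le_abs _ _ _).trans ?_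
  simpa using abs_min_sub_min_le_max x a y a

lemma abs_truncate_sub_le (a b x y : ℝ) : |truncate a b x - truncate a b y| ≤ |x - y| := by
  have := abs_max_min_sub_le b a x y
  simpa only [truncate, max_comm, min_comm] using this

lemma continuous_truncate (a b : ℝ) : Continuous (truncate a b) := by
  unfold truncate; fun_prop

/-- The field `f z u η` is bounded and Lipschitz in `(u, η) ∈ ℝ²`, uniformly for `z ∈ [0, T]`. -/
def IsUnifLipschitz (T : ℝ) (f : ℝ → ℝ → ℝ → ℝ) : Prop :=
  ∃ C, 0 ≤ C ∧ ∀ z ∈ Icc 0 T, ∀ u η u' η',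
    |f z u η| ≤ C ∧ |f z u η - f z u' η'| ≤ C * (|u - u'| + |η - η'|)

namespace IsUnifLipschitz

variable {T : ℝ} {f g : ℝ → ℝ → ℝ → ℝ}

lemma add (hf : IsUnifLipschitz T f) (hg : IsUnifLipschitz T g) :
    IsUnifLipschitz T (fun z u η => f z u η + g z u η) := by
  obtain ⟨C, hC, h⟩ := hf
  obtain ⟨D, hD, h'⟩ := hg
  refine ⟨C + D, by positivity, fun z hz u η u' η' => ⟨?_, ?_⟩⟩
  · exact (abs_add_le _ _).trans (add_le_add (h z hz u η u' η').1 (h' z hz u η u' η').1)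
  · rw [add_sub_add_comm, add_mul]
    exact (abs_add_le _ _).trans (add_le_add (h z hz u η u' η').2 (h' z hz u η u' η').2)

lemma mul (hf : IsUnifLipschitz T f) (hg : IsUnifLipschitz T g) :
    IsUnifLipschitz T (fun z u η => f z u η * g z u η) := by
  obtain ⟨C, hC, h⟩ := hf
  obtain ⟨D, hD, h'⟩ := hg
  refine ⟨C * D + D * C, by positivity, fun z hz u η u' η' => ⟨?_, ?_⟩⟩
  · rw [abs_mul]
    have := mul_le_mul (h z hz u η u' η').1 (h' z hz u η u' η').1 (abs_nonneg _) hC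
    nlinarith [mul_nonneg hC hD]
  · have e : f z u η * g z u η - f z u' η' * g z u' η'
        = f z u η * (g z u η - g z u' η') + g z u' η' * (f z u η - f z u' η') := by ring
    rw [e, add_mul, mul_assoc, mul_assoc]
    refine (abs_add_le _ _).trans (add_le_add ?_ ?_)
    · rw [abs_mul]
      exact mul_le_mul (h z hz u η u' η').1 (h' z hz u η u' η').2 (abs_nonneg _) hC
    · rw [abs_mul]
      exact mul_le_mul (h' z hz u' η' u η).1 (h z hz u η u' η').2 (abs_nonneg _) hD

lemma of_bounded {a : ℝ → ℝ} {A : ℝ} (h : ∀ z ∈ Icc 0 T, |a z| ≤ A) :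
    IsUnifLipschitz T (fun z _ _ => a z) :=
  ⟨|A|, abs_nonneg _, fun z hz u η u' η' => ⟨(h z hz).trans (le_abs_self _), by
    simp only [sub_self, abs_zero]; positivity⟩⟩

lemma const (a : ℝ) : IsUnifLipschitz T (fun _ _ _ => a) := of_bounded fun _ _ => le_rfl

end IsUnifLipschitz

/-- A continuously differentiable function on a compact interval is bounded and Lipschitz there. -/
lemma exists_lipschitz_bound {f f' : ℝ → ℝ} {a b : ℝ}
    (h : ∀ x ∈ Icc a b, HasDerivAt f (f' x) x) (hc : ContinuousOn f' (Icc a b)) :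
    ∃ C, 0 ≤ C ∧ ∀ x ∈ Icc a b, |f x| ≤ C ∧ ∀ y ∈ Icc a b, |f x - f y| ≤ C * |x - y| := by
  obtain ⟨C, hC⟩ := isCompact_Icc.exists_bound_of_continuousOn hc
  obtain ⟨D, hD⟩ := isCompact_Icc.exists_bound_of_continuousOn
    (fun x hx => (h x hx).continuousAt.continuousWithinAt : ContinuousOn f (Icc a b))
  refine ⟨max (max C D) 0, le_max_right _ _, fun x hx => ⟨?_, fun y hy => ?_⟩⟩
  · exact (hD x hx).trans ((le_max_right _ _).trans (le_max_left _ _))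
  · have := (convex_Icc a b).norm_image_sub_le_of_norm_hasDerivWithin_le
      (fun x hx => (h x hx).hasDerivWithinAt) hC hy hx
    refine this.trans ?_
    rw [Real.norm_eq_abs]
    gcongr
    exact (le_max_left _ _).trans (le_max_left _ _)

lemma exists_lipschitz_rpow {a b r : ℝ} (h : 0 < a ∨ (0 ≤ a ∧ 1 ≤ r)) :
    ∃ C, 0 ≤ C ∧ ∀ x ∈ Icc a b, |x ^ r| ≤ C ∧ ∀ y ∈ Icc a b, |x ^ r - y ^ r| ≤ C * |x - y| := by
  have h' : ∀ x ∈ Icc a b, x ≠ 0 ∨ 1 ≤ r := fun x hx =>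
    h.imp (fun h => (h.trans_le hx.1).ne') And.right
  refine exists_lipschitz_bound (f' := fun x => r * x ^ (r - 1))
    (fun x hx => Real.hasDerivAt_rpow_const (h' x hx)) fun x hx => ?_
  refine (continuousAt_const.mul (Real.continuousAt_rpow_const _ _ ?_)).continuousWithinAt
  exact (h' x hx).imp id fun h => by linarith

lemma IsUnifLipschitz.rpow_eta {T m M : ℝ} (hm : 0 < m) (hM : m ≤ M) (r : ℝ) :
    IsUnifLipschitz T (fun _ _ η => truncate m M η ^ r) := by
  obtain ⟨C, hC, h⟩ := exists_lipschitz_rpow (a := m) (b := M) (r := r) (Or.inl hm)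
  refine ⟨C, hC, fun z _ u η u' η' => ⟨(h _ (truncate_mem hM η)).1, ?_⟩⟩
  refine ((h _ (truncate_mem hM η)).2 _ (truncate_mem hM η')).trans ?_
  have := abs_truncate_sub_le m M η η'
  gcongr
  linarith [abs_nonneg (u - u')]

lemma IsUnifLipschitz.truncate_eta {T m M : ℝ} (hM : m ≤ M) :
    IsUnifLipschitz T (fun _ _ η => truncate m M η) := by
  refine ⟨max (max |m| |M|) 1, by positivity, fun z _ u η u' η' => ⟨?_, ?_⟩⟩
  · have := truncate_mem hM η
    exact (abs_le_max_abs_abs this.1 this.2).trans (le_max_left _ _)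
  · calc _ ≤ |η - η'| := abs_truncate_sub_le m M η η'
      _ ≤ 1 * (|u - u'| + |η - η'|) := by linarith [abs_nonneg (u - u')]
      _ ≤ _ := by gcongr; exact le_max_right _ _

lemma IsUnifLipschitz.truncate_u {T m M : ℝ} (hM : m ≤ M) :
    IsUnifLipschitz T (fun _ u _ => truncate m M u) := by
  refine ⟨max (max |m| |M|) 1, by positivity, fun z _ u η u' η' => ⟨?_, ?_⟩⟩
  · have := truncate_mem hM u
    exact (abs_le_max_abs_abs this.1 this.2).trans (le_max_left _ _)
  · calc _ ≤ |u - u'| := abs_truncate_sub_le m M u u'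
      _ ≤ 1 * (|u - u'| + |η - η'|) := by linarith [abs_nonneg (η - η')]
      _ ≤ _ := by gcongr; exact le_max_right _ _

/-! ### The desingularized profile field -/

/-- The function `β (β - 1) B(y) / y`, written in terms of `Y = y ^ (β - 1)`. It has a double zero
at `Y = 1` and is continuously differentiable up to `Y = 0`. -/
noncomputable def shearPotential (β Y : ℝ) : ℝ := 1 + (β - 1) * Y ^ (β / (β - 1)) - β * Y

lemma shearPotential_one (β : ℝ) : shearPotential β 1 = 0 := by
  simp [shearPotential]

lemma one_le_exponent {β : ℝ} (hβ : 1 < β) : 1 ≤ β / (β - 1) := by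
  rw [le_div_iff₀ (by linarith)]; linarith

lemma hasDerivAt_shearPotential {β : ℝ} (hβ : 1 < β) (Y : ℝ) :
    HasDerivAt (shearPotential β) (-(β * (1 - Y ^ (1 / (β - 1))))) Y := by
  have h1 : HasDerivAt (fun Y : ℝ => Y ^ (β / (β - 1))) _ Y :=
    Real.hasDerivAt_rpow_const (Or.inr (one_le_exponent hβ))
  have h2 := ((h1.const_mul (β - 1)).const_add 1).sub ((hasDerivAt_id Y).const_mul β)
  have hb : β - 1 ≠ 0 := by linarith
  have e : β / (β - 1) - 1 = 1 / (β - 1) := by field_simp; ring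
  refine h2.congr_deriv ?_
  rw [e]
  field_simp
  ring

lemma continuous_shearPotential {β : ℝ} (hβ : 1 < β) : Continuous (shearPotential β) :=
  continuous_iff_continuousAt.2 fun Y => (hasDerivAt_shearPotential hβ Y).continuousAt

/-- Near the double zero `Y = 1` the Lipschitz constant is of the order of the distance to it. -/
lemma abs_shearPotential_sub_le {β c x y : ℝ} (hβ : 1 < β) (hβ₂ : β ≤ 2)
    (hx : x ∈ Icc 0 1) (hy : y ∈ Icc 0 1) (hx' : 1 - c ≤ x) (hy' : 1 - c ≤ y) :
    |shearPotential β x - shearPotential β y| ≤ β / (β - 1) * c * |x - y| := by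
  have hb : 0 < β - 1 := by linarith
  refine (convex_Icc (max 0 (1 - c)) 1).norm_image_sub_le_of_norm_hasDerivWithin_le
    (f := shearPotential β)
    (fun x _ => (hasDerivAt_shearPotential hβ x).hasDerivWithinAt) (fun Y hY => ?_)
    ⟨max_le hy.1 hy', hy.2⟩ ⟨max_le hx.1 hx', hx.2⟩
  have hY0 : 0 ≤ Y := (le_max_left _ _).trans hY.1
  have hYc : 1 - c ≤ Y := (le_max_right _ _).trans hY.1
  have hp : 1 ≤ 1 / (β - 1) := by rw [le_div_iff₀ hb]; linarith
  have h1 : Y ^ (1 / (β - 1)) ≤ 1 := Real.rpow_le_one hY0 hY.2 (by positivity)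
  have h2 := one_add_mul_self_le_rpow_one_add (s := Y - 1) (by linarith) hp
  rw [add_sub_cancel] at h2
  rw [Real.norm_eq_abs, abs_neg, abs_of_nonneg (mul_nonneg (by linarith) (by linarith))]
  calc β * (1 - Y ^ (1 / (β - 1))) ≤ β * (1 / (β - 1) * c) := by
        gcongr
        have : 1 / (β - 1) * (1 - Y) ≤ 1 / (β - 1) * c := by gcongr; linarith
        linarith
    _ = _ := by ring

lemma shearPotential_nonneg {β Y : ℝ} (hβ : 1 < β) (hY : 0 ≤ Y) : 0 ≤ shearPotential β Y := by
  have h2 := one_add_mul_self_le_rpow_one_add (s := Y - 1) (by linarith) (one_le_exponent hβ)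
  rw [add_sub_cancel] at h2
  have hb : 0 < β - 1 := by linarith
  have h3 : (β - 1) * (1 + β / (β - 1) * (Y - 1)) ≤ (β - 1) * Y ^ (β / (β - 1)) := by gcongr
  have h4 : (β - 1) * (1 + β / (β - 1) * (Y - 1)) = β - 1 + β * (Y - 1) := by field_simp
  unfold shearPotential
  linarith

lemma abs_shearPotential_le {β c x : ℝ} (hβ : 1 < β) (hβ₂ : β ≤ 2) (hc : 0 ≤ c)
    (hx : x ∈ Icc 0 1) (hx' : 1 - c ≤ x) : |shearPotential β x| ≤ β / (β - 1) * c ^ 2 := by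
  have h := abs_shearPotential_sub_le hβ hβ₂ hx ⟨zero_le_one, le_rfl⟩ hx' (by linarith)
  rw [shearPotential_one, sub_zero] at h
  have hb : 0 < β - 1 := by linarith
  calc _ ≤ _ := h
    _ ≤ β / (β - 1) * c * c := by
      gcongr
      rw [abs_sub_comm, abs_of_nonneg (by linarith [hx.2])]
      linarith
    _ = _ := by ring

/-- The right-hand side of the equation for `u = δ ^ (β - 1)`, in terms of `u`, of
`η` and of the shear variable `Y`, which is `u η ^ (1 - β)` for the actual equation. -/
noncomputable def shearField (β θ α z Y η : ℝ) : ℝ :=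
  -(β - 1) * ((4 - 3 * β) / (β * (β - 1)) * η ^ (β - 1) * (shearPotential β Y / z)
    + θ * z * (η ^ (β - 4 / 3) * (η + α)))

/-- The shear variable, truncated to `[max 0 (1 - k z), 1]`, for truncated arguments: `u` to
`[0, d ^ (β - 1)]` and `η` to `[m, d]`. -/
noncomputable def truncatedShear (β d m k z u η : ℝ) : ℝ :=
  max (min (truncate 0 (d ^ (β - 1)) u * truncate m d η ^ (1 - β)) 1) (1 - k * z)

/-- The density belonging to `u = δ ^ (β - 1)`, truncated to `[0, d]`. -/
noncomputable def truncatedDensity (β d u : ℝ) : ℝ := truncate 0 (d ^ (β - 1)) u ^ (1 / (β - 1))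

/-- The right-hand side of the truncated profile equation as a causal operator; `η` is the mean
density. For `z ≤ 0` it vanishes: there the truncated shear is `1`, and the quotient by `z` in
`shearField` is a quotient by zero, whose value `0` is also the limit from the right. -/
noncomputable def profileOperator (β θ α d m k : ℝ) (u : ℝ → ℝ) (z : ℝ) : ℝ :=
  shearField β θ α (max z 0)
    (truncatedShear β d m k (max z 0) (u (max z 0))
      (ballMean (fun s => truncatedDensity β d (u s)) (max z 0)))
    (truncate m d (ballMean (fun s => truncatedDensity β d (u s)) (max z 0)))

section
variable {β θ α d m k T : ℝ}

lemma truncatedShear_mem (hm : 0 < m) (hd : m ≤ d) (hk : 0 ≤ k) {z : ℝ} (hz : 0 ≤ z)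
    (u η : ℝ) : truncatedShear β d m k z u η ∈ Icc 0 1 ∧
      1 - k * z ≤ truncatedShear β d m k z u η := by
  have h1 := (truncate_mem (Real.rpow_nonneg (hm.le.trans hd) (β - 1)) u).1
  have h2 : 0 ≤ truncate m d η ^ (1 - β) :=
    Real.rpow_nonneg (hm.le.trans (truncate_mem hd η).1) _
  exact ⟨⟨(le_min (mul_nonneg h1 h2) zero_le_one).trans (le_max_left _ _),
    max_le (min_le_right _ _) (by nlinarith)⟩, le_max_right _ _⟩

lemma abs_shearPotential_div_le (hβ : 1 < β) (hβ₂ : β ≤ 2) (hm : 0 < m) (hd : m ≤ d) (hk : 0 ≤ k)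
    {z : ℝ} (hz : 0 ≤ z) (u η : ℝ) :
    |shearPotential β (truncatedShear β d m k z u η) / z| ≤ β / (β - 1) * k ^ 2 * z := by
  have hb : 0 < β - 1 := by linarith
  obtain ⟨h1, h2⟩ := truncatedShear_mem (β := β) hm hd hk hz u η
  rcases hz.eq_or_lt with rfl | hz'
  · simp
  rw [abs_div, abs_of_pos hz', div_le_iff₀ hz']
  refine (abs_shearPotential_le hβ hβ₂ (by positivity) h1 h2).trans_eq ?_
  ring

lemma isUnifLipschitz_shearPotential_div (hβ : 1 < β) (hβ₂ : β ≤ 2) (hm : 0 < m) (hd : m ≤ d)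
    (hk : 0 ≤ k) :
    IsUnifLipschitz T
      (fun z u η => shearPotential β (truncatedShear β d m k z u η) / z) := by
  have hb : 0 < β - 1 := by linarith
  obtain ⟨C, hC, h⟩ := (IsUnifLipschitz.truncate_u (T := T)
    (Real.rpow_nonneg (hm.le.trans hd) (β - 1))).mul
      (IsUnifLipschitz.rpow_eta (T := T) hm hd (1 - β))
  set q := β / (β - 1)
  have hq : 0 ≤ q := by positivity
  refine ⟨max (q * k ^ 2 * |T|) (q * k * C), by positivity, fun z hz u η u' η' => ⟨?_, ?_⟩⟩
  · refine (abs_shearPotential_div_le hβ hβ₂ hm hd hk hz.1 u η).trans ?_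
    refine le_trans ?_ (le_max_left _ _)
    gcongr
    exact hz.2.trans (le_abs_self _)
  · obtain ⟨h1, h2⟩ := truncatedShear_mem (β := β) hm hd hk hz.1 u η
    obtain ⟨h1', h2'⟩ := truncatedShear_mem (β := β) hm hd hk hz.1 u' η'
    rcases hz.1.eq_or_lt with rfl | hz'
    · simp; positivity
    rw [← sub_div, abs_div, abs_of_pos hz', div_le_iff₀ hz']
    have h3 := abs_shearPotential_sub_le hβ hβ₂ (c := k * z) h1 h1' h2 h2'
    have h4 : |truncatedShear β d m k z u η - truncatedShear β d m k z u' η'|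
        ≤ C * (|u - u'| + |η - η'|) :=
      (abs_max_min_sub_le _ _ _ _).trans (h z hz u η u' η').2
    calc _ ≤ _ := h3
      _ ≤ q * (k * z) * (C * (|u - u'| + |η - η'|)) := by gcongr
      _ = q * k * C * (|u - u'| + |η - η'|) * z := by ring
      _ ≤ _ := by gcongr; exact le_max_right _ _

lemma isUnifLipschitz_truncatedField (hβ : 1 < β) (hβ₂ : β ≤ 2) (hm : 0 < m) (hd : m ≤ d)
    (hk : 0 ≤ k) :
    IsUnifLipschitz T
      (fun z u η => shearField β θ α z (truncatedShear β d m k z u η) (truncate m d η)) := by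
  unfold shearField
  refine (IsUnifLipschitz.const _).mul (.add (.mul (.mul (.const _) (.rpow_eta hm hd _))
    (isUnifLipschitz_shearPotential_div hβ hβ₂ hm hd hk))
    (.mul (.of_bounded (A := |θ| * |T|) fun z hz => ?_)
      ((IsUnifLipschitz.rpow_eta hm hd _).mul ((IsUnifLipschitz.truncate_eta hd).add (.const _)))))
  rw [abs_mul]
  gcongr
  · exact hz.1
  · exact hz.2

lemma continuous_truncatedDensity (hβ : 1 < β) (d : ℝ) : Continuous (truncatedDensity β d) := by
  have hb : 0 < β - 1 := by linarith
  exact (continuous_truncate _ _).rpow_const fun _ => Or.inr (by positivity)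

lemma exists_abs_truncatedDensity_sub_le (hβ : 1 < β) (hβ₂ : β ≤ 2) (hd : 0 ≤ d) :
    ∃ C, 0 ≤ C ∧ ∀ x y, |truncatedDensity β d x - truncatedDensity β d y| ≤ C * |x - y| := by
  have hb : 0 < β - 1 := by linarith
  obtain ⟨C, hC, h⟩ := exists_lipschitz_rpow (a := 0) (b := d ^ (β - 1)) (r := 1 / (β - 1))
    (Or.inr ⟨le_rfl, by rw [le_div_iff₀ hb]; linarith⟩)
  refine ⟨C, hC, fun x y => ?_⟩
  have h0 := Real.rpow_nonneg hd (β - 1)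
  refine ((h _ (truncate_mem h0 x)).2 _ (truncate_mem h0 y)).trans ?_
  exact mul_le_mul_of_nonneg_left (abs_truncate_sub_le _ _ _ _) hC

/-- A quotient by the positive part of `z` is continuous if the numerator is `O(z²)`. -/
lemma continuous_div_posPart {n : ℝ → ℝ} (hn : Continuous n) {C : ℝ}
    (h : ∀ z, |n z / max z 0| ≤ C * max z 0) : Continuous fun z => n z / max z 0 := by
  refine continuous_iff_continuousAt.2 fun z => ?_
  rcases lt_or_ge 0 z with hz | hz
  · exact hn.continuousAt.div (by fun_prop) (by rw [max_eq_left hz.le]; exact hz.ne')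
  · have e : n z / max z 0 = 0 := by rw [max_eq_right hz, div_zero]
    simp only [ContinuousAt, e]
    refine squeeze_zero_norm h ?_
    have : Continuous fun z : ℝ => C * max z 0 := by fun_prop
    simpa [max_eq_right hz] using this.tendsto z

lemma continuous_profileOperator (hβ : 1 < β) (hβ₂ : β ≤ 2) (hm : 0 < m) (hd : m ≤ d)
    (hk : 0 ≤ k) {u : ℝ → ℝ} (hu : Continuous u) :
    Continuous (profileOperator β θ α d m k u) := by
  have c1 := continuous_ballMean ((continuous_truncatedDensity hβ d).comp hu)
  simp only [Function.comp_def] at c1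
  have c2 := (continuous_truncate m d).comp c1
  have c3 := (continuous_truncate 0 (d ^ (β - 1))).comp hu
  simp only [Function.comp_def] at c2 c3
  have hpos : ∀ z, truncate m d (ballMean (fun s => truncatedDensity β d (u s)) z) ≠ 0 :=
    fun z => (hm.trans_le (truncate_mem hd _).1).ne'
  have c4 : ∀ r : ℝ, Continuous fun z =>
      truncate m d (ballMean (fun s => truncatedDensity β d (u s)) z) ^ r :=
    fun r => c2.rpow_const fun z => Or.inl (hpos z)
  have c5 : Continuous fun z => truncatedShear β d m k (max z 0) (u (max z 0))
      (ballMean (fun s => truncatedDensity β d (u s)) (max z 0)) := by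
    unfold truncatedShear
    have hc : Continuous fun z : ℝ => max z 0 := by fun_prop
    exact (((c3.comp hc).mul ((c4 (1 - β)).comp hc)).min continuous_const).max (by fun_prop)
  have c7 := continuous_div_posPart ((continuous_shearPotential hβ).comp c5)
    fun z => abs_shearPotential_div_le hβ hβ₂ hm hd hk (le_max_right z 0) _ _
  simp only [Function.comp_def] at c7
  have c8 := c4 (β - 1)
  have c9 := c4 (β - 4 / 3)
  have c8' := c8.comp (by fun_prop : Continuous fun z : ℝ => max z 0)
  have c9' := c9.comp (by fun_prop : Continuous fun z : ℝ => max z 0)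
  have c2' := c2.comp (by fun_prop : Continuous fun z : ℝ => max z 0)
  simp only [Function.comp_def] at c8' c9' c2'
  unfold profileOperator shearField
  exact continuous_const.mul (((continuous_const.mul c8').mul c7).add
    ((continuous_const.mul (by fun_prop)).mul (c9'.mul (c2'.add continuous_const))))

lemma exists_isCausalLipschitz_profileOperator (hβ : 1 < β) (hβ₂ : β ≤ 2) (hm : 0 < m)
    (hd : m ≤ d) (hk : 0 ≤ k) :
    ∃ L, 0 ≤ L ∧ IsCausalLipschitz (profileOperator β θ α d m k) T L := by
  obtain ⟨C, hC, h⟩ := isUnifLipschitz_truncatedField (T := T) (θ := θ) (α := α) hβ hβ₂ hm hd hk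
  obtain ⟨D, hD, h'⟩ := exists_abs_truncatedDensity_sub_le hβ hβ₂ (hm.le.trans hd)
  refine ⟨C * (1 + D), by positivity, fun u hu => continuous_profileOperator hβ hβ₂ hm hd hk hu,
    fun u v hu hv z hz M huv => ?_⟩
  unfold profileOperator
  rw [max_eq_left hz.1]
  refine (h z hz _ _ _ _).2.trans ?_
  rw [mul_assoc]
  gcongr
  rw [add_mul, one_mul]
  refine add_le_add (huv z ⟨hz.1, le_rfl⟩) ?_
  refine abs_ballMean_sub_le ((continuous_truncatedDensity hβ d).comp hu)
    ((continuous_truncatedDensity hβ d).comp hv) hz.1 fun s hs => (h' _ _).trans ?_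
  gcongr
  exact huv s hs

lemma profileOperator_zero (u : ℝ → ℝ) : profileOperator β θ α d m k u 0 = 0 := by
  simp [profileOperator, shearField]

end

/-! ### Solutions of the desingularized profile equation -/

/-- The mean density `η` belonging to `u = δ ^ (β - 1)`. -/
noncomputable def profileMean (β : ℝ) (u : ℝ → ℝ) (z : ℝ) : ℝ :=
  ballMean (fun s => u s ^ (1 / (β - 1))) z

/-- `u = δ ^ (β - 1)` solves the profile equation on `[0, T]` with central density `d`. The density
may vanish; the mean density is bounded below and the shear variable
`Y = u η ^ (1 - β)` leaves its central value `1` at most linearly. -/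
structure IsDesingularizedProfile (β θ α d T m k : ℝ) (u : ℝ → ℝ) : Prop where
  continuous : Continuous u
  init : u 0 = d ^ (β - 1)
  mem : ∀ z ∈ Icc 0 T, u z ∈ Icc 0 (d ^ (β - 1))
  mean_mem : ∀ z ∈ Icc 0 T, profileMean β u z ∈ Icc m d
  shear_mem : ∀ z ∈ Icc 0 T, u z * profileMean β u z ^ (1 - β) ∈ Icc (1 - k * z) 1
  hasDerivAt : ∀ z ∈ Ioo 0 T, HasDerivAt u
    (shearField β θ α z (u z * profileMean β u z ^ (1 - β)) (profileMean β u z)) z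

section
variable {β θ α d m k T : ℝ} {u : ℝ → ℝ}

lemma continuous_rpow_density (hβ : 1 < β) (hu : Continuous u) :
    Continuous fun s => u s ^ (1 / (β - 1)) := by
  have hb : 0 < β - 1 := by linarith
  exact hu.rpow_const fun _ => Or.inr (by positivity)

lemma ballMean_truncatedDensity {z : ℝ} (hz : 0 ≤ z)
    (hu : ∀ s ∈ Icc 0 z, u s ∈ Icc 0 (d ^ (β - 1))) :
    ballMean (fun s => truncatedDensity β d (u s)) z = profileMean β u z :=
  ballMean_congr hz fun s hs => by rw [truncatedDensity, truncate_of_mem (hu s hs)]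

/-- Where no truncation is active, the truncated operator is the profile equation. -/
lemma profileOperator_eq {z : ℝ} (hz : 0 ≤ z) (hu : ∀ s ∈ Icc 0 z, u s ∈ Icc 0 (d ^ (β - 1)))
    (hη : profileMean β u z ∈ Icc m d)
    (hY : u z * profileMean β u z ^ (1 - β) ∈ Icc (1 - k * z) 1) :
    profileOperator β θ α d m k u z
      = shearField β θ α z (u z * profileMean β u z ^ (1 - β)) (profileMean β u z) := by
  rw [profileOperator, max_eq_left hz, ballMean_truncatedDensity hz hu, truncate_of_mem hη,
    truncatedShear, truncate_of_mem hη, truncate_of_mem (hu z ⟨hz, le_rfl⟩), min_eq_left hY.2,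
    max_eq_left hY.1]

lemma IsDesingularizedProfile.hasDerivAt_operator (h : IsDesingularizedProfile β θ α d T m k u)
    {m' k' T' : ℝ} (hm : m' ≤ m) (hk : k ≤ k') (hT : T' ≤ T) :
    ∀ z ∈ Ioo 0 T', HasDerivAt u (profileOperator β θ α d m' k' u z) z := by
  intro z hz
  have hz' : z ∈ Icc 0 T := ⟨hz.1.le, hz.2.le.trans hT⟩
  have h1 := h.mean_mem z hz'
  have h2 := h.shear_mem z hz'
  have h3 : k * z ≤ k' * z := mul_le_mul_of_nonneg_right hk hz.1.le
  rw [profileOperator_eq hz.1.le (fun s hs => h.mem s ⟨hs.1, hs.2.trans hz'.2⟩)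
    ⟨hm.trans h1.1, h1.2⟩ ⟨by linarith [h2.1], h2.2⟩]
  exact h.hasDerivAt z ⟨hz.1, hz.2.trans_le hT⟩

lemma IsDesingularizedProfile.eqOn {m' k' : ℝ} {v : ℝ → ℝ} (hβ : 1 < β) (hβ₂ : β ≤ 2)
    (hm : 0 < m) (hm' : 0 < m') (hT : 0 ≤ T) (hu : IsDesingularizedProfile β θ α d T m k u)
    (hv : IsDesingularizedProfile β θ α d T m' k' v) : EqOn u v (Icc 0 T) := by
  have h0 : m ≤ d := (hu.mean_mem 0 ⟨le_rfl, hT⟩).1.trans (hu.mean_mem 0 ⟨le_rfl, hT⟩).2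
  have hk : 0 ≤ max (max k k') 0 := le_max_right _ _
  obtain ⟨L, hL, h⟩ := exists_isCausalLipschitz_profileOperator (θ := θ) (α := α) (T := T) hβ hβ₂
    (lt_min hm hm') ((min_le_left _ _).trans h0) hk
  exact h.eqOn_of_hasDerivAt hL hu.continuous hv.continuous
    (hu.hasDerivAt_operator (min_le_left _ _) ((le_max_left _ _).trans (le_max_left _ _)) le_rfl)
    (hv.hasDerivAt_operator (min_le_right _ _) ((le_max_right _ _).trans (le_max_left _ _)) le_rfl)
    (hu.init.trans hv.init.symm)

lemma rpow_rpow_density (hβ : 1 < β) (hd : 0 ≤ d) : (d ^ (β - 1)) ^ (1 / (β - 1)) = d := by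
  rw [← Real.rpow_mul hd, mul_one_div_cancel (by linarith), Real.rpow_one]

lemma rpow_density_rpow (hβ : 1 < β) (hd : 0 ≤ d) : (d ^ (1 / (β - 1))) ^ (β - 1) = d := by
  rw [← Real.rpow_mul hd, one_div_mul_cancel (by linarith), Real.rpow_one]

/-- For a decreasing density, the shear variable is at most `1`. -/
lemma shear_le_one (hβ : 1 < β) (hu : Continuous u) {z : ℝ} (hz : 0 ≤ z)
    (hdec : ∀ s ∈ Icc 0 z, u z ≤ u s) (h0 : 0 ≤ u z) (hη : 0 < profileMean β u z) :
    u z * profileMean β u z ^ (1 - β) ≤ 1 := by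
  have hb : 0 < β - 1 := by linarith
  have h1 : u z ^ (1 / (β - 1)) ≤ profileMean β u z :=
    le_ballMean (continuous_rpow_density hβ hu) hz fun s hs =>
      Real.rpow_le_rpow h0 (hdec s hs) (by positivity)
  have h2 : u z ≤ profileMean β u z ^ (β - 1) := by
    rw [← rpow_density_rpow hβ h0]
    exact Real.rpow_le_rpow (Real.rpow_nonneg h0 _) h1 hb.le
  calc _ ≤ profileMean β u z ^ (β - 1) * profileMean β u z ^ (1 - β) := by gcongr
    _ = 1 := by rw [← Real.rpow_add hη]; simp

/-- The field is negative, with a gravitational part of definite size. -/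
lemma shearField_le (hβ : 1 < β) (hβ₂ : β ≤ 4 / 3) (hθ : 0 < θ) {z Y η : ℝ}
    (hz : 0 ≤ z) (hY : 0 ≤ Y) (hη : 0 < η) (hηd : η ≤ d) (hα : 0 < α) :
    shearField β θ α z Y η ≤ -((β - 1) * θ * α * d ^ (β - 4 / 3)) * z := by
  have hb : 0 < β - 1 := by linarith
  have h1 := shearPotential_nonneg hβ hY
  have h2 : d ^ (β - 4 / 3) ≤ η ^ (β - 4 / 3) :=
    Real.rpow_le_rpow_of_nonpos hη hηd (by linarith)
  have h4 : 0 ≤ 4 - 3 * β := by linarith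
  have h5 : 0 ≤ (4 - 3 * β) / (β * (β - 1)) * η ^ (β - 1) * (shearPotential β Y / z) := by
    positivity
  have h6 : θ * z * (d ^ (β - 4 / 3) * α) ≤ θ * z * (η ^ (β - 4 / 3) * (η + α)) := by
    have : 0 < d := hη.trans_le hηd
    gcongr
    linarith
  unfold shearField
  nlinarith

lemma shearField_nonpos (hβ : 1 < β) (hβ₂ : β ≤ 4 / 3) (hθ : 0 < θ) {z Y η : ℝ}
    (hz : 0 ≤ z) (hY : 0 ≤ Y) (hη : 0 < η) (hα : 0 < α) :
    shearField β θ α z Y η ≤ 0 := by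
  have hb : 0 < β - 1 := by linarith
  have := shearField_le (d := η) hβ hβ₂ hθ hz hY hη le_rfl hα
  have : 0 ≤ ((β - 1) * θ * α * η ^ (β - 4 / 3)) * z := by positivity
  linarith

lemma abs_shearField_le (hβ : 1 < β) (hβ₂ : β ≤ 4 / 3) (hθ : 0 < θ) (hα : 0 < α) (hm : 0 < m)
    {z Y η c : ℝ} (hz : 0 ≤ z) (hη : η ∈ Icc m d) (hY : |shearPotential β Y / z| ≤ c * z) :
    |shearField β θ α z Y η| ≤ (β - 1) * ((4 - 3 * β) / (β * (β - 1)) * d ^ (β - 1) * c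
      + θ * (m ^ (β - 4 / 3) * (d + α))) * z := by
  have hb : 0 < β - 1 := by linarith
  have hη0 : 0 < η := hm.trans_le hη.1
  have hd0 : 0 < d := hη0.trans_le hη.2
  have h2 : η ^ (β - 4 / 3) ≤ m ^ (β - 4 / 3) :=
    Real.rpow_le_rpow_of_nonpos hm hη.1 (by linarith)
  have h3 : η ^ (β - 1) ≤ d ^ (β - 1) := Real.rpow_le_rpow hη0.le hη.2 hb.le
  have h4 : 0 ≤ 4 - 3 * β := by linarith
  have h5 : |(4 - 3 * β) / (β * (β - 1)) * η ^ (β - 1) * (shearPotential β Y / z)|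
      ≤ (4 - 3 * β) / (β * (β - 1)) * d ^ (β - 1) * (c * z) := by
    rw [abs_mul, abs_of_nonneg (by positivity : 0 ≤ (4 - 3 * β) / (β * (β - 1)) * η ^ (β - 1))]
    gcongr
  have h6 : |θ * z * (η ^ (β - 4 / 3) * (η + α))| ≤ θ * z * (m ^ (β - 4 / 3) * (d + α)) := by
    rw [abs_of_nonneg (by positivity)]
    have := hη.2
    gcongr
  unfold shearField
  rw [abs_mul, abs_neg, abs_of_pos hb]
  refine (mul_le_mul_of_nonneg_left ((abs_add_le _ _).trans (add_le_add h5 h6)) hb.le).trans_eq ?_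
  ring

/-- The first zero of a continuous function that is positive at `0`. -/
lemma exists_first_zero {f : ℝ → ℝ} {T : ℝ} (hf : ContinuousOn f (Icc 0 T)) (hT : 0 ≤ T)
    (h0 : 0 < f 0) (h1 : f T ≤ 0) : ∃ Z ∈ Ioc 0 T, f Z = 0 ∧ ∀ z ∈ Ico 0 Z, 0 < f z := by
  have hS : IsCompact (Icc 0 T ∩ f ⁻¹' Iic 0) :=
    isCompact_Icc.of_isClosed_subset (hf.preimage_isClosed_of_isClosed isClosed_Icc isClosed_Iic)
      inter_subset_left
  obtain ⟨Z, ⟨hZ, hZ0⟩, hmin⟩ := hS.exists_isLeast ⟨T, ⟨hT, le_rfl⟩, h1⟩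
  have hpos : ∀ z ∈ Ico 0 Z, 0 < f z := by
    intro z hz
    by_contra h
    exact absurd (hmin ⟨⟨hz.1, hz.2.le.trans hZ.2⟩, not_lt.1 h⟩) (not_le.2 hz.2)
  have hZpos : 0 < Z := by
    rcases hZ.1.eq_or_lt with h | h
    · rw [← h] at hZ0; exact absurd hZ0 (not_le.2 h0)
    · exact h
  refine ⟨Z, ⟨hZpos, hZ.2⟩, ?_, hpos⟩
  obtain ⟨w, hw, hw0⟩ := intermediate_value_Icc' hZ.1
    (hf.mono (Icc_subset_Icc_right hZ.2)) (show (0 : ℝ) ∈ Icc (f Z) (f 0) from ⟨hZ0, h0.le⟩)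
  rcases hw.2.eq_or_lt with h | h
  · rwa [← h]
  · exact absurd hw0 (hpos w ⟨hw.1, h⟩).ne'

lemma profileOperator_le (hβ : 1 < β) (hβ₂ : β ≤ 4 / 3) (hθ : 0 < θ) (hα : 0 < α)
    (hm : 0 < m) (hd : m ≤ d) (hk : 0 ≤ k) {z : ℝ} (hz : 0 ≤ z) :
    profileOperator β θ α d m k u z ≤ -((β - 1) * θ * α * d ^ (β - 4 / 3)) * z := by
  unfold profileOperator
  rw [max_eq_left hz]
  exact shearField_le hβ hβ₂ hθ hz (truncatedShear_mem hm hd hk hz _ _).1.1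
    (hm.trans_le (truncate_mem hd _).1) (truncate_mem hd _).2 hα

lemma antitoneOn_of_operator (hβ : 1 < β) (hβ₂ : β ≤ 4 / 3) (hθ : 0 < θ) (hα : 0 < α)
    (hm : 0 < m) (hd : m ≤ d) (hk : 0 ≤ k)
    (hu : ∀ z ∈ Icc 0 T, HasDerivAt u (profileOperator β θ α d m k u z) z) :
    AntitoneOn u (Icc 0 T) := by
  have hb : 0 < β - 1 := by linarith
  have hd0 : 0 < d := hm.trans_le hd
  refine antitoneOn_of_deriv_nonpos (convex_Icc _ _)
    (fun z hz => (hu z hz).continuousAt.continuousWithinAt)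
    (fun z hz => ((hu z (interior_subset hz)).differentiableAt).differentiableWithinAt)
    fun z hz => ?_
  have hz' := interior_subset hz
  rw [(hu z hz').deriv]
  refine (profileOperator_le hβ hβ₂ hθ hα hm hd hk hz'.1).trans ?_
  have := mul_nonneg (by positivity : 0 ≤ (β - 1) * θ * α * d ^ (β - 4 / 3)) hz'.1
  linarith

/-- Existence near the center. -/
lemma exists_local_profile (hβ : 1 < β) (hβ₂ : β ≤ 4 / 3) (hθ : 0 < θ) (hα : 0 < α)
    (hd : 0 < d) :
    ∃ T, 0 < T ∧ T ≤ 1 ∧ ∃ u, IsDesingularizedProfile β θ α d T (d / 2) 1 u := by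
  have hb : 0 < β - 1 := by linarith
  have hm : 0 < d / 2 := by positivity
  have hmd : d / 2 ≤ d := by linarith
  obtain ⟨L, hL, hΨ⟩ := exists_isCausalLipschitz_profileOperator (θ := θ) (α := α) (T := 1)
    hβ (by linarith) hm hmd zero_le_one
  obtain ⟨u, g, cg, hu, hu0, -, hg⟩ := hΨ.exists_hasDerivAt hL zero_le_one
    (fun u _ => profileOperator_zero u) (d ^ (β - 1))
  have cu : Continuous u := continuous_iff_continuousAt.2 fun z => (hu z).continuousAt
  have hu' : ∀ z ∈ Icc 0 1, HasDerivAt u (profileOperator β θ α d (d / 2) 1 u z) z :=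
    fun z hz => hg z hz ▸ hu z
  have hanti := antitoneOn_of_operator hβ hβ₂ hθ hα hm hmd zero_le_one hu'
  set C := (β - 1) * ((4 - 3 * β) / (β * (β - 1)) * d ^ (β - 1) * (β / (β - 1) * 1 ^ 2)
      + θ * ((d / 2) ^ (β - 4 / 3) * (d + α))) with hC
  have hC0 : 0 < C := by
    have h4 : 0 ≤ 4 - 3 * β := by linarith
    positivity
  have hbound : ∀ z ∈ Icc (0 : ℝ) 1, |profileOperator β θ α d (d / 2) 1 u z| ≤ C * z := by
    intro z hz
    unfold profileOperator
    rw [max_eq_left hz.1]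
    exact abs_shearField_le hβ hβ₂ hθ hα hm hz.1 (truncate_mem hmd _)
      (abs_shearPotential_div_le hβ (by linarith) hm hmd zero_le_one hz.1 _ _)
  have hdrop : ∀ z ∈ Icc (0 : ℝ) 1, d ^ (β - 1) - C * z * z ≤ u z := by
    intro z hz
    have := (convex_Icc 0 z).norm_image_sub_le_of_norm_hasDerivWithin_le (f := u) (C := C * z)
      (fun x hx => (hu' x ⟨hx.1, hx.2.trans hz.2⟩).hasDerivWithinAt)
      (fun x hx => (hbound x ⟨hx.1, hx.2.trans hz.2⟩).trans (by have := hx.2; gcongr))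
      (⟨le_rfl, hz.1⟩ : (0 : ℝ) ∈ Icc 0 z) (⟨hz.1, le_rfl⟩ : z ∈ Icc 0 z)
    rw [Real.norm_eq_abs, Real.norm_eq_abs, sub_zero, abs_of_nonneg hz.1, hu0] at this
    linarith [(abs_le.1 this).1]
  have hgap : (d / 2) ^ (β - 1) < d ^ (β - 1) :=
    Real.rpow_lt_rpow hm.le (by linarith) hb
  have huc : 0 < d ^ (β - 1) := Real.rpow_pos_of_pos hd _
  set gap := d ^ (β - 1) - (d / 2) ^ (β - 1)
  have hgap0 : 0 < gap := sub_pos.2 hgap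
  -- up to this point `u ≥ d ^ (β - 1) - C z²` keeps the density above `d / 2` and `1 - Y ≤ z`
  set T := min 1 (gap / C) with hTdef
  have hT0 : 0 < T := lt_min one_pos (by positivity)
  have hT1 : T ≤ 1 := min_le_left _ _
  have hTC : C * T ≤ gap := by
    have : T ≤ gap / C := min_le_right _ _
    rw [le_div_iff₀ hC0] at this
    linarith
  have hCz : ∀ z ∈ Icc 0 T, C * z ≤ gap := fun z hz =>
    (mul_le_mul_of_nonneg_left hz.2 hC0.le).trans hTC
  have hlow : ∀ z ∈ Icc 0 T, (d / 2) ^ (β - 1) ≤ u z := by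
    intro z hz
    have h1 := hdrop z ⟨hz.1, hz.2.trans hT1⟩
    have h2 : C * z * z ≤ gap * 1 :=
      mul_le_mul (hCz z hz) (hz.2.trans hT1) hz.1 hgap0.le
    have h3 : gap = d ^ (β - 1) - (d / 2) ^ (β - 1) := rfl
    linarith
  have hmem : ∀ z ∈ Icc 0 T, u z ∈ Icc 0 (d ^ (β - 1)) := fun z hz =>
    ⟨(Real.rpow_nonneg hm.le _).trans (hlow z hz), by
      rw [← hu0]
      exact hanti ⟨le_rfl, zero_le_one⟩ ⟨hz.1, hz.2.trans hT1⟩ hz.1⟩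
  have hmean : ∀ z ∈ Icc 0 T, profileMean β u z ∈ Icc (d / 2) d := by
    intro z hz
    constructor
    · refine le_ballMean (continuous_rpow_density hβ cu) hz.1 fun s hs => ?_
      rw [← rpow_rpow_density hβ hm.le]
      exact Real.rpow_le_rpow (Real.rpow_nonneg hm.le _) (hlow s ⟨hs.1, hs.2.trans hz.2⟩)
        (by positivity)
    · refine ballMean_le (continuous_rpow_density hβ cu) hz.1 fun s hs => ?_
      have := hmem s ⟨hs.1, hs.2.trans hz.2⟩
      calc u s ^ (1 / (β - 1)) ≤ (d ^ (β - 1)) ^ (1 / (β - 1)) :=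
            Real.rpow_le_rpow this.1 this.2 (by positivity)
        _ = d := rpow_rpow_density hβ hd.le
  have hshear : ∀ z ∈ Icc 0 T, u z * profileMean β u z ^ (1 - β) ∈ Icc (1 - 1 * z) 1 := by
    intro z hz
    have hη := hmean z hz
    have hη0 : 0 < profileMean β u z := hm.trans_le hη.1
    refine ⟨?_, shear_le_one hβ cu hz.1 (fun s hs => hanti ⟨hs.1, hs.2.trans (hz.2.trans hT1)⟩
      ⟨hz.1, hz.2.trans hT1⟩ hs.2) (hmem z hz).1 hη0⟩
    have h1 : d ^ (1 - β) ≤ profileMean β u z ^ (1 - β) :=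
      Real.rpow_le_rpow_of_nonpos hη0 hη.2 (by linarith)
    have h2 : d ^ (β - 1) * d ^ (1 - β) = 1 := by rw [← Real.rpow_add hd]; simp
    have h3 : 0 < d ^ (1 - β) := Real.rpow_pos_of_pos hd _
    have h4 : d ^ (β - 1) * (1 - z) ≤ u z := by
      have h5 := hdrop z ⟨hz.1, hz.2.trans hT1⟩
      have h6 : C * z * z ≤ d ^ (β - 1) * z := by
        have := hCz z hz
        have h7 : gap ≤ d ^ (β - 1) := sub_le_self _ (Real.rpow_nonneg hm.le _)
        exact mul_le_mul_of_nonneg_right (this.trans h7) hz.1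
      linarith
    calc 1 - 1 * z = d ^ (β - 1) * (1 - z) * d ^ (1 - β) := by linear_combination -(1 - z) * h2
      _ ≤ u z * d ^ (1 - β) := by gcongr
      _ ≤ _ := by have := (hmem z hz).1; gcongr
  refine ⟨T, hT0, hT1, u, cu, hu0, hmem, hmean, hshear, fun z hz => ?_⟩
  have hz' : z ∈ Icc 0 T := Ioo_subset_Icc_self hz
  rw [← profileOperator_eq hz'.1 (fun s hs => hmem s ⟨hs.1, hs.2.trans hz'.2⟩) (hmean z hz')
    (hshear z hz')]
  exact hu' z ⟨hz'.1, hz'.2.trans hT1⟩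

/-- The profile exists up to a zero `Z` of the density, in fact as a `C¹` function beyond it. The
gravitational term forces `u ≤ d ^ (β - 1) - c z² / 2`, whence the zero. -/
lemma exists_profile (hβ : 1 < β) (hβ₂ : β ≤ 4 / 3) (hθ : 0 < θ) (hα : 0 < α) (hd : 0 < d) :
    ∃ Z, 0 < Z ∧ ∃ (u g : ℝ → ℝ) (m k : ℝ), 0 < m ∧ Continuous g ∧ (∀ z, HasDerivAt u (g z) z) ∧
      (∀ z ≤ 0, g z = 0) ∧ u Z = 0 ∧ (∀ z ∈ Ico 0 Z, 0 < u z) ∧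
      IsDesingularizedProfile β θ α d Z m k u := by
  have hb : 0 < β - 1 := by linarith
  obtain ⟨a, ha, ha1, v, hv⟩ := exists_local_profile hβ hβ₂ hθ hα hd
  have huc : 0 < d ^ (β - 1) := Real.rpow_pos_of_pos hd _
  set c := (β - 1) * θ * α * d ^ (β - 4 / 3) with hc
  have hc0 : 0 < c := by positivity
  -- beyond this point the bound `d ^ (β - 1) - c z² / 2` is negative
  set T := 1 + 2 * d ^ (β - 1) / c with hT
  have hT1 : 1 ≤ T := by rw [hT]; linarith [(by positivity : 0 ≤ 2 * d ^ (β - 1) / c)]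
  have hT0 : 0 < T := by linarith
  -- the mass inside radius `a` bounds the mean density up to `T` from below
  set m := (a / T) ^ 3 * (d / 2) with hmdef
  have hm : 0 < m := by positivity
  have haT : a ≤ T := ha1.trans hT1
  have hm2 : m ≤ d / 2 := by
    refine mul_le_of_le_one_left (by positivity) (pow_le_one₀ (by positivity) ?_)
    rw [div_le_one hT0]; exact haT
  have hmd : m ≤ d := by linarith
  -- with this slope the truncation `1 - k z` of the shear is void for `z ≥ a`
  set k := 1 / a with hkdef
  have hk : 1 ≤ k := by rw [hkdef, le_div_iff₀ ha]; linarith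
  have hk0 : 0 ≤ k := by linarith
  obtain ⟨L, hL, hΨ⟩ := exists_isCausalLipschitz_profileOperator (θ := θ) (α := α) (T := T)
    hβ (by linarith) hm hmd hk0
  obtain ⟨u, g, cg, hu, hu0, hg0, hg⟩ := hΨ.exists_hasDerivAt hL hT0.le
    (fun u _ => profileOperator_zero u) (d ^ (β - 1))
  have cu : Continuous u := continuous_iff_continuousAt.2 fun z => (hu z).continuousAt
  have hu' : ∀ z ∈ Icc 0 T, HasDerivAt u (profileOperator β θ α d m k u z) z :=
    fun z hz => hg z hz ▸ hu z
  have hanti := antitoneOn_of_operator hβ hβ₂ hθ hα hm hmd hk0 hu'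
  have hle : ∀ z ∈ Icc 0 T, u z ≤ d ^ (β - 1) := fun z hz => by
    rw [← hu0]; exact hanti ⟨le_rfl, hT0.le⟩ hz hz.1
  have huT : u T ≤ 0 := by
    have hanti2 : AntitoneOn (fun z => u z + c * z ^ 2 / 2) (Icc 0 T) := by
      have hd2 : ∀ z, HasDerivAt (fun z => u z + c * z ^ 2 / 2) (g z + c * z) z := fun z => by
        refine ((hu z).add (((hasDerivAt_pow 2 z).const_mul c).div_const 2)).congr_deriv ?_
        push_cast; ring
      refine antitoneOn_of_deriv_nonpos (convex_Icc _ _)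
        (fun z _ => (hd2 z).continuousAt.continuousWithinAt)
        (fun z _ => (hd2 z).differentiableAt.differentiableWithinAt) fun z hz => ?_
      have hz' := interior_subset hz
      rw [(hd2 z).deriv, hg z hz']
      have := profileOperator_le (u := u) hβ hβ₂ hθ hα hm hmd hk0 hz'.1
      rw [← hc] at this
      linarith
    have h1 := hanti2 ⟨le_rfl, hT0.le⟩ ⟨hT0.le, le_rfl⟩ hT0.le
    simp only [hu0] at h1
    have h2 : c * T = c + 2 * d ^ (β - 1) := by rw [hT]; field_simp
    nlinarith
  obtain ⟨Z, hZ, hZ0, hpos⟩ := exists_first_zero cu.continuousOn hT0.le (hu0 ▸ huc) huT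
  have hmem : ∀ z ∈ Icc 0 Z, u z ∈ Icc 0 (d ^ (β - 1)) := by
    intro z hz
    refine ⟨?_, hle z ⟨hz.1, hz.2.trans hZ.2⟩⟩
    rcases hz.2.eq_or_lt with h | h
    · rw [h, hZ0]
    · exact (hpos z ⟨hz.1, h⟩).le
  -- the local solution solves the equation with weaker truncations, so both agree near the center
  have hvu : EqOn v u (Icc 0 a) := by
    obtain ⟨L', hL', hΨ'⟩ := exists_isCausalLipschitz_profileOperator (θ := θ) (α := α) (T := a)
      hβ (by linarith) hm hmd hk0
    exact hΨ'.eqOn_of_hasDerivAt hL' hv.continuous cu (hv.hasDerivAt_operator hm2 hk le_rfl)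
      (fun z hz => hu' z ⟨hz.1.le, hz.2.le.trans haT⟩) (hv.init.trans hu0.symm)
  have hmeanvu : ∀ z ∈ Icc 0 a, profileMean β v z = profileMean β u z := fun z hz =>
    ballMean_congr hz.1 fun s hs => by rw [hvu ⟨hs.1, hs.2.trans hz.2⟩]
  have hmean : ∀ z ∈ Icc 0 Z, profileMean β u z ∈ Icc m d := by
    intro z hz
    constructor
    · rcases le_total z a with h | h
      · rw [← hmeanvu z ⟨hz.1, h⟩]
        exact hm2.trans (hv.mean_mem z ⟨hz.1, h⟩).1
      · have h1 := le_pow_mul_ballMean (continuous_rpow_density hβ cu) h fun s hs =>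
          Real.rpow_nonneg (hmem s ⟨ha.le.trans hs.1, hs.2.trans hz.2⟩).1 _
        have h2 : d / 2 ≤ ballMean (fun s => u s ^ (1 / (β - 1))) a := by
          have := (hv.mean_mem a ⟨ha.le, le_rfl⟩).1
          rwa [hmeanvu a ⟨ha.le, le_rfl⟩] at this
        have hz0 : 0 < z := ha.trans_le h
        have h3 : a ^ 3 * (d / 2) ≤ z ^ 3 * profileMean β u z :=
          (mul_le_mul_of_nonneg_left h2 (by positivity)).trans h1
        have h4 : m ≤ (a / z) ^ 3 * (d / 2) := by
          rw [hmdef]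
          have := hz.2.trans hZ.2
          gcongr
        refine h4.trans ?_
        rw [div_pow, div_mul_eq_mul_div, div_le_iff₀ (by positivity)]
        linarith
    · refine ballMean_le (continuous_rpow_density hβ cu) hz.1 fun s hs => ?_
      have := hmem s ⟨hs.1, hs.2.trans hz.2⟩
      calc u s ^ (1 / (β - 1)) ≤ (d ^ (β - 1)) ^ (1 / (β - 1)) :=
            Real.rpow_le_rpow this.1 this.2 (by positivity)
        _ = d := rpow_rpow_density hβ hd.le
  have hshear : ∀ z ∈ Icc 0 Z, u z * profileMean β u z ^ (1 - β) ∈ Icc (1 - k * z) 1 := by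
    intro z hz
    have hη0 : 0 < profileMean β u z := hm.trans_le (hmean z hz).1
    have hz' : z ∈ Icc 0 T := ⟨hz.1, hz.2.trans hZ.2⟩
    refine ⟨?_, shear_le_one hβ cu hz.1 (fun s hs => hanti ⟨hs.1, hs.2.trans hz'.2⟩ hz' hs.2)
      (hmem z hz).1 hη0⟩
    rcases le_total z a with h | h
    · have h1 := (hv.shear_mem z ⟨hz.1, h⟩).1
      rw [hmeanvu z ⟨hz.1, h⟩, hvu ⟨hz.1, h⟩] at h1
      have : 1 * z ≤ k * z := mul_le_mul_of_nonneg_right hk hz.1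
      linarith
    · have h1 : 1 ≤ k * z := by
        rw [hkdef, one_div, ← div_eq_inv_mul, le_div_iff₀ ha]; linarith
      have := mul_nonneg (hmem z hz).1 (Real.rpow_nonneg hη0.le (1 - β))
      linarith
  refine ⟨Z, hZ.1, u, g, m, k, hm, cg, hu, hg0, hZ0, hpos, cu, hu0, hmem, hmean, hshear,
    fun z hz => ?_⟩
  have hz' : z ∈ Icc 0 Z := Ioo_subset_Icc_self hz
  rw [← profileOperator_eq hz'.1 (fun s hs => hmem s ⟨hs.1, hs.2.trans hz'.2⟩) (hmean z hz')
    (hshear z hz')]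
  exact hu' z ⟨hz'.1, hz'.2.trans hZ.2⟩

end

/-! ### Smoothness of averages -/

lemma hasDerivAt_ballMean_of_hasDerivAt {f f' : ℝ → ℝ} (hf : ∀ x, HasDerivAt f (f' x) x)
    (hf' : Continuous f') (z : ℝ) :
    HasDerivAt (ballMean f) (3 * ∫ τ in (0 : ℝ)..1, τ ^ 3 * f' (z * τ)) z := by
  have cf : Continuous f := continuous_iff_continuousAt.2 fun x => (hf x).continuousAt
  obtain ⟨C, hC⟩ := (isCompact_closedBall (0 : ℝ) (|z| + 1)).exists_bound_of_continuousOn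
    hf'.continuousOn
  refine HasDerivAt.const_mul 3 ?_
  refine (intervalIntegral.hasDerivAt_integral_of_dominated_loc_of_deriv_le
    (F := fun z τ => τ ^ 2 * f (z * τ)) (F' := fun z τ => τ ^ 3 * f' (z * τ))
    (bound := fun _ => C) (Metric.ball_mem_nhds z one_pos)
    (Eventually.of_forall fun x => Continuous.aestronglyMeasurable (by fun_prop))
    (Continuous.intervalIntegrable (by fun_prop) _ _)
    (Continuous.aestronglyMeasurable (by fun_prop)) ?_ intervalIntegrable_const ?_).2
  · refine Eventually.of_forall fun τ hτ x hx => ?_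
    rw [uIoc_of_le zero_le_one] at hτ
    have h1 : ‖f' (x * τ)‖ ≤ C := by
      refine hC _ ?_
      rw [mem_closedBall_zero_iff, Real.norm_eq_abs, abs_mul, abs_of_pos hτ.1]
      have h2 : |x| ≤ |z| + 1 := by
        have h3 := hx
        rw [Metric.mem_ball, Real.dist_eq] at h3
        have := abs_sub_abs_le_abs_sub x z
        linarith
      calc |x| * τ ≤ |x| * 1 := by have := hτ.2; gcongr
        _ ≤ _ := by linarith
    rw [norm_mul, norm_pow, Real.norm_eq_abs, abs_of_pos hτ.1]
    calc τ ^ 3 * ‖f' (x * τ)‖ ≤ 1 * ‖f' (x * τ)‖ := by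
          gcongr
          exact pow_le_one₀ hτ.1.le hτ.2
      _ ≤ C := by rwa [one_mul]
  · refine Eventually.of_forall fun τ _ x _ => ?_
    have h1 : HasDerivAt (fun x => f (x * τ)) (f' (x * τ) * (1 * τ)) x :=
      (hf (x * τ)).comp x ((hasDerivAt_id x).mul_const τ)
    exact (h1.const_mul (τ ^ 2)).congr_deriv (by ring)

lemma contDiff_one_of_hasDerivAt {f f' : ℝ → ℝ} (hf : ∀ x, HasDerivAt f (f' x) x)
    (hf' : Continuous f') : ContDiff ℝ 1 f := by
  rw [contDiff_one_iff_deriv]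
  refine ⟨fun x => (hf x).differentiableAt, ?_⟩
  rwa [show deriv f = f' from funext fun x => (hf x).deriv]

lemma ContDiff.hasDerivAt_one {f : ℝ → ℝ} (h : ContDiff ℝ 1 f) (x : ℝ) :
    HasDerivAt f (deriv f x) x := ((h.differentiable one_ne_zero) x).hasDerivAt

lemma contDiff_ballMean {f : ℝ → ℝ} (hf : ContDiff ℝ 1 f) : ContDiff ℝ 1 (ballMean f) := by
  have cf' : Continuous (deriv f) := hf.continuous_deriv le_rfl
  refine contDiff_one_of_hasDerivAt
    (fun x => hasDerivAt_ballMean_of_hasDerivAt hf.hasDerivAt_one cf' x) ?_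
  refine continuous_const.mul
    (intervalIntegral.continuous_parametric_intervalIntegral_of_continuous' ?_ _ _)
  fun_prop

lemma deriv_ballMean_zero {f : ℝ → ℝ} (hf : ContDiff ℝ 1 f) (h0 : deriv f 0 = 0) :
    deriv (ballMean f) 0 = 0 := by
  rw [(hasDerivAt_ballMean_of_hasDerivAt hf.hasDerivAt_one (hf.continuous_deriv le_rfl) 0).deriv]
  simp [h0]

/-- The mean over balls of a strictly decreasing function exceeds its boundary value. -/
lemma lt_ballMean {f : ℝ → ℝ} {z : ℝ} (hf : Continuous f) (hz : 0 < z)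
    (h : StrictAntiOn f (Icc 0 z)) : f z < ballMean f z := by
  have hz2 : z / 2 ∈ Icc 0 z := ⟨by positivity, by linarith⟩
  have hzz : z ∈ Icc 0 z := ⟨hz.le, le_rfl⟩
  have c : Continuous fun s => f s - f z := by fun_prop
  have h1 := le_pow_mul_ballMean c (show z / 2 ≤ z by linarith) fun s hs => by
    have := h.antitoneOn ⟨hz2.1.trans hs.1, hs.2⟩ hzz hs.2
    linarith
  have h2 : f (z / 2) - f z ≤ ballMean (fun s => f s - f z) (z / 2) :=
    le_ballMean c hz2.1 fun s hs => by
      have := h.antitoneOn ⟨hs.1, hs.2.trans hz2.2⟩ hz2 hs.2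
      linarith
  have h3 : f z < f (z / 2) := h hz2 hzz (by linarith)
  have h4 := ballMean_sub hf (continuous_const (y := f z)) z
  rw [ballMean_const] at h4
  rw [← h4] at h1
  have h5 : 0 < (z / 2) ^ 3 * ballMean (fun s => f s - f z) (z / 2) :=
    mul_pos (by positivity) (by linarith)
  have h6 : 0 < z ^ 3 * (ballMean f z - f z) := by linarith
  have := (mul_pos_iff_of_pos_left (by positivity : 0 < z ^ 3)).1 h6
  linarith

/-! ### The profile system -/

lemma profileTheta_pos {G K κ ν : ℝ} (hG : 0 < G) (hK : 0 < K) (hκ : 0 < κ) (hν₁ : -1 < ν)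
    (hν₂ : ν < 1) : 0 < profileTheta G K κ ν := by
  have := Real.pi_pos
  have h1 : 0 < 1 + ν := by linarith
  have h2 : 0 < 1 - ν := by linarith
  unfold profileTheta
  positivity

lemma profileB_eq {β y : ℝ} (hβ : 1 < β) (hy : 0 < y) :
    profileB β y = y * shearPotential β (y ^ (β - 1)) / (β * (β - 1)) := by
  have hb : β - 1 ≠ 0 := by linarith
  rw [profileB, if_neg hβ.ne', shearPotential]
  congr 1
  rw [← Real.rpow_mul hy.le, mul_div_cancel₀ _ hb, Real.rpow_sub_one hy.ne', Real.rpow_add hy,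
    Real.rpow_one]
  field_simp

/-- In terms of `u = δ ^ (β - 1)`, the right-hand side of the equation for `δ` is the field
`shearField`. -/
lemma shearField_eq {β θ α z δ η : ℝ} (hβ : 1 < β) (hδ : 0 < δ) (hη : 0 < η) :
    shearField β θ α z (δ ^ (β - 1) * η ^ (1 - β)) η =
      (β - 1) * δ ^ (β - 2) * ((δ / η) ^ (1 - β) *
        (3 * (β - 4 / 3) / z * profileB β (δ / η) * η
          - θ * z * η ^ (-(1 / 3) : ℝ) * δ * (η + α))) := by
  have hb : β - 1 ≠ 0 := by linarith
  have hb0 : β ≠ 0 := by linarith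
  have hy : (δ / η) ^ (β - 1) = δ ^ (β - 1) * η ^ (1 - β) := by
    rw [Real.div_rpow hδ.le hη.le, div_eq_mul_inv, ← Real.rpow_neg hη.le, neg_sub]
  rw [profileB_eq hβ (div_pos hδ hη), hy]
  have hy' : (δ / η) ^ (1 - β) = δ ^ (1 - β) * η ^ (β - 1) := by
    rw [Real.div_rpow hδ.le hη.le, div_eq_mul_inv, ← Real.rpow_neg hη.le, neg_sub]
  have e1 : δ ^ (β - 2) * δ ^ (1 - β) * δ = 1 := by
    rw [← Real.rpow_add hδ, ← Real.rpow_add_one hδ.ne']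
    ring_nf; simp
  have e2 : η ^ (β - 1) * η ^ (-(1 / 3) : ℝ) = η ^ (β - 4 / 3) := by
    rw [← Real.rpow_add hη]; congr 1; ring
  rw [hy']
  unfold shearField
  rw [← e2]
  generalize shearPotential β (δ ^ (β - 1) * η ^ (1 - β)) = S
  have e3 : (β - 1) * δ ^ (β - 2) * (δ ^ (1 - β) * η ^ (β - 1) *
        (3 * (β - 4 / 3) / z * (δ / η * S / (β * (β - 1))) * η
          - θ * z * η ^ (-(1 / 3) : ℝ) * δ * (η + α)))
      = (δ ^ (β - 2) * δ ^ (1 - β) * δ) * ((β - 1) * η ^ (β - 1) *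
        (3 * (β - 4 / 3) / z * (1 / η * S / (β * (β - 1))) * η
          - θ * z * η ^ (-(1 / 3) : ℝ) * (η + α))) := by ring
  rw [e3, e1]
  have : 1 / η * S / (β * (β - 1)) * η = S / (β * (β - 1)) := by field_simp
  have e4 : 3 * (β - 4 / 3) / z * (1 / η * S / (β * (β - 1))) * η
    = 3 * (β - 4 / 3) / z * (1 / η * S / (β * (β - 1)) * η) := by ring
  rw [e4, this]
  ring

lemma mem_profileInterval {z Z : ℝ} : z ∈ profileInterval (Z : EReal) ↔ 0 ≤ z ∧ z < Z := by
  simp [profileInterval]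

section
variable {G K κ ν β α d : ℝ} {Z : EReal} {δ η : ℝ → ℝ}

/-- In a strongly regular solution, `η` is the mean density. -/
lemma IsStronglyRegularProfile.eta_eq (h : IsStronglyRegularProfile G K κ ν β α d Z δ η) {T : ℝ}
    (hT : (T : EReal) < Z) :
    ∀ z ∈ Icc 0 T, η z = ballMean (fun s => δ (truncate 0 T s)) z := by
  intro z hz
  rcases hz.1.eq_or_lt with rfl | hz0
  · rw [ballMean_zero, truncate_of_mem ⟨le_rfl, hz.2⟩, h.eta_center, h.delta_center]
  have hsub : ∀ s ∈ Icc 0 T, s ∈ profileInterval Z := fun s hs =>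
    ⟨hs.1, (EReal.coe_le_coe_iff.2 hs.2).trans_lt hT⟩
  have cδ : Continuous fun s => δ (truncate 0 T s) := by
    refine (h.delta_contDiff.continuousOn.mono hsub).comp_continuous (continuous_truncate 0 T)
      fun s => truncate_mem (hz.1.trans hz.2) s
  have key := exists_hasDerivAt_eq_slope
    (fun s => s ^ 3 * (η s - ballMean (fun s => δ (truncate 0 T s)) s)) (fun _ => 0) hz0
    (((continuous_pow 3).continuousOn).mul ((h.eta_continuous.mono fun s hs =>
      hsub s ⟨hs.1, hs.2.trans hz.2⟩).sub (continuous_ballMean cδ).continuousOn))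
    (fun s hs => by
      have hs' : s ∈ Icc 0 T := ⟨hs.1.le, hs.2.le.trans hz.2⟩
      refine ((hasDerivAt_pow 3 s).mul ((h.eta_equation s (hsub s hs') hs.1).sub
        (hasDerivAt_ballMean cδ hs.1))).congr_deriv ?_
      rw [truncate_of_mem hs']
      have := hs.1.ne'
      simp only [Pi.sub_apply]
      field_simp
      push_cast
      ring)
  obtain ⟨c, -, hc⟩ := key
  simp only [ne_eq, OfNat.ofNat_ne_zero, not_false_eq_true, zero_pow, zero_mul, sub_zero] at hc
  rw [eq_comm, div_eq_zero_iff] at hc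
  rcases hc with hc | hc
  · rcases mul_eq_zero.1 hc with hc | hc
    · exact absurd hc (by positivity)
    · linarith
  · exact absurd hc hz0.ne'

/-- A strongly regular solution yields a solution of the desingularized equation on every compact
subinterval. -/
lemma IsStronglyRegularProfile.exists_desingularized
    (h : IsStronglyRegularProfile G K κ ν β α d Z δ η) (hβ : 1 < β) (hβ₂ : β ≤ 4 / 3)
    (hθ : 0 < profileTheta G K κ ν) (hα : 0 < α) {T : ℝ} (hT0 : 0 < T) (hT : (T : EReal) < Z) :
    ∃ m k, 0 < m ∧ IsDesingularizedProfile β (profileTheta G K κ ν) α d T m k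
      (fun s => δ (truncate 0 T s) ^ (β - 1)) := by
  have hb : 0 < β - 1 := by linarith
  set f := fun s => δ (truncate 0 T s) with hf
  set u := fun s => f s ^ (β - 1) with hu
  have hsub : ∀ s ∈ Icc 0 T, s ∈ profileInterval Z := fun s hs =>
    ⟨hs.1, (EReal.coe_le_coe_iff.2 hs.2).trans_lt hT⟩
  have cf : Continuous f :=
    (h.delta_contDiff.continuousOn.mono hsub).comp_continuous (continuous_truncate 0 T)
      fun s => truncate_mem hT0.le s
  have hfpos : ∀ s, 0 < f s := fun s => h.delta_pos _ (hsub _ (truncate_mem hT0.le s))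
  have hfδ : ∀ s ∈ Icc 0 T, f s = δ s := fun s hs => by rw [hf]; simp only [truncate_of_mem hs]
  have h0T : (0 : ℝ) ∈ Icc 0 T := ⟨le_rfl, hT0.le⟩
  have hf0 : f 0 = d := by rw [hfδ 0 h0T, h.delta_center]
  have hd : 0 < d := hf0 ▸ hfpos 0
  have cu : Continuous u := cf.rpow_const fun s => Or.inl (hfpos s).ne'
  have hmean : profileMean β u = ballMean f := by
    funext z
    unfold profileMean
    congr 1
    funext s
    rw [hu]
    exact rpow_rpow_density hβ (hfpos s).le
  have hηmean : ∀ z ∈ Icc 0 T, η z = ballMean f z := h.eta_eq hT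
  have hderiv : ∀ z ∈ Ioo 0 T, HasDerivAt f ((δ z / η z) ^ (1 - β) *
      (3 * (β - 4 / 3) / z * profileB β (δ z / η z) * η z
        - profileTheta G K κ ν * z * η z ^ (-(1 / 3) : ℝ) * δ z * (η z + α))) z := by
    intro z hz
    refine (h.delta_equation z (hsub z (Ioo_subset_Icc_self hz)) hz.1).congr_of_eventuallyEq ?_
    filter_upwards [isOpen_Ioo.mem_nhds hz] with s hs
    exact hfδ s (Ioo_subset_Icc_self hs)
  have hmeanpos : ∀ z, 0 ≤ z → 0 < ballMean f z := by
    intro z hz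
    obtain ⟨x, -, hx⟩ := isCompact_Icc.exists_isMinOn (s := Icc 0 z) ⟨0, le_rfl, hz⟩
      cf.continuousOn
    exact (hfpos x).trans_le (le_ballMean cf hz fun s hs => hx hs)
  have hud : ∀ z ∈ Ioo 0 T, HasDerivAt u (shearField β (profileTheta G K κ ν) α z
      (u z * profileMean β u z ^ (1 - β)) (profileMean β u z)) z := by
    intro z hz
    have hz' := Ioo_subset_Icc_self hz
    have h1 := (hderiv z hz).rpow_const (p := β - 1) (Or.inl (hfpos z).ne')
    refine h1.congr_deriv ?_
    rw [hmean, shearField_eq hβ (hfpos z) (hmeanpos z hz'.1), hηmean z hz', hfδ z hz']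
    ring_nf
  have hanti : AntitoneOn u (Icc 0 T) := by
    refine antitoneOn_of_deriv_nonpos (convex_Icc _ _) cu.continuousOn
      (fun z hz => ?_) fun z hz => ?_
    · rw [interior_Icc] at hz
      exact (hud z hz).differentiableAt.differentiableWithinAt
    · rw [interior_Icc] at hz
      rw [(hud z hz).deriv]
      have hp := hmeanpos z hz.1.le
      rw [hmean]
      exact shearField_nonpos hβ hβ₂ hθ hz.1.le
        (mul_nonneg (Real.rpow_nonneg (hfpos z).le _) (Real.rpow_nonneg hp.le _)) hp hα
  have hfanti : ∀ s ∈ Icc 0 T, ∀ z ∈ Icc 0 T, s ≤ z → f z ≤ f s := by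
    intro s hs z hz hsz
    by_contra hlt
    exact absurd (hanti hs hz hsz)
      (not_le.2 (Real.rpow_lt_rpow (hfpos s).le (not_le.1 hlt) hb))
  have hTT : T ∈ Icc 0 T := ⟨hT0.le, le_rfl⟩
  -- near the center the density decreases at most linearly, as its derivative tends to zero
  obtain ⟨e, he, hlin⟩ : ∃ e > 0, ∀ z ∈ Icc 0 T, z ≤ e → d - z ≤ f z := by
    have h1 := (Metric.tendsto_nhdsWithin_nhds.1 h.delta_deriv_center) 1 one_pos
    obtain ⟨e, he, h2⟩ := h1
    refine ⟨e / 2, by positivity, fun z hz hze => ?_⟩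
    rcases hz.1.eq_or_lt with rfl | hz0
    · rw [hf0]; simp
    have hsub' : ∀ s ∈ Ioo 0 z, s ∈ Ioo 0 T := fun s hs => ⟨hs.1, hs.2.trans_le hz.2⟩
    obtain ⟨c, hc, hc'⟩ := exists_hasDerivAt_eq_slope f _ hz0 cf.continuousOn
      fun s hs => hderiv s (hsub' s hs)
    have h3 := h2 (x := c) hc.1 (by
      rw [Real.dist_eq, sub_zero, abs_of_pos hc.1]; linarith [hc.2])
    rw [(h.delta_equation c (hsub c (Ioo_subset_Icc_self (hsub' c hc))) hc.1).deriv, hc',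
      Real.dist_eq, sub_zero, hf0, sub_zero, abs_div, abs_of_pos hz0, div_lt_one hz0] at h3
    linarith [(abs_lt.1 h3).1]
  refine ⟨f T, max (1 / d) (1 / e), hfpos T, cu, by simp only [hu, hf0],
    fun z hz => ⟨Real.rpow_nonneg (hfpos z).le _, ?_⟩, fun z hz => ?_, fun z hz => ?_, hud⟩
  · rw [← hf0]; exact hanti h0T hz hz.1
  · rw [hmean]
    refine ⟨le_ballMean cf hz.1 fun s hs => ?_, ballMean_le cf hz.1 fun s hs => ?_⟩
    · have hs' : s ∈ Icc 0 T := ⟨hs.1, hs.2.trans hz.2⟩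
      exact hfanti s hs' T hTT hs'.2
    · rw [← hf0]
      exact hfanti 0 h0T s ⟨hs.1, hs.2.trans hz.2⟩ hs.1
  · have hp := hmeanpos z hz.1
    have hle : ballMean f z ≤ d := ballMean_le cf hz.1 fun s hs => by
      rw [← hf0]; exact hfanti 0 h0T s ⟨hs.1, hs.2.trans hz.2⟩ hs.1
    refine ⟨?_, shear_le_one hβ cu hz.1 (fun s hs => hanti ⟨hs.1, hs.2.trans hz.2⟩ hz hs.2)
      (Real.rpow_nonneg (hfpos z).le _) (by rw [hmean]; exact hp)⟩
    rw [hmean]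
    have hY0 : 0 ≤ u z * ballMean f z ^ (1 - β) :=
      mul_nonneg (Real.rpow_nonneg (hfpos z).le _) (Real.rpow_nonneg hp.le _)
    rcases le_total z e with hze | hze
    · have h1 : f z / d ≤ u z * ballMean f z ^ (1 - β) := by
        have hfd : f z ≤ d := hf0 ▸ hfanti 0 h0T z hz hz.1
        calc f z / d = (f z / d) ^ (1 : ℝ) := (Real.rpow_one _).symm
          _ ≤ (f z / d) ^ (β - 1) := Real.rpow_le_rpow_of_exponent_ge (div_pos (hfpos z) hd)
              ((div_le_one hd).2 hfd) (by linarith)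
          _ = u z * d ^ (1 - β) := by
              rw [Real.div_rpow (hfpos z).le hd.le, div_eq_mul_inv, ← Real.rpow_neg hd.le, neg_sub]
          _ ≤ _ := mul_le_mul_of_nonneg_left
              (Real.rpow_le_rpow_of_nonpos hp hle (by linarith))
              (Real.rpow_nonneg (hfpos z).le _)
      have h2 := hlin z hz hze
      have h3 : 1 - 1 / d * z ≤ f z / d := by
        rw [le_div_iff₀ hd]; field_simp; linarith
      have h4 : 1 / d * z ≤ max (1 / d) (1 / e) * z :=
        mul_le_mul_of_nonneg_right (le_max_left _ _) hz.1
      linarith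
    · have h3 : 1 ≤ 1 / e * z := by
        rw [one_div, ← div_eq_inv_mul, le_div_iff₀ he]; linarith
      have h4 : 1 / e * z ≤ max (1 / d) (1 / e) * z :=
        mul_le_mul_of_nonneg_right (le_max_right _ _) hz.1
      linarith

lemma IsDesingularizedProfile.mono {θ m k T T' : ℝ} {u : ℝ → ℝ}
    (h : IsDesingularizedProfile β θ α d T m k u) (hT : T' ≤ T) :
    IsDesingularizedProfile β θ α d T' m k u :=
  ⟨h.continuous, h.init, fun z hz => h.mem z ⟨hz.1, hz.2.trans hT⟩,
    fun z hz => h.mean_mem z ⟨hz.1, hz.2.trans hT⟩,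
    fun z hz => h.shear_mem z ⟨hz.1, hz.2.trans hT⟩,
    fun z hz => h.hasDerivAt z ⟨hz.1, hz.2.trans_le hT⟩⟩

/-- The maximal profile, together with its continuation to a pair of `C¹` functions on the line. -/
lemma exists_maximalProfile (hβ : 1 < β) (hβ₂ : β ≤ 4 / 3) (hθ : 0 < profileTheta G K κ ν)
    (hα : 0 < α) (hd : 0 < d) :
    ∃ (Zmax : ℝ) (δ η : ℝ → ℝ), 0 < Zmax ∧ IsMaximalProfile G K κ ν β α d (Zmax : EReal) δ η ∧
      ContDiff ℝ 1 δ ∧ ContDiff ℝ 1 η ∧ deriv δ 0 = 0 ∧ deriv η 0 = 0 ∧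
      (∀ z < Zmax, 0 < δ z) ∧ (∀ z ≤ Zmax, 0 < η z) ∧ η = ballMean δ ∧
      (∀ z ∈ Ioo 0 Zmax, δ z < η z) ∧ δ Zmax = 0 := by
  have hb : 0 < β - 1 := by linarith
  obtain ⟨Z, hZ, u, g, m, k, hm, cg, hu, hg0, huZ, hpos, hprof⟩ :=
    exists_profile hβ hβ₂ hθ hα hd
  set p := 1 / (β - 1) with hp
  have hp1 : 1 ≤ p := by rw [hp, le_div_iff₀ hb]; linarith
  set δ := fun s => u s ^ p with hδ
  have hδd : ∀ z, HasDerivAt δ (g z * p * u z ^ (p - 1)) z := fun z =>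
    (hu z).rpow_const (Or.inr hp1)
  have cu : Continuous u := hprof.continuous
  have hδc : ContDiff ℝ 1 δ := contDiff_one_of_hasDerivAt hδd
    ((cg.mul continuous_const).mul (cu.rpow_const fun _ => Or.inr (by linarith)))
  have hδ0 : deriv δ 0 = 0 := by rw [(hδd 0).deriv, hg0 0 le_rfl]; ring
  have huneg : ∀ z ≤ 0, u z = d ^ (β - 1) := by
    intro z hz
    rw [← hprof.init]
    rcases hz.eq_or_lt with rfl | hz0
    · rfl
    obtain ⟨c, hc, hc'⟩ := exists_hasDerivAt_eq_slope u g hz0 cu.continuousOn fun s _ => hu s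
    rw [hg0 c hc.2.le, eq_comm, div_eq_zero_iff] at hc'
    rcases hc' with h | h <;> linarith
  have hδneg : ∀ z ≤ 0, δ z = d := fun z hz => by
    simp only [hδ, huneg z hz]; exact rpow_rpow_density hβ hd.le
  have hupos : ∀ z < Z, 0 < u z := by
    intro z hz
    rcases le_total z 0 with h | h
    · rw [huneg z h]; positivity
    · exact hpos z ⟨h, hz⟩
  have hδpos : ∀ z < Z, 0 < δ z := fun z hz => Real.rpow_pos_of_pos (hupos z hz) _
  have hδZ : δ Z = 0 := by simp only [hδ, huZ]; exact Real.zero_rpow (by positivity)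
  set η := ballMean δ with hη
  have hηprof : η = profileMean β u := rfl
  have hηpos : ∀ z ≤ Z, 0 < η z := by
    intro z hz
    rcases le_total z 0 with h | h
    · have : η z = d := by
        rw [hη, ← ballMean_const d z]
        unfold ballMean
        congr 1
        refine intervalIntegral.integral_congr fun τ hτ => ?_
        rw [uIcc_of_le zero_le_one] at hτ
        simp only [hδneg (z * τ) (mul_nonpos_of_nonpos_of_nonneg h hτ.1)]
      rw [this]; exact hd
    · rw [hηprof]
      exact hm.trans_le (hprof.mean_mem z ⟨h, hz⟩).1
  have huδ : ∀ z < Z, u z = δ z ^ (β - 1) := fun z hz =>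
    (rpow_density_rpow hβ (hupos z hz).le).symm
  have hfield : ∀ z ∈ Ioo 0 Z, g z = shearField β (profileTheta G K κ ν) α z
      (δ z ^ (β - 1) * η z ^ (1 - β)) (η z) := by
    intro z hz
    rw [← huδ z hz.2, hηprof]
    exact (hu z).unique (hprof.hasDerivAt z hz)
  have hδeq : ∀ z ∈ Ioo 0 Z, HasDerivAt δ ((δ z / η z) ^ (1 - β) *
      (3 * (β - 4 / 3) / z * profileB β (δ z / η z) * η z
        - profileTheta G K κ ν * z * η z ^ (-(1 / 3) : ℝ) * δ z * (η z + α))) z := by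
    intro z hz
    refine (hδd z).congr_deriv ?_
    rw [hfield z hz, shearField_eq hβ (hδpos z hz.2) (hηpos z hz.2.le), huδ z hz.2]
    have e1 : (δ z ^ (β - 1)) ^ (p - 1) * δ z ^ (β - 2) = 1 := by
      rw [← Real.rpow_mul (hδpos z hz.2).le, ← Real.rpow_add (hδpos z hz.2)]
      have : (β - 1) * (p - 1) + (β - 2) = 0 := by rw [hp]; field_simp; ring
      rw [this, Real.rpow_zero]
    have e2 : (β - 1) * p = 1 := by rw [hp]; field_simp
    generalize (δ z / η z) ^ (1 - β) * (3 * (β - 4 / 3) / z * profileB β (δ z / η z) * η z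
        - profileTheta G K κ ν * z * η z ^ (-(1 / 3) : ℝ) * δ z * (η z + α)) = R
    calc _ = ((β - 1) * p) * ((δ z ^ (β - 1)) ^ (p - 1) * δ z ^ (β - 2)) * R := by ring
      _ = R := by rw [e1, e2]; ring
  have hanti : StrictAntiOn δ (Icc 0 Z) := by
    have hstrict : StrictAntiOn u (Icc 0 Z) := by
      refine strictAntiOn_of_deriv_neg (convex_Icc _ _) cu.continuousOn fun z hz => ?_
      rw [interior_Icc] at hz
      rw [(hu z).deriv, hfield z hz]
      have h1 := hηpos z hz.2.le
      have h2 := hδpos z hz.2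
      have h3 := shearField_le (d := η z) hβ hβ₂ hθ hz.1.le
        (by positivity : 0 ≤ δ z ^ (β - 1) * η z ^ (1 - β)) h1 le_rfl hα
      have h4 : 0 < ((β - 1) * profileTheta G K κ ν * α * η z ^ (β - 4 / 3)) * z := by
        have := hz.1
        positivity
      linarith
    intro s hs z hz hsz
    exact Real.rpow_lt_rpow (hprof.mem z hz).1 (hstrict hs hz hsz) (by positivity)
  refine ⟨Z, δ, η, hZ, ⟨⟨by exact_mod_cast hZ, hδneg 0 le_rfl, ?_, fun z hz => ?_,
    hδc.contDiffOn, ?_, (continuous_ballMean hδc.continuous).continuousOn, fun z hz hz0 => ?_,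
    fun z hz hz0 => ?_⟩, ?_⟩, hδc, contDiff_ballMean hδc, hδ0, deriv_ballMean_zero hδc hδ0, hδpos,
    hηpos, rfl, fun z hz => ?_, hδZ⟩
  · rw [hη, ballMean_zero, hδneg 0 le_rfl]
  · exact hδpos z (mem_profileInterval.1 hz).2
  · have := ((hδc.continuous_deriv le_rfl).tendsto 0).mono_left (nhdsWithin_le_nhds (s := Ioi 0))
    rwa [hδ0] at this
  · exact hδeq z ⟨hz0, (mem_profileInterval.1 hz).2⟩
  · exact hasDerivAt_ballMean hδc.continuous hz0
  · intro Z' δ' η' h'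
    have key : ∀ T : ℝ, 0 < T → (T : EReal) < Z' → T ≤ Z → ∀ z ∈ Icc 0 T,
        δ' z = δ z ∧ η' z = η z := by
      intro T hT0 hT hTZ z hz
      obtain ⟨m', k', hm', hp'⟩ := h'.exists_desingularized hβ hβ₂ hθ hα hT0 hT
      have heq := (hprof.mono hTZ).eqOn hβ (by linarith) hm hm' hT0.le hp'
      have hsub : ∀ s ∈ Icc 0 T, s ∈ profileInterval Z' := fun s hs =>
        ⟨hs.1, (EReal.coe_le_coe_iff.2 hs.2).trans_lt hT⟩
      have h1 : ∀ s ∈ Icc 0 T, δ' (truncate 0 T s) = δ s := by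
        intro s hs
        have := heq hs
        simp only at this
        simp only [hδ, this]
        rw [truncate_of_mem hs]
        exact (rpow_rpow_density hβ (h'.delta_pos s (hsub s hs)).le).symm
      refine ⟨?_, ?_⟩
      · have := h1 z hz
        rwa [truncate_of_mem hz] at this
      · rw [h'.eta_eq hT z hz]
        exact ballMean_congr hz.1 fun s hs => h1 s ⟨hs.1, hs.2.trans hz.2⟩
    have hle : Z' ≤ Z := by
      by_contra hlt
      have hlt := not_le.1 hlt
      have h1 := (key Z hZ hlt le_rfl Z ⟨hZ.le, le_rfl⟩).1
      rw [hδZ] at h1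
      exact absurd h1 (h'.delta_pos Z ⟨hZ.le, hlt⟩).ne'
    refine ⟨hle, fun z hz => ?_⟩
    rcases hz.1.eq_or_lt with rfl | hz0
    · rw [h'.delta_center, h'.eta_center, hδneg 0 le_rfl, hη, ballMean_zero, hδneg 0 le_rfl]
      exact ⟨rfl, rfl⟩
    · exact key z hz0 hz.2 (EReal.coe_le_coe_iff.1 (hz.2.le.trans hle)) z ⟨hz.1, le_rfl⟩
  · exact lt_ballMean hδc.continuous hz.1
      (hanti.mono (Icc_subset_Icc_right hz.2.le))

end

/-! ### The polytropic constitutive function -/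

section
variable {κ ν γ β : ℝ}

lemma poisson_ratio_le (hν₁ : -1 < ν) (hν₂ : ν ≤ 1 / 2) :
    0 < (1 + ν) / (1 - ν) ∧ (1 + ν) / (1 - ν) ≤ 3 := by
  have h2 : 0 < 1 - ν := by linarith
  exact ⟨div_pos (by linarith) h2, by rw [div_le_iff₀ h2]; linarith⟩

lemma boundaryShear_rpow (hν₁ : -1 < ν) (hν₂ : ν ≤ 1 / 2) (hβ : 0 < β) (hβ₂ : β ≤ 4 / 3) :
    boundaryShear ν (4 / 3) β ^ β = 1 - β / 4 * ((1 + ν) / (1 - ν)) := by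
  have h := poisson_ratio_le hν₁ hν₂
  have h1 : 0 ≤ 1 - β / (3 * (4 / 3)) * ((1 + ν) / (1 - ν)) := by nlinarith [h.1, h.2]
  rw [boundaryShear, ← Real.rpow_mul h1, one_div_mul_cancel hβ.ne', Real.rpow_one]
  ring

lemma boundaryShear_nonneg (hν₁ : -1 < ν) (hν₂ : ν ≤ 1 / 2) (hβ₂ : β ≤ 4 / 3) :
    0 ≤ boundaryShear ν (4 / 3) β := by
  have h := poisson_ratio_le hν₁ hν₂
  exact Real.rpow_nonneg (by nlinarith [h.1, h.2]) _

lemma boundaryShear_lt_one (hν₁ : -1 < ν) (hν₂ : ν ≤ 1 / 2) (hβ : 0 < β) (hβ₂ : β ≤ 4 / 3) :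
    boundaryShear ν (4 / 3) β < 1 := by
  have h := poisson_ratio_le hν₁ hν₂
  exact Real.rpow_lt_one (by nlinarith [h.1, h.2]) (by nlinarith [mul_pos hβ h.1])
    (by positivity)

lemma boundaryShear_pos (hν₁ : -1 < ν) (hν₂ : ν ≤ 1 / 2) (hβ₂ : β ≤ 4 / 3)
    (h : ¬ (ν = 1 / 2 ∧ β = 4 / 3)) : 0 < boundaryShear ν (4 / 3) β := by
  refine Real.rpow_pos_of_pos ?_ _
  have h1 : 0 < 1 - ν := by linarith
  have h2 : 0 < 4 * (1 - ν) - β * (1 + ν) := by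
    rcases hβ₂.lt_or_eq with h3 | h3
    · nlinarith
    · rcases hν₂.lt_or_eq with h4 | h4
      · rw [h3]; linarith
      · exact absurd ⟨h4, h3⟩ h
  have h3 : 1 - β / (3 * (4 / 3)) * ((1 + ν) / (1 - ν))
      = (4 * (1 - ν) - β * (1 + ν)) / (4 * (1 - ν)) := by field_simp
  rw [h3]
  positivity

/-- The anisotropy `(1 - y) Q(y)`, a combination of `1 - y ^ β` and `1 - y`. -/
lemma one_sub_mul_polyQ (hβ : β ≠ 1) (y : ℝ) :
    (1 - y) * polyQ ν γ β y
      = 3 * (β - γ) * (1 - ν) / (2 * β * (β - 1) * (1 + ν)) * (1 - y ^ β)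
        + (3 * (γ - 1) * (1 - ν) / (2 * (β - 1) * (1 + ν)) - 1 / 2) * (1 - y) := by
  rw [polyQ, if_neg hβ]
  rcases eq_or_ne y 1 with rfl | hy
  · simp
  · have : 1 - y ≠ 0 := sub_ne_zero.2 hy.symm
    generalize 3 * (β - γ) * (1 - ν) / (2 * β * (β - 1) * (1 + ν)) = A
    generalize 3 * (γ - 1) * (1 - ν) / (2 * (β - 1) * (1 + ν)) = B
    field_simp
    ring

lemma polyTan_eq (hβ : β ≠ 1) (δ η : ℝ) :
    polyTan κ ν γ β δ η = polyRad κ ν γ β δ η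
      + 3 * κ * (3 * (β - γ) * (1 - ν) / (2 * β * (β - 1) * (1 + ν)) * (1 - (δ / η) ^ β)
        + (3 * (γ - 1) * (1 - ν) / (2 * (β - 1) * (1 + ν)) - 1 / 2) * (1 - δ / η)) * η ^ γ := by
  rw [polyTan, ← one_sub_mul_polyQ hβ]
  ring

variable {δ η : ℝ → ℝ} {δ' η' s : ℝ}

lemma hasDerivAt_shear (hδ : HasDerivAt δ δ' s) (hη : HasDerivAt η η' s) (hη0 : 0 < η s) :
    HasDerivAt (fun s => δ s / η s) ((δ' - δ s / η s * η') / η s) s := by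
  refine (hδ.div hη hη0.ne').congr_deriv ?_
  have := hη0.ne'
  field_simp

/-- The derivative of the radial pressure along a curve. -/
lemma hasDerivAt_polyRad (hδ : HasDerivAt δ δ' s) (hη : HasDerivAt η η' s) (hδ0 : 0 < δ s)
    (hη0 : 0 < η s) :
    HasDerivAt (fun s => polyRad κ ν γ β (δ s) (η s))
      (κ * (3 * (1 - ν) / (β * (1 + ν)) *
        (β * (δ s / η s) ^ (β - 1) * ((δ' - δ s / η s * η') / η s) * η s ^ γ
        + ((δ s / η s) ^ β - boundaryShear ν γ β ^ β) * (γ * η s ^ (γ - 1) * η')))) s := by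
  have hy0 : 0 < δ s / η s := div_pos hδ0 hη0
  have h1 := (hasDerivAt_shear hδ hη hη0).rpow_const (p := β) (Or.inl hy0.ne')
  have h2 := hη.rpow_const (p := γ) (Or.inl hη0.ne')
  refine (((((h1.sub_const (boundaryShear ν γ β ^ β)).const_mul
    (3 * (1 - ν) / (β * (1 + ν)))).mul h2).sub_const (1 / γ)).const_mul κ).congr_deriv ?_
  ring

lemma hasDerivAt_polyTan (hβ : β ≠ 1) (hδ : HasDerivAt δ δ' s) (hη : HasDerivAt η η' s)
    (hδ0 : 0 < δ s) (hη0 : 0 < η s) :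
    HasDerivAt (fun s => polyTan κ ν γ β (δ s) (η s))
      (κ * (3 * (1 - ν) / (β * (1 + ν)) *
        (β * (δ s / η s) ^ (β - 1) * ((δ' - δ s / η s * η') / η s) * η s ^ γ
        + ((δ s / η s) ^ β - boundaryShear ν γ β ^ β) * (γ * η s ^ (γ - 1) * η')))
      + 3 * κ * (-(3 * (β - γ) * (1 - ν) / (2 * β * (β - 1) * (1 + ν)) *
            (β * (δ s / η s) ^ (β - 1))
          + (3 * (γ - 1) * (1 - ν) / (2 * (β - 1) * (1 + ν)) - 1 / 2))
          * ((δ' - δ s / η s * η') / η s) * η s ^ γ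
        + (1 - δ s / η s) * polyQ ν γ β (δ s / η s) * (γ * η s ^ (γ - 1) * η'))) s := by
  have hy0 : 0 < δ s / η s := div_pos hδ0 hη0
  have h0 := hasDerivAt_shear hδ hη hη0
  have h1 := h0.rpow_const (p := β) (Or.inl hy0.ne')
  have h2 := hη.rpow_const (p := γ) (Or.inl hη0.ne')
  simp only [polyTan_eq hβ]
  refine ((hasDerivAt_polyRad hδ hη hδ0 hη0).add ((((((h1.const_sub 1).const_mul
    (3 * (β - γ) * (1 - ν) / (2 * β * (β - 1) * (1 + ν)))).add ((h0.const_sub 1).const_mul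
    (3 * (γ - 1) * (1 - ν) / (2 * (β - 1) * (1 + ν)) - 1 / 2))).const_mul (3 * κ))).mul
      h2)).congr_deriv ?_
  rw [one_sub_mul_polyQ hβ]
  simp only [Pi.add_apply]
  ring

lemma contDiffOn_polyRad {n : WithTop ℕ∞} :
    ContDiffOn ℝ n (fun p : ℝ × ℝ => polyRad κ ν γ β p.1 p.2) (Ioi 0 ×ˢ Ioi 0) := by
  unfold polyRad
  have h1 : ContDiffOn ℝ n (fun p : ℝ × ℝ => p.1 / p.2) (Ioi 0 ×ˢ Ioi 0) :=
    contDiff_fst.contDiffOn.div contDiff_snd.contDiffOn fun p hp => (mem_Ioi.1 hp.2).ne'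
  have h2 : ContDiffOn ℝ n (fun p : ℝ × ℝ => (p.1 / p.2) ^ β) (Ioi 0 ×ˢ Ioi 0) :=
    h1.rpow_const_of_ne fun p hp => (div_pos hp.1 hp.2).ne'
  have h3 : ContDiffOn ℝ n (fun p : ℝ × ℝ => p.2 ^ γ) (Ioi 0 ×ˢ Ioi 0) :=
    contDiff_snd.contDiffOn.rpow_const_of_ne fun p hp => (mem_Ioi.1 hp.2).ne'
  exact contDiffOn_const.mul (((contDiffOn_const.mul (h2.sub contDiffOn_const)).mul h3).sub
    contDiffOn_const)

lemma contDiffOn_polyTan (hβ : β ≠ 1) {n : WithTop ℕ∞} :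
    ContDiffOn ℝ n (fun p : ℝ × ℝ => polyTan κ ν γ β p.1 p.2) (Ioi 0 ×ˢ Ioi 0) := by
  simp only [polyTan_eq hβ]
  have h1 : ContDiffOn ℝ n (fun p : ℝ × ℝ => p.1 / p.2) (Ioi 0 ×ˢ Ioi 0) :=
    contDiff_fst.contDiffOn.div contDiff_snd.contDiffOn fun p hp => (mem_Ioi.1 hp.2).ne'
  have h2 : ContDiffOn ℝ n (fun p : ℝ × ℝ => (p.1 / p.2) ^ β) (Ioi 0 ×ˢ Ioi 0) :=
    h1.rpow_const_of_ne fun p hp => (div_pos hp.1 hp.2).ne'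
  have h3 : ContDiffOn ℝ n (fun p : ℝ × ℝ => p.2 ^ γ) (Ioi 0 ×ˢ Ioi 0) :=
    contDiff_snd.contDiffOn.rpow_const_of_ne fun p hp => (mem_Ioi.1 hp.2).ne'
  exact contDiffOn_polyRad.add ((contDiffOn_const.mul ((contDiffOn_const.mul
    (contDiffOn_const.sub h2)).add (contDiffOn_const.mul (contDiffOn_const.sub h1)))).mul h3)

lemma polyTan_self (d : ℝ) (hd : 0 < d) : polyTan κ ν γ β d d = polyRad κ ν γ β d d := by
  rw [polyTan, div_self hd.ne']; ring

lemma isElasticConstitutive_poly (hκ : 0 < κ) (hν₁ : -1 < ν) (hν₂ : ν ≤ 1 / 2) (hβ : 1 < β)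
    (hβ₂ : β ≤ 4 / 3) :
    IsElasticConstitutive κ ν (polyRad κ ν (4 / 3) β) (polyTan κ ν (4 / 3) β) := by
  have hβ0 : 0 < β := by linarith
  have hβ1 : β - 1 ≠ 0 := by linarith
  have h1 : (1 + ν) ≠ 0 := by linarith
  have h2 : (1 - ν) ≠ 0 := by linarith
  have hyb := boundaryShear_rpow hν₁ hν₂ hβ0 hβ₂
  have hrad : polyRad κ ν (4 / 3) β 1 1 = 0 := by
    simp only [polyRad, hyb, div_one, Real.one_rpow]
    field_simp
    ring
  refine ⟨hκ, ⟨hν₁, hν₂⟩, contDiffOn_polyRad, contDiffOn_polyTan hβ.ne',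
    fun d hd => (polyTan_self d hd).symm, fun d hd => ?_, hrad, (polyTan_self 1 one_pos).trans hrad,
    ?_, ?_, ?_, ?_⟩
  · have a1 := hasDerivAt_polyRad (κ := κ) (ν := ν) (γ := 4 / 3) (β := β)
      (hasDerivAt_const d d) (hasDerivAt_id d) hd hd
    have a2 := hasDerivAt_polyTan (κ := κ) (ν := ν) (γ := 4 / 3) hβ.ne'
      (hasDerivAt_const d d) (hasDerivAt_id d) hd hd
    simp only [id] at a1 a2
    have a3 : HasDerivAt (fun e => polyRad κ ν (4 / 3) β d e + 2 * polyTan κ ν (4 / 3) β d e) _ d :=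
      a1.add (a2.const_mul 2)
    rw [a3.deriv]
    simp only [div_self hd.ne', Real.one_rpow, hyb, sub_self, zero_mul, add_zero]
    have e : d ^ (4 / 3 : ℝ) = d * d ^ (4 / 3 - 1 : ℝ) := by
      rw [Real.rpow_sub_one hd.ne']; field_simp
    rw [e]
    field_simp
    ring
  · have a := hasDerivAt_polyRad (κ := κ) (ν := ν) (γ := 4 / 3) (β := β)
      (hasDerivAt_id (1 : ℝ)) (hasDerivAt_const (1 : ℝ) (1 : ℝ)) one_pos one_pos
    simp only [id] at a
    rw [a.deriv]
    simp only [div_one, Real.one_rpow]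
    field_simp
    ring
  · have a := hasDerivAt_polyRad (κ := κ) (ν := ν) (γ := 4 / 3) (β := β)
      (hasDerivAt_const (1 : ℝ) (1 : ℝ)) (hasDerivAt_id (1 : ℝ)) one_pos one_pos
    simp only [id] at a
    rw [a.deriv]
    simp only [div_one, Real.one_rpow, hyb]
    field_simp
    ring
  · have a := hasDerivAt_polyTan (κ := κ) (ν := ν) (γ := 4 / 3) hβ.ne'
      (hasDerivAt_id (1 : ℝ)) (hasDerivAt_const (1 : ℝ) (1 : ℝ)) one_pos one_pos
    simp only [id] at a
    rw [a.deriv]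
    simp only [div_one, Real.one_rpow, sub_self, zero_mul, add_zero]
    field_simp
    ring
  · have a := hasDerivAt_polyTan (κ := κ) (ν := ν) (γ := 4 / 3) hβ.ne'
      (hasDerivAt_const (1 : ℝ) (1 : ℝ)) (hasDerivAt_id (1 : ℝ)) one_pos one_pos
    simp only [id] at a
    rw [a.deriv]
    simp only [div_one, Real.one_rpow, sub_self, zero_mul, add_zero, hyb]
    field_simp
    ring

/-- The anisotropy is nonnegative: Bernoulli's inequality `1 - y ^ β ≤ β (1 - y)` bounds it below by
`(1 - y) (1 - 2ν) / (1 + ν)`. -/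
lemma one_sub_mul_polyQ_nonneg (hν₁ : -1 < ν) (hν₂ : ν ≤ 1 / 2) (hβ : 1 < β) (hβ₂ : β ≤ 4 / 3)
    {y : ℝ} (hy : 0 ≤ y) (hy1 : y ≤ 1) : 0 ≤ (1 - y) * polyQ ν (4 / 3) β y := by
  have hb : 0 < β - 1 := by linarith
  have h1 : 0 < 1 + ν := by linarith
  have h2 : 0 < 1 - ν := by linarith
  have hB := one_add_mul_self_le_rpow_one_add (s := y - 1) (by linarith) hβ.le
  rw [add_sub_cancel] at hB
  rw [one_sub_mul_polyQ hβ.ne']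
  have hA : 3 * (β - 4 / 3) * (1 - ν) / (2 * β * (β - 1) * (1 + ν)) ≤ 0 :=
    div_nonpos_of_nonpos_of_nonneg
      (mul_nonpos_of_nonpos_of_nonneg (by linarith) h2.le) (by positivity)
  have h3 : 3 * (β - 4 / 3) * (1 - ν) / (2 * β * (β - 1) * (1 + ν)) * (β * (1 - y))
      ≤ 3 * (β - 4 / 3) * (1 - ν) / (2 * β * (β - 1) * (1 + ν)) * (1 - y ^ β) :=
    mul_le_mul_of_nonpos_left (by linarith) hA
  have h4 : 3 * (β - 4 / 3) * (1 - ν) / (2 * β * (β - 1) * (1 + ν)) * (β * (1 - y))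
      + (3 * (4 / 3 - 1) * (1 - ν) / (2 * (β - 1) * (1 + ν)) - 1 / 2) * (1 - y)
      = (1 - y) * ((1 - 2 * ν) / (1 + ν)) := by
    field_simp
    ring
  have h5 : 0 ≤ (1 - y) * ((1 - 2 * ν) / (1 + ν)) :=
    mul_nonneg (by linarith) (div_nonneg (by linarith) h1.le)
  linarith

end

/-! ### The scale factor -/

/-- Time as a function of the parameter `ψ`, where the scale factor is `cosh² ψ`. -/
noncomputable def scaleTime (c ψ : ℝ) : ℝ := (Real.cosh ψ * Real.sinh ψ + ψ) / √(2 * c)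

lemma hasDerivAt_scaleTime (c ψ : ℝ) :
    HasDerivAt (scaleTime c) (2 * Real.cosh ψ ^ 2 / √(2 * c)) ψ := by
  refine ((((Real.hasDerivAt_cosh ψ).mul (Real.hasDerivAt_sinh ψ)).add
    (hasDerivAt_id ψ)).div_const (√(2 * c))).congr_deriv ?_
  congr 1
  linarith [Real.cosh_sq ψ]

lemma contDiff_scaleTime (c : ℝ) {n : WithTop ℕ∞} : ContDiff ℝ n (scaleTime c) := by
  unfold scaleTime
  have h1 := Real.contDiff_cosh (n := n)
  have h2 := Real.contDiff_sinh (n := n)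
  fun_prop

/-- An explicit scale factor: `ω = cosh² ψ` with `t = (cosh ψ sinh ψ + ψ) / √(2 c)`. -/
lemma exists_scaleFactor {c : ℝ} (hc : 0 < c) :
    ∃ ω : ℝ → ℝ, ContDiff ℝ 2 ω ∧ (∀ t, 1 ≤ ω t) ∧ ω 0 = 1 ∧ deriv ω 0 = 0 ∧
      (∀ t, ω t ^ 2 * deriv (deriv ω) t = c) ∧ (∀ t, 0 < t → 0 < deriv ω t) ∧
      Tendsto ω atTop atTop := by
  set r := √(2 * c) with hr
  have hr0 : 0 < r := by positivity
  have hmono : StrictMono (scaleTime c) := strictMono_of_deriv_pos fun ψ => by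
    rw [(hasDerivAt_scaleTime c ψ).deriv]
    have := Real.cosh_pos ψ
    positivity
  have hid : ∀ ψ, 0 ≤ ψ → ψ / r ≤ scaleTime c ψ := fun ψ hψ => by
    unfold scaleTime
    have h1 := mul_nonneg (Real.cosh_pos ψ).le (Real.sinh_nonneg_iff.2 hψ)
    gcongr
    linarith
  have hodd : ∀ ψ, scaleTime c (-ψ) = -scaleTime c ψ := fun ψ => by
    unfold scaleTime; rw [Real.cosh_neg, Real.sinh_neg]; ring
  have htop : Tendsto (scaleTime c) atTop atTop :=
    tendsto_atTop_mono' _ ((eventually_ge_atTop 0).mono hid) (tendsto_id.atTop_div_const hr0)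
  have hbot : Tendsto (scaleTime c) atBot atBot := by
    have h1 := tendsto_neg_atTop_atBot.comp (htop.comp tendsto_neg_atBot_atTop)
    refine h1.congr fun ψ => ?_
    simp [hodd]
  let e : ℝ ≃ₜ ℝ := (hmono.orderIsoOfSurjective _
    ((contDiff_scaleTime c (n := 0)).continuous.surjective htop hbot)).toHomeomorph
  have he : ∀ ψ, e ψ = scaleTime c ψ := fun _ => rfl
  have hd0 : ∀ ψ, 2 * Real.cosh ψ ^ 2 / r ≠ 0 := fun ψ => by
    have := Real.cosh_pos ψ
    positivity
  have hsymm : ContDiff ℝ 2 e.symm :=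
    e.contDiff_symm_deriv hd0 (fun ψ => hasDerivAt_scaleTime c ψ) (contDiff_scaleTime c)
  have hd : ∀ t, HasDerivAt e.symm (2 * Real.cosh (e.symm t) ^ 2 / r)⁻¹ t := fun t =>
    HasDerivAt.of_local_left_inverse (hsymm.continuous.continuousAt)
      (hasDerivAt_scaleTime c (e.symm t)) (hd0 _)
      (Eventually.of_forall fun s => e.apply_symm_apply s)
  have h00 : e.symm 0 = 0 := by
    rw [Homeomorph.symm_apply_eq, he, scaleTime]; simp
  set ω := fun t => Real.cosh (e.symm t) ^ 2 with hω
  have hω' : ∀ t, HasDerivAt ω (r * (Real.sinh (e.symm t) / Real.cosh (e.symm t))) t := by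
    intro t
    refine (((Real.hasDerivAt_cosh _).comp t (hd t)).pow 2).congr_deriv ?_
    have := (Real.cosh_pos (e.symm t)).ne'
    simp only [Function.comp_apply]
    push_cast
    field_simp
  have hdω : deriv ω = fun t => r * (Real.sinh (e.symm t) / Real.cosh (e.symm t)) :=
    funext fun t => (hω' t).deriv
  refine ⟨ω, (Real.contDiff_cosh.comp hsymm).pow 2, fun t => ?_, by simp [hω, h00], ?_, fun t => ?_,
    fun t ht => ?_, ?_⟩
  · exact one_le_pow₀ (Real.one_le_cosh _)
  · rw [hdω]; simp [h00]
  · have h2 : HasDerivAt (deriv ω) _ t := hdω ▸ ((((Real.hasDerivAt_sinh _).comp t (hd t)).div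
      ((Real.hasDerivAt_cosh _).comp t (hd t)) (Real.cosh_pos _).ne').const_mul r)
    rw [h2.deriv]
    have h3 := (Real.cosh_pos (e.symm t)).ne'
    have h4 : r ^ 2 = 2 * c := Real.sq_sqrt (by positivity)
    have h5 := Real.cosh_sq (e.symm t)
    simp only [Function.comp_apply, hω]
    generalize Real.cosh (e.symm t) = C at *
    generalize Real.sinh (e.symm t) = S at *
    field_simp
    have h6 : C ^ 2 - S ^ 2 = 1 := by linarith
    rw [h6, h4]; ring
  · rw [(hω' t).deriv]
    have h1 : 0 < e.symm t := by
      have : e 0 < e (e.symm t) := by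
        rw [e.apply_symm_apply, ← h00, e.apply_symm_apply]; exact ht
      exact hmono.lt_iff_lt.1 this
    have := Real.sinh_pos_iff.2 h1
    have := Real.cosh_pos (e.symm t)
    positivity
  · have h1 : Tendsto e.symm atTop atTop := by
      have := (hmono.orderIsoOfSurjective _
        ((contDiff_scaleTime c (n := 0)).continuous.surjective htop hbot)).symm.tendsto_atTop
      exact this
    refine tendsto_atTop_mono (fun t => ?_) h1
    have h2 : e.symm t ≤ Real.cosh (e.symm t) := by
      rw [Real.cosh_eq]
      have h3 := Real.add_one_le_exp (e.symm t)
      have h4 := Real.add_one_le_exp (-(e.symm t))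
      rcases le_total 0 (e.symm t) with h | h
      · have h5 := Real.quadratic_le_exp_of_nonneg h
        have h6 := (Real.exp_pos (-(e.symm t)))
        nlinarith [sq_nonneg (e.symm t - 1)]
      · have h6 := (Real.exp_pos (-(e.symm t)))
        have h7 := (Real.exp_pos (e.symm t))
        linarith
    have h3 := Real.one_le_cosh (e.symm t)
    simp only [hω]
    nlinarith

lemma derivWithin_Ici_eq {f : ℝ → ℝ} (hf : Differentiable ℝ f) {t : ℝ} (ht : 0 ≤ t) :
    derivWithin f (Ici 0) t = deriv f t :=
  (hf t).derivWithin (uniqueDiffOn_Ici 0 t ht)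

section
variable {G K α : ℝ} {ω : ℝ → ℝ}

lemma isScaleFactor_of_contDiff (h : ContDiff ℝ 2 ω) (h1 : ∀ t, 1 ≤ ω t) (h0 : ω 0 = 1)
    (h0' : deriv ω 0 = 0)
    (heq : ∀ t, ω t ^ 2 * deriv (deriv ω) t = 4 * Real.pi * G / 3 * K * α) :
    IsScaleFactor G K α ω := by
  have hd : Differentiable ℝ ω := h.differentiable two_ne_zero
  have hd' : Differentiable ℝ (deriv ω) :=
    ((contDiff_succ_iff_deriv (n := 1)).1 h).2.2.differentiable one_ne_zero
  refine ⟨h.contDiffOn, fun t _ => one_pos.trans_le (h1 t), h0, ?_, fun t ht => ?_⟩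
  · rw [derivWithin_Ici_eq hd le_rfl, h0']
  · have e : EqOn (derivWithin ω (Ici 0)) (deriv ω) (Ici 0) := fun s hs =>
      derivWithin_Ici_eq hd hs
    rw [derivWithin_congr e (e ht), derivWithin_Ici_eq hd' ht, heq]

lemma IsScaleFactor.hasDerivWithinAt (h : IsScaleFactor G K α ω) {t : ℝ} (ht : 0 ≤ t) :
    HasDerivWithinAt ω (derivWithin ω (Ici 0) t) (Ici 0) t :=
  (h.contDiff.differentiableOn two_ne_zero t ht).hasDerivWithinAt

lemma IsScaleFactor.contDiffOn_derivWithin (h : IsScaleFactor G K α ω) :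
    ContDiffOn ℝ 1 (derivWithin ω (Ici 0)) (Ici 0) :=
  ((contDiffOn_succ_iff_derivWithin (n := 1) (uniqueDiffOn_Ici 0)).1 h.contDiff).2.2

lemma IsScaleFactor.hasDerivWithinAt_derivWithin (h : IsScaleFactor G K α ω) {t : ℝ}
    (ht : 0 ≤ t) :
    HasDerivWithinAt (derivWithin ω (Ici 0)) (4 * Real.pi * G / 3 * K * α / ω t ^ 2)
      (Ici 0) t := by
  have h1 := (h.contDiffOn_derivWithin.differentiableOn one_ne_zero t ht).hasDerivWithinAt
  have h2 := h.equation t ht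
  have h3 := h.pos t ht
  rwa [show derivWithin (derivWithin ω (Ici 0)) (Ici 0) t
      = 4 * Real.pi * G / 3 * K * α / ω t ^ 2 by rw [← h2]; field_simp] at h1

lemma monotoneOn_Ici_of_hasDerivWithinAt_nonneg {f f' : ℝ → ℝ}
    (hf : ∀ t, 0 ≤ t → HasDerivWithinAt f (f' t) (Ici 0) t) (hf' : ∀ t, 0 < t → 0 ≤ f' t) :
    MonotoneOn f (Ici 0) := by
  refine monotoneOn_of_deriv_nonneg (convex_Ici 0) (fun t ht => (hf t ht).continuousWithinAt)
    (fun t ht => ?_) fun t ht => ?_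
  · rw [interior_Ici] at ht
    exact ((hf t (le_of_lt ht)).hasDerivAt (Ici_mem_nhds ht)).differentiableAt.differentiableWithinAt
  · rw [interior_Ici] at ht
    rw [((hf t (le_of_lt ht)).hasDerivAt (Ici_mem_nhds ht)).deriv]
    exact hf' t ht

lemma IsScaleFactor.one_le (h : IsScaleFactor G K α ω) (hG : 0 < G) (hK : 0 < K) (hα : 0 < α)
    {t : ℝ} (ht : 0 ≤ t) : 1 ≤ ω t := by
  have hpi := Real.pi_pos
  have h1 := monotoneOn_Ici_of_hasDerivWithinAt_nonneg (fun t ht => h.hasDerivWithinAt_derivWithin ht)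
    (fun t _ => by positivity)
  have h2 := monotoneOn_Ici_of_hasDerivWithinAt_nonneg (fun t ht => h.hasDerivWithinAt ht)
    (fun t ht => by
      have := h1 (mem_Ici.2 le_rfl) (mem_Ici.2 ht.le) ht.le
      rwa [h.init_deriv] at this)
  have := h2 (mem_Ici.2 le_rfl) (mem_Ici.2 ht) ht
  rwa [h.init] at this

/-- Uniqueness of the scale factor: a scale factor stays above `1`, where the equation is
Lipschitz. -/
lemma IsScaleFactor.eqOn {ω' : ℝ → ℝ} (h : IsScaleFactor G K α ω) (h' : IsScaleFactor G K α ω')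
    (hG : 0 < G) (hK : 0 < K) (hα : 0 < α) : EqOn ω' ω (Ici 0) := by
  have hpi := Real.pi_pos
  obtain ⟨c, hc⟩ : ∃ c, c = 4 * Real.pi * G / 3 * K * α := ⟨_, rfl⟩
  have hc0 : 0 < c := by rw [hc]; positivity
  let v : ℝ → ℝ × ℝ → ℝ × ℝ := fun _ p => (p.2, c / p.1 ^ 2)
  let S : ℝ → Set (ℝ × ℝ) := fun _ => {p | 1 ≤ p.1}
  have hlip : ∀ t, LipschitzOnWith (max 1 (2 * c)).toNNReal (v t) (S t) := by
    intro t
    refine LipschitzOnWith.of_dist_le_mul fun p hp q hq => ?_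
    have hp : 1 ≤ p.1 := hp
    have hq : 1 ≤ q.1 := hq
    rw [Real.coe_toNNReal _ (by positivity)]
    have hd1 : |p.1 - q.1| ≤ dist p q := le_max_left (dist p.1 q.1) (dist p.2 q.2)
    have hd2 : |p.2 - q.2| ≤ dist p q := le_max_right (dist p.1 q.1) (dist p.2 q.2)
    refine max_le ?_ ?_
    · calc dist (v t p).1 (v t q).1 = 1 * |p.2 - q.2| := by rw [one_mul]; rfl
        _ ≤ _ := by
          gcongr
          exact le_max_left _ _
    · have e : c / p.1 ^ 2 - c / q.1 ^ 2
          = c * ((q.1 - p.1) * (1 / (p.1 ^ 2 * q.1) + 1 / (p.1 * q.1 ^ 2))) := by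
        have : p.1 ≠ 0 := by positivity
        have : q.1 ≠ 0 := by positivity
        field_simp
        ring
      have b1 : 1 / (p.1 ^ 2 * q.1) ≤ 1 := by
        rw [div_le_one (by positivity)]
        exact one_le_mul_of_one_le_of_one_le (one_le_pow₀ hp) hq
      have b2 : 1 / (p.1 * q.1 ^ 2) ≤ 1 := by
        rw [div_le_one (by positivity)]
        exact one_le_mul_of_one_le_of_one_le hp (one_le_pow₀ hq)
      have b0 : 0 ≤ 1 / (p.1 ^ 2 * q.1) + 1 / (p.1 * q.1 ^ 2) := by positivity
      calc dist (v t p).2 (v t q).2 = |c / p.1 ^ 2 - c / q.1 ^ 2| := rfl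
        _ = c * (|p.1 - q.1| * (1 / (p.1 ^ 2 * q.1) + 1 / (p.1 * q.1 ^ 2))) := by
          rw [e, abs_mul, abs_mul, abs_of_pos hc0, abs_of_nonneg b0, abs_sub_comm]
        _ ≤ c * (dist p q * 2) := by
          gcongr
          linarith
        _ = 2 * c * dist p q := by ring
        _ ≤ _ := by gcongr; exact le_max_right _ _
  have hsol : ∀ w, IsScaleFactor G K α w → ∀ T,
      ContinuousOn (fun t => (w t, derivWithin w (Ici 0) t)) (Icc 0 T) ∧
      ∀ t ∈ Ico 0 T, HasDerivWithinAt (fun t => (w t, derivWithin w (Ici 0) t))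
        (v t (w t, derivWithin w (Ici 0) t)) (Ici t) t := by
    intro w hw T
    have hw' : ∀ t, 0 ≤ t → HasDerivWithinAt (derivWithin w (Ici 0)) (c / w t ^ 2) (Ici 0) t :=
      fun t ht => hc ▸ hw.hasDerivWithinAt_derivWithin ht
    refine ⟨fun t ht => ?_, fun t ht => ?_⟩
    · exact (((hw.hasDerivWithinAt ht.1).continuousWithinAt).prodMk
        ((hw' t ht.1).continuousWithinAt)).mono Icc_subset_Ici_self
    · exact ((hw.hasDerivWithinAt ht.1).prodMk (hw' t ht.1)).mono
        (Ici_subset_Ici.2 ht.1)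
  intro T hT
  have := ODE_solution_unique_of_mem_Icc_right (v := v) (s := S) (fun t _ => hlip t)
    (hsol ω' h' T).1 (hsol ω' h' T).2 (fun t ht => h'.one_le hG hK hα ht.1)
    (hsol ω h T).1 (hsol ω h T).2 (fun t ht => h.one_le hG hK hα ht.1)
    (by simp only [h.init, h'.init, h.init_deriv, h'.init_deriv])
  exact congrArg Prod.fst (this ⟨hT, le_rfl⟩)

end

/-! ### Hydrostatic form of the profile equation -/

/-- For a mean density `η`, the equation for `δ` in the profile system is the balance of the
pressure gradient with gravity and the homologous acceleration: the defects of both equations are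
proportional. -/
lemma pressure_balance {G K κ ν β α x δ η δ' : ℝ} (hκ : 0 < κ) (hν₁ : -1 < ν)
    (hν₂ : ν ≤ 1 / 2) (hβ : 1 < β) (hβ₂ : β ≤ 4 / 3) (hx : 0 < x) (hδ : 0 < δ) (hη : 0 < η) :
    -(κ * (3 * (1 - ν) / (β * (1 + ν)) *
        (β * (δ / η) ^ (β - 1) * ((δ' - δ / η * (-(3 / x) * (η - δ))) / η) * η ^ (4 / 3 : ℝ)
        + ((δ / η) ^ β - boundaryShear ν (4 / 3) β ^ β) *
          (4 / 3 * η ^ (4 / 3 - 1 : ℝ) * (-(3 / x) * (η - δ))))))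
      + 2 / x * (polyTan κ ν (4 / 3) β δ η - polyRad κ ν (4 / 3) β δ η)
      - 4 * Real.pi * G / 3 * K ^ 2 * x * δ * (η + α)
    = -(3 * κ * (1 - ν) / (1 + ν)) * η ^ (1 / 3 : ℝ) * (δ / η) ^ (β - 1) *
      (δ' - (δ / η) ^ (1 - β) *
        (3 * (β - 4 / 3) / x * profileB β (δ / η) * η
          - profileTheta G K κ ν * x * η ^ (-(1 / 3) : ℝ) * δ * (η + α))) := by
  have hb : β - 1 ≠ 0 := by linarith
  have hβ0 : 0 < β := by linarith
  have h1 : 1 + ν ≠ 0 := by linarith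
  have h2 : 1 - ν ≠ 0 := by linarith
  rw [polyTan_eq hβ.ne', boundaryShear_rpow hν₁ hν₂ hβ0 hβ₂, profileB, if_neg hβ.ne', profileTheta]
  obtain ⟨y, hy⟩ : ∃ y, y = δ / η := ⟨_, rfl⟩
  have hy0 : 0 < y := hy ▸ div_pos hδ hη
  have hδy : δ = y * η := by rw [hy]; field_simp
  rw [← hy, hδy]
  obtain ⟨Y, hY⟩ : ∃ Y, Y = y ^ (β - 1) := ⟨_, rfl⟩
  have hY0 : Y ≠ 0 := hY ▸ (Real.rpow_pos_of_pos hy0 _).ne'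
  have e1 : y ^ β = y * Y := by rw [hY, Real.rpow_sub_one hy0.ne']; field_simp
  have e2 : y ^ (1 + β) = y ^ 2 * Y := by
    rw [Real.rpow_add hy0, Real.rpow_one, e1]; ring
  have e3 : y ^ (1 - β) = 1 / Y := by
    rw [hY, one_div, ← Real.rpow_neg hy0.le, neg_sub]
  obtain ⟨E, hE⟩ : ∃ E, E = η ^ (1 / 3 : ℝ) := ⟨_, rfl⟩
  have hE0 : E ≠ 0 := hE ▸ (Real.rpow_pos_of_pos hη _).ne'
  have e4 : η ^ (4 / 3 - 1 : ℝ) = E := by rw [hE]; norm_num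
  have e5 : η ^ (4 / 3 : ℝ) = η * E := by
    rw [← e4, Real.rpow_sub_one hη.ne']; field_simp
  have e6 : η ^ (-(1 / 3) : ℝ) = 1 / E := by
    rw [hE, Real.rpow_neg hη.le, inv_eq_one_div]
  rw [e1, e2, e3, e4, e5, e6, ← hE, ← hY]
  have hη' := hη.ne'
  have hx' := hx.ne'
  have hκ' := hκ.ne'
  field_simp
  ring

/-! ### Homologous fields -/

/-- The field `a(t) g(r / ω(t))` inside the ball of radius `Z ω(t)`, continued by zero. -/
noncomputable def homologousField (Z : ℝ) (ω a g : ℝ → ℝ) (t r : ℝ) : ℝ :=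
  if r ≤ Z * ω t then a t * g (r / ω t) else 0

section
variable {Z Zmax : ℝ} {ω a g : ℝ → ℝ}

lemma homologousField_of_le {t r : ℝ} (h : r ≤ Z * ω t) :
    homologousField Z ω a g t r = a t * g (r / ω t) := if_pos h

lemma homologousField_of_lt {t r : ℝ} (h : Z * ω t < r) : homologousField Z ω a g t r = 0 :=
  if_neg (not_le.2 h)

lemma isRegularField_homologousField (hω : ContDiff ℝ 1 ω) (hω0 : ∀ t, 0 < ω t)
    (ha : ContDiff ℝ 1 a) (hg : ContDiffOn ℝ 1 g (Iio Zmax)) (hZ : Z < Zmax) :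
    IsRegularField (Ici 0) (fun t => Z * ω t) (homologousField Z ω a g) := by
  have key : ContDiffOn ℝ 1 (fun p : ℝ × ℝ => homologousField Z ω a g p.1 p.2)
      (closedRegion (Ici 0) fun t => Z * ω t) := by
    have h1 : ContDiffOn ℝ 1 (fun p : ℝ × ℝ => a p.1 * g (p.2 / ω p.1))
        (closedRegion (Ici 0) fun t => Z * ω t) := by
      refine (ha.comp contDiff_fst).contDiffOn.mul (hg.comp
        (contDiff_snd.div (hω.comp contDiff_fst) fun p => (hω0 p.1).ne').contDiffOn
        fun p hp => ?_)
      have h2 := hp.2.2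
      exact mem_Iio.2 (lt_of_le_of_lt ((div_le_iff₀ (hω0 p.1)).2 h2) hZ)
    exact h1.congr fun p hp => homologousField_of_le hp.2.2
  exact ⟨key.continuousOn, key.mono fun p hp => ⟨hp.1, hp.2.1, le_of_lt hp.2.2⟩⟩

lemma hasDerivAt_homologousField_radius (hω0 : ∀ t, 0 < ω t)
    (hg : ContDiffOn ℝ 1 g (Iio Zmax)) (hZ : Z < Zmax) {t r : ℝ} (hr : r < Z * ω t) :
    HasDerivAt (homologousField Z ω a g t) (a t * (deriv g (r / ω t) / ω t)) r := by
  have hx : r / ω t < Zmax := ((div_lt_iff₀ (hω0 t)).2 hr).trans hZ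
  have h1 : HasDerivAt g (deriv g (r / ω t)) (r / ω t) :=
    ((hg.differentiableOn one_ne_zero).differentiableAt (isOpen_Iio.mem_nhds hx)).hasDerivAt
  have h2 := (h1.comp r ((hasDerivAt_id r).div_const (ω t))).const_mul (a t)
  refine (h2.congr_of_eventuallyEq ?_).congr_deriv (by ring)
  filter_upwards [Iio_mem_nhds hr] with s hs
  exact homologousField_of_le (le_of_lt hs)

lemma hasDerivAt_homologousField_time (hω : Differentiable ℝ ω) (hω0 : ∀ t, 0 < ω t)
    (ha : Differentiable ℝ a) (hg : ContDiffOn ℝ 1 g (Iio Zmax)) (hZ : Z < Zmax) {t r : ℝ}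
    (hr : r < Z * ω t) :
    HasDerivAt (fun s => homologousField Z ω a g s r)
      (deriv a t * g (r / ω t) - a t * (deriv g (r / ω t) * (r * deriv ω t / ω t ^ 2))) t := by
  have hx : r / ω t < Zmax := ((div_lt_iff₀ (hω0 t)).2 hr).trans hZ
  have h1 : HasDerivAt g (deriv g (r / ω t)) (r / ω t) :=
    ((hg.differentiableOn one_ne_zero).differentiableAt (isOpen_Iio.mem_nhds hx)).hasDerivAt
  have h2 : HasDerivAt (fun s => r / ω s) (-(r * deriv ω t / ω t ^ 2)) t := by
    refine ((hasDerivAt_const t r).div (hω t).hasDerivAt (hω0 t).ne').congr_deriv ?_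
    ring
  have h3 := (ha t).hasDerivAt.mul (h1.comp t h2)
  refine (h3.congr_of_eventuallyEq ?_).congr_deriv (by simp only [Function.comp_apply]; ring)
  have h4 : ∀ᶠ s in 𝓝 t, r < Z * ω s :=
    (continuousAt_const.mul (hω t).continuousAt).eventually_const_lt hr
  filter_upwards [h4] with s hs
  exact homologousField_of_le (le_of_lt hs)

lemma tendsto_deriv_homologousField (hω0 : ∀ t, 0 < ω t) (hg : ContDiffOn ℝ 1 g (Iio Zmax))
    (hZ0 : 0 < Z) (hZ : Z < Zmax) (t : ℝ) :
    Tendsto (deriv (homologousField Z ω a g t)) (𝓝[>] 0) (𝓝 (a t * (deriv g 0 / ω t))) := by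
  have h1 : ContinuousOn (deriv g) (Iio Zmax) := hg.continuousOn_deriv_of_isOpen isOpen_Iio le_rfl
  have h2 : ContinuousAt (fun r => a t * (deriv g (r / ω t) / ω t)) 0 := by
    have h3 : ContinuousAt (deriv g) (0 / ω t) := by
      rw [zero_div]; exact h1.continuousAt (Iio_mem_nhds (hZ0.trans hZ))
    have h4 : ContinuousAt (fun r => deriv g (r / ω t)) 0 :=
      ContinuousAt.comp (f := fun r => r / ω t) h3 (by fun_prop)
    exact continuousAt_const.mul (h4.div_const _)
  have h5 : Tendsto (fun r => a t * (deriv g (r / ω t) / ω t)) (𝓝[>] 0)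
      (𝓝 (a t * (deriv g 0 / ω t))) := by
    have := h2.tendsto.mono_left (nhdsWithin_le_nhds (s := Ioi 0))
    simpa only [zero_div] using this
  refine h5.congr' ?_
  filter_upwards [nhdsWithin_le_nhds (Iio_mem_nhds (mul_pos hZ0 (hω0 t)))] with r hr
  exact (hasDerivAt_homologousField_radius hω0 hg hZ hr).deriv.symm

end

/-- The mass is the volume times the mean density. -/
lemma enclosedMass_eq {K : ℝ} (hK : K ≠ 0) (ρ : ℝ → ℝ → ℝ) (t r : ℝ) :
    enclosedMass ρ t r = 4 * Real.pi / 3 * K * r ^ 3 * ballMean (fun s => ρ t s / K) r := by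
  have h := pow_mul_ballMean (fun s => ρ t s / K) r
  have h2 : ∫ s in (0 : ℝ)..r, s ^ 2 * (ρ t s / K) = (∫ s in (0 : ℝ)..r, ρ t s * s ^ 2) / K := by
    rw [← intervalIntegral.integral_div]
    congr 1; ext s; ring
  rw [h2] at h
  rw [enclosedMass, mul_assoc _ (r ^ 3), h]
  field_simp

lemma enclosedMass_div {K r : ℝ} (hK : K ≠ 0) (hr : r ≠ 0) (ρ : ℝ → ℝ → ℝ) (t : ℝ) :
    enclosedMass ρ t r / (4 * Real.pi / 3 * K * r ^ 3) = ballMean (fun s => ρ t s / K) r := by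
  rw [enclosedMass_eq hK]
  have := Real.pi_pos.ne'
  field_simp

lemma ballMean_comp_div (f : ℝ → ℝ) (w r : ℝ) (c : ℝ) :
    ballMean (fun s => f (s / w) * c) r = ballMean f (r / w) * c := by
  unfold ballMean
  rw [mul_assoc, ← intervalIntegral.integral_mul_const]
  congr 2; ext τ
  have e : r * τ / w = r / w * τ := by ring
  simp only [e]
  ring

/-! ### Scaling of the polytropic pressures -/

lemma polyRad_scale {κ ν β δ η w : ℝ} (hη : 0 < η) (hw : 0 < w) :
    κ / (4 / 3) + polyRad κ ν (4 / 3) β (δ * (w ^ 3)⁻¹) (η * (w ^ 3)⁻¹)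
      = (w ^ 4)⁻¹ * (κ / (4 / 3) + polyRad κ ν (4 / 3) β δ η) := by
  have h1 : (η * (w ^ 3)⁻¹) ^ (4 / 3 : ℝ) = η ^ (4 / 3 : ℝ) * (w ^ 4)⁻¹ := by
    rw [Real.mul_rpow hη.le (by positivity), Real.inv_rpow (by positivity),
      ← Real.rpow_natCast w 3, ← Real.rpow_mul hw.le, ← Real.rpow_natCast w 4]
    norm_num
  have h2 : δ * (w ^ 3)⁻¹ / (η * (w ^ 3)⁻¹) = δ / η := by
    have := hw.ne'
    field_simp
  rw [polyRad, polyRad, h1, h2]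
  ring

lemma polyTan_scale {κ ν β δ η w : ℝ} (hη : 0 < η) (hw : 0 < w) :
    κ / (4 / 3) + polyTan κ ν (4 / 3) β (δ * (w ^ 3)⁻¹) (η * (w ^ 3)⁻¹)
      = (w ^ 4)⁻¹ * (κ / (4 / 3) + polyTan κ ν (4 / 3) β δ η) := by
  have h1 : (η * (w ^ 3)⁻¹) ^ (4 / 3 : ℝ) = η ^ (4 / 3 : ℝ) * (w ^ 4)⁻¹ := by
    rw [Real.mul_rpow hη.le (by positivity), Real.inv_rpow (by positivity),
      ← Real.rpow_natCast w 3, ← Real.rpow_mul hw.le, ← Real.rpow_natCast w 4]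
    norm_num
  have h2 : δ * (w ^ 3)⁻¹ / (η * (w ^ 3)⁻¹) = δ / η := by
    have := hw.ne'
    field_simp
  have h3 := polyRad_scale (κ := κ) (ν := ν) (β := β) (δ := δ) hη hw
  rw [polyTan, polyTan, ← add_assoc, h3, h1, h2]
  ring

lemma add_polyRad_eq (κ ν β δ η : ℝ) :
    κ / (4 / 3) + polyRad κ ν (4 / 3) β δ η = κ * (3 * (1 - ν) / (β * (1 + ν)) *
      ((δ / η) ^ β - boundaryShear ν (4 / 3) β ^ β) * η ^ (4 / 3 : ℝ)) := by
  rw [polyRad]; ring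

/-! ### Existence of homologous balls -/

/-- A pair of `C¹` functions on the line which is, on `(0, Zmax)`, a strongly regular solution of the
profile system with positive density, and whose derivatives vanish at the center. -/
structure IsSmoothProfile (G K κ ν β α Zmax : ℝ) (δ η : ℝ → ℝ) : Prop where
  delta_contDiff : ContDiff ℝ 1 δ
  eta_contDiff : ContDiff ℝ 1 η
  deriv_delta_zero : deriv δ 0 = 0
  deriv_eta_zero : deriv η 0 = 0
  delta_pos : ∀ z < Zmax, 0 < δ z
  eta_pos : ∀ z < Zmax, 0 < η z
  eta_eq : η = ballMean δ
  delta_lt_eta : ∀ z ∈ Ioo 0 Zmax, δ z < η z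
  delta_equation : ∀ z ∈ Ioo 0 Zmax, HasDerivAt δ ((δ z / η z) ^ (1 - β) *
      (3 * (β - 4 / 3) / z * profileB β (δ z / η z) * η z
        - profileTheta G K κ ν * z * η z ^ (-(1 / 3) : ℝ) * δ z * (η z + α))) z

/-- The radial pressure of a ball with density profile `(δ, η)`. -/
noncomputable def profilePRad (κ ν β : ℝ) (δ η : ℝ → ℝ) (x : ℝ) : ℝ :=
  κ / (4 / 3) + polyRad κ ν (4 / 3) β (δ x) (η x)

/-- The tangential pressure of a ball with density profile `(δ, η)`. -/
noncomputable def profilePTan (κ ν β : ℝ) (δ η : ℝ → ℝ) (x : ℝ) : ℝ :=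
  κ / (4 / 3) + polyTan κ ν (4 / 3) β (δ x) (η x)

/-- The ball of radius `Z ω` with density profile `(δ, η)`, moving homologously with scale factor
`ω`. -/
noncomputable def homologousBall (K κ ν β Z : ℝ) (ω δ η : ℝ → ℝ) : Matter where
  rho := homologousField Z ω (fun t => K * (ω t ^ 3)⁻¹) δ
  pRad := homologousField Z ω (fun t => (ω t ^ 4)⁻¹) (profilePRad κ ν β δ η)
  pTan := homologousField Z ω (fun t => (ω t ^ 4)⁻¹) (profilePTan κ ν β δ η)
  u := homologousField Z ω (deriv ω) fun x => x

section
variable {G K κ ν β α Z Zmax : ℝ} {δ η ω : ℝ → ℝ}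

namespace IsSmoothProfile

lemma eta_hasDerivAt (h : IsSmoothProfile G K κ ν β α Zmax δ η) {x : ℝ} (hx : 0 < x) :
    HasDerivAt η (-(3 / x) * (η x - δ x)) x := by
  rw [h.eta_eq]
  exact hasDerivAt_ballMean h.delta_contDiff.continuous hx

lemma eta_zero (h : IsSmoothProfile G K κ ν β α Zmax δ η) : η 0 = δ 0 := by
  rw [h.eta_eq, ballMean_zero]

lemma contDiffOn_pair (h : IsSmoothProfile G K κ ν β α Zmax δ η) :
    ContDiffOn ℝ 1 (fun x => (δ x, η x)) (Iio Zmax) :=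
  (h.delta_contDiff.prodMk h.eta_contDiff).contDiffOn

lemma mapsTo_pair (h : IsSmoothProfile G K κ ν β α Zmax δ η) :
    MapsTo (fun x => (δ x, η x)) (Iio Zmax) (Ioi 0 ×ˢ Ioi 0) :=
  fun x hx => ⟨h.delta_pos x hx, h.eta_pos x hx⟩

lemma contDiffOn_pRad (h : IsSmoothProfile G K κ ν β α Zmax δ η) :
    ContDiffOn ℝ 1 (profilePRad κ ν β δ η) (Iio Zmax) := by
  have h1 := (contDiffOn_polyRad (κ := κ) (ν := ν) (γ := 4 / 3) (β := β) (n := 1)).comp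
    h.contDiffOn_pair h.mapsTo_pair
  exact contDiffOn_const.add h1

lemma contDiffOn_pTan (h : IsSmoothProfile G K κ ν β α Zmax δ η) (hβ : β ≠ 1) :
    ContDiffOn ℝ 1 (profilePTan κ ν β δ η) (Iio Zmax) := by
  have h1 := (contDiffOn_polyTan (κ := κ) (ν := ν) (γ := 4 / 3) hβ (n := 1)).comp h.contDiffOn_pair
    h.mapsTo_pair
  exact contDiffOn_const.add h1

lemma deriv_pRad_zero (h : IsSmoothProfile G K κ ν β α Zmax δ η) (hZ : 0 < Zmax) :
    deriv (profilePRad κ ν β δ η) 0 = 0 := by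
  have h1 := h.delta_contDiff.hasDerivAt_one 0
  have h2 := h.eta_contDiff.hasDerivAt_one 0
  rw [h.deriv_delta_zero] at h1
  rw [h.deriv_eta_zero] at h2
  have h3 : HasDerivAt (profilePRad κ ν β δ η) _ 0 :=
    (hasDerivAt_polyRad h1 h2 (h.delta_pos 0 hZ) (h.eta_pos 0 hZ)).const_add _
  rw [h3.deriv]
  simp

lemma deriv_pTan_zero (h : IsSmoothProfile G K κ ν β α Zmax δ η) (hβ : β ≠ 1) (hZ : 0 < Zmax) :
    deriv (profilePTan κ ν β δ η) 0 = 0 := by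
  have h1 := h.delta_contDiff.hasDerivAt_one 0
  have h2 := h.eta_contDiff.hasDerivAt_one 0
  rw [h.deriv_delta_zero] at h1
  rw [h.deriv_eta_zero] at h2
  have h3 : HasDerivAt (profilePTan κ ν β δ η) _ 0 :=
    (hasDerivAt_polyTan hβ h1 h2 (h.delta_pos 0 hZ) (h.eta_pos 0 hZ)).const_add _
  rw [h3.deriv]
  simp

/-- The profile is in mechanical equilibrium in the comoving frame. -/
lemma balance (h : IsSmoothProfile G K κ ν β α Zmax δ η) (hκ : 0 < κ) (hν₁ : -1 < ν)
    (hν₂ : ν ≤ 1 / 2) (hβ : 1 < β) (hβ₂ : β ≤ 4 / 3) {x : ℝ} (hx : x ∈ Ioo 0 Zmax) :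
    -deriv (profilePRad κ ν β δ η) x
      + 2 / x * (profilePTan κ ν β δ η x - profilePRad κ ν β δ η x)
      = 4 * Real.pi * G / 3 * K ^ 2 * x * δ x * (η x + α) := by
  have h1 := h.delta_equation x hx
  have h2 := h.eta_hasDerivAt hx.1
  have hδ := h.delta_pos x hx.2
  have hη := h.eta_pos x hx.2
  have h3 : HasDerivAt (profilePRad κ ν β δ η) _ x :=
    (hasDerivAt_polyRad h1 h2 hδ hη).const_add (κ / (4 / 3))
  have h4 := pressure_balance (G := G) (K := K) (α := α) (δ' := (δ x / η x) ^ (1 - β) *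
      (3 * (β - 4 / 3) / x * profileB β (δ x / η x) * η x
        - profileTheta G K κ ν * x * η x ^ (-(1 / 3) : ℝ) * δ x * (η x + α)))
    hκ hν₁ hν₂ hβ hβ₂ hx.1 hδ hη
  rw [sub_self, mul_zero] at h4
  rw [h3.deriv, profilePTan, profilePRad, add_sub_add_left_eq_sub]
  linarith

lemma pRad_le_pTan (h : IsSmoothProfile G K κ ν β α Zmax δ η) (hκ : 0 < κ) (hν₁ : -1 < ν)
    (hν₂ : ν ≤ 1 / 2) (hβ : 1 < β) (hβ₂ : β ≤ 4 / 3) {x : ℝ} (hx0 : 0 ≤ x) (hx : x < Zmax) :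
    profilePRad κ ν β δ η x ≤ profilePTan κ ν β δ η x := by
  have hδ := h.delta_pos x hx
  have hη := h.eta_pos x hx
  have hy : δ x / η x ≤ 1 := by
    rcases hx0.eq_or_lt with rfl | hx0
    · rw [h.eta_zero, div_self hδ.ne']
    · exact (div_le_one hη).2 (h.delta_lt_eta x ⟨hx0, hx⟩).le
  have h1 := one_sub_mul_polyQ_nonneg hν₁ hν₂ hβ hβ₂ (div_pos hδ hη).le hy
  have h2 : 0 < η x ^ (4 / 3 : ℝ) := Real.rpow_pos_of_pos hη _
  rw [profilePRad, profilePTan, polyTan]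
  have : 0 ≤ κ * (3 * ((1 - δ x / η x) * polyQ ν (4 / 3) β (δ x / η x)) * η x ^ (4 / 3 : ℝ)) := by
    positivity
  linarith

end IsSmoothProfile

/-- The radial pressure is positive exactly where the shear variable exceeds the boundary shear. -/
lemma add_polyRad_pos_iff (hκ : 0 < κ) (hν₁ : -1 < ν) (hν₂ : ν ≤ 1 / 2) (hβ : 0 < β)
    (hβ₂ : β ≤ 4 / 3) {d e : ℝ} (hd : 0 < d) (he : 0 < e) :
    0 < κ / (4 / 3) + polyRad κ ν (4 / 3) β d e ↔ boundaryShear ν (4 / 3) β < d / e := by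
  have h1 : 0 < 1 + ν := by linarith
  have h2 : 0 < 1 - ν := by linarith
  have h3 : 0 < e ^ (4 / 3 : ℝ) := Real.rpow_pos_of_pos he _
  rw [add_polyRad_eq, mul_pos_iff_of_pos_left hκ, mul_pos_iff_of_pos_right h3,
    mul_pos_iff_of_pos_left (by positivity), sub_pos,
    Real.rpow_lt_rpow_iff (boundaryShear_nonneg hν₁ hν₂ hβ₂) (div_pos hd he).le hβ]

lemma add_polyRad_eq_zero_iff (hκ : 0 < κ) (hν₁ : -1 < ν) (hν₂ : ν ≤ 1 / 2) (hβ : 0 < β)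
    (hβ₂ : β ≤ 4 / 3) {d e : ℝ} (hd : 0 < d) (he : 0 < e) :
    κ / (4 / 3) + polyRad κ ν (4 / 3) β d e = 0 ↔ d / e = boundaryShear ν (4 / 3) β := by
  have h1 : 0 < 1 + ν := by linarith
  have h2 : 0 < 1 - ν := by linarith
  have h3 : 0 < e ^ (4 / 3 : ℝ) := Real.rpow_pos_of_pos he _
  have h4 : 3 * (1 - ν) / (β * (1 + ν)) ≠ 0 := by positivity
  rw [add_polyRad_eq, mul_eq_zero_iff_left hκ.ne', mul_eq_zero_iff_right h3.ne',
    mul_eq_zero_iff_left h4, sub_eq_zero,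
    Real.rpow_left_inj (div_pos hd he).le (boundaryShear_nonneg hν₁ hν₂ hβ₂) hβ.ne']

theorem isHomologousBall_homologousBall (h : IsSmoothProfile G K κ ν β α Zmax δ η) (hK : 0 < K)
    (hκ : 0 < κ) (hν₁ : -1 < ν) (hν₂ : ν ≤ 1 / 2) (hβ : 1 < β) (hβ₂ : β ≤ 4 / 3)
    (hZ0 : 0 < Z) (hZ : Z < Zmax) (hyZ : δ Z / η Z = boundaryShear ν (4 / 3) β)
    (hy : ∀ z ∈ Ico 0 Z, boundaryShear ν (4 / 3) β < δ z / η z)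
    (hω : ContDiff ℝ 2 ω) (hω0 : ∀ t, 0 < ω t) (hinit : ω 0 = 1)
    (heq : ∀ t, ω t ^ 2 * deriv (deriv ω) t = 4 * Real.pi * G / 3 * K * α) :
    IsHomologousBall G K κ ν (4 / 3) β (Ici 0) (fun t => Z * ω t) ω
      (homologousBall K κ ν β Z ω δ η) := by
  have hβ0 : 0 < β := by linarith
  have hω1 : ContDiff ℝ 1 ω := hω.of_le one_le_two
  have hωd : Differentiable ℝ ω := hω1.differentiable one_ne_zero
  have hω'c : ContDiff ℝ 1 (deriv ω) := ((contDiff_succ_iff_deriv (n := 1)).1 hω).2.2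
  have hω'd : Differentiable ℝ (deriv ω) := hω'c.differentiable one_ne_zero
  have ha3 : ContDiff ℝ 1 (fun t => K * (ω t ^ 3)⁻¹) :=
    contDiff_const.mul ((hω1.pow 3).inv fun t => (pow_pos (hω0 t) 3).ne')
  have ha4 : ContDiff ℝ 1 (fun t => (ω t ^ 4)⁻¹) :=
    (hω1.pow 4).inv fun t => (pow_pos (hω0 t) 4).ne'
  have hδ1 := h.delta_contDiff.contDiffOn (s := Iio Zmax)
  have hid : ContDiffOn ℝ 1 (fun x : ℝ => x) (Iio Zmax) := contDiff_id.contDiffOn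
  have hPr := h.contDiffOn_pRad
  have hPt := h.contDiffOn_pTan hβ.ne'
  have hin : ∀ t, ∀ r ∈ Ico 0 (Z * ω t), r / ω t ∈ Ico 0 Z := fun t r hr =>
    ⟨div_nonneg hr.1 (hω0 t).le, (div_lt_iff₀ (hω0 t)).2 hr.2⟩
  have hPrpos : ∀ x ∈ Ico 0 Z, 0 < profilePRad κ ν β δ η x := fun x hx =>
    (add_polyRad_pos_iff hκ hν₁ hν₂ hβ0 hβ₂ (h.delta_pos x (hx.2.trans hZ))
      (h.eta_pos x (hx.2.trans hZ))).2 (hy x hx)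
  have hPtpos : ∀ x ∈ Ico 0 Z, 0 < profilePTan κ ν β δ η x := fun x hx =>
    (hPrpos x hx).trans_le (h.pRad_le_pTan hκ hν₁ hν₂ hβ hβ₂ hx.1 (hx.2.trans hZ))
  have hcenter : ∀ t, homologousField Z ω (fun t => (ω t ^ 4)⁻¹) (profilePRad κ ν β δ η) t 0
      = homologousField Z ω (fun t => (ω t ^ 4)⁻¹) (profilePTan κ ν β δ η) t 0 := by
    intro t
    have h0 := (mul_pos hZ0 (hω0 t)).le
    rw [homologousField_of_le h0, homologousField_of_le h0, zero_div, profilePRad, profilePTan,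
      h.eta_zero, polyTan_self _ (h.delta_pos 0 (hZ0.trans hZ))]
  have hu0 : ∀ t, homologousField Z ω (deriv ω) (fun x => x) t 0 = 0 := by
    intro t
    rw [homologousField_of_le (mul_pos hZ0 (hω0 t)).le]; simp
  -- the mean density at radius `r` is the rescaled profile of `η`
  have hmass : ∀ t, ∀ r ∈ Ioo 0 (Z * ω t),
      ballMean (fun s => homologousField Z ω (fun t => K * (ω t ^ 3)⁻¹) δ t s / K) r
        = η (r / ω t) * (ω t ^ 3)⁻¹ := by
    intro t r hr
    rw [h.eta_eq, ← ballMean_comp_div]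
    refine ballMean_congr hr.1.le fun s hs => ?_
    rw [homologousField_of_le (hs.2.trans hr.2.le)]
    field_simp
  have hrhoK : ∀ t, ∀ r ∈ Ioo 0 (Z * ω t),
      homologousField Z ω (fun t => K * (ω t ^ 3)⁻¹) δ t r / K = δ (r / ω t) * (ω t ^ 3)⁻¹ := by
    intro t r hr
    rw [homologousField_of_le hr.2.le]
    field_simp
  refine ⟨⟨⟨fun t _ => mul_pos hZ0 (hω0 t), (contDiff_const.mul hω1).contDiffOn,
      fun t _ r hr => ?_, fun t _ r hr => ?_, fun t _ r hr => ?_,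
      isRegularField_homologousField hω1 hω0 ha3 hδ1 hZ,
      isRegularField_homologousField hω1 hω0 ha4 hPr hZ,
      isRegularField_homologousField hω1 hω0 ha4 hPt hZ,
      isRegularField_homologousField hω1 hω0 hω'c hid hZ,
      fun t _ r (hr : Z * ω t < r) => by
        simp only [homologousBall, homologousField_of_lt hr, and_self], fun t _ => hcenter t, fun t _ => ?_, fun t _ => hu0 t,
      fun t _ => ?_, fun t _ => ?_, fun t _ => ?_, fun t _ => ?_, ?_⟩, hK, by positivity,
      isElasticConstitutive_poly hκ hν₁ hν₂ hβ hβ₂, fun t _ r hr => ?_, fun t _ r hr => ?_⟩,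
      ⟨fun t ht r hr => ?_, fun t ht r hr => ?_, fun t ht => ?_, fun t _ => ?_⟩,
      ⟨hω1.contDiffOn, fun t _ => hω0 t, hinit, fun t ht r hr => ?_⟩⟩
  · have := hin t r hr
    have hw := hω0 t
    have := h.delta_pos _ (this.2.trans hZ)
    simp only [homologousBall, homologousField_of_le hr.2.le]
    positivity
  · have := hPrpos _ (hin t r hr)
    have hw := hω0 t
    simp only [homologousBall, homologousField_of_le hr.2.le]
    positivity
  · have := hPtpos _ (hin t r hr)
    have hw := hω0 t
    simp only [homologousBall, homologousField_of_le hr.2.le]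
    positivity
  · simp only [homologousBall, hcenter]
  · simp only [homologousBall, hu0]
    simp
  · have := tendsto_deriv_homologousField (a := fun t => K * (ω t ^ 3)⁻¹) hω0 hδ1 hZ0 hZ t
    rwa [h.deriv_delta_zero, zero_div, mul_zero] at this
  · have := tendsto_deriv_homologousField (a := fun t => (ω t ^ 4)⁻¹) hω0 hPr hZ0 hZ t
    rwa [h.deriv_pRad_zero (hZ0.trans hZ), zero_div, mul_zero] at this
  · have := tendsto_deriv_homologousField (a := fun t => (ω t ^ 4)⁻¹) hω0 hPt hZ0 hZ t
    rwa [h.deriv_pTan_zero hβ.ne' (hZ0.trans hZ), zero_div, mul_zero] at this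
  · refine ⟨fun t => deriv ω t / ω t,
      (hω'd.continuous.div hωd.continuous fun t => (hω0 t).ne').continuousOn, fun t _ => ⟨?_, ?_⟩⟩
    · have := tendsto_deriv_homologousField (a := deriv ω) hω0 hid hZ0 hZ t
      rwa [deriv_id'', mul_one_div] at this
    · refine tendsto_const_nhds.congr' ?_
      filter_upwards [self_mem_nhdsWithin,
        nhdsWithin_le_nhds (Iio_mem_nhds (mul_pos hZ0 (hω0 t)))] with r hr0 hr
      have hr0' : r ≠ 0 := (mem_Ioi.1 hr0).ne'
      simp only [homologousBall]
      rw [homologousField_of_le (le_of_lt hr)]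
      field_simp
  · rw [enclosedMass_div hK.ne' hr.1.ne']
    simp only [homologousBall]
    rw [hrhoK t r hr, hmass t r hr, polyRad_scale (h.eta_pos _ ?_) (hω0 t),
      homologousField_of_le hr.2.le]
    · rfl
    · exact (hin t r (Ioo_subset_Ico_self hr)).2.trans hZ
  · rw [enclosedMass_div hK.ne' hr.1.ne']
    simp only [homologousBall]
    rw [hrhoK t r hr, hmass t r hr, polyTan_scale (h.eta_pos _ ?_) (hω0 t),
      homologousField_of_le hr.2.le]
    · rfl
    · exact (hin t r (Ioo_subset_Ico_self hr)).2.trans hZ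
  · -- conservation of mass
    have hw := (hω0 t).ne'
    have hr0 := hr.1.ne'
    have d1 := hasDerivAt_homologousField_time hωd hω0 (ha3.differentiable one_ne_zero) hδ1 hZ hr.2
    have d2 := hasDerivAt_homologousField_radius (a := fun t => K * (ω t ^ 3)⁻¹) hω0 hδ1 hZ hr.2
    have d3 := hasDerivAt_homologousField_radius (a := deriv ω) hω0 hid hZ hr.2
    have d4 : HasDerivAt (fun t => K * (ω t ^ 3)⁻¹)
        (K * (-(3 * ω t ^ 2 * deriv ω t) / (ω t ^ 3) ^ 2)) t := by
      have := ((((hωd t).hasDerivAt.pow 3).inv (pow_ne_zero 3 hw)).const_mul K)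
      refine this.congr_deriv ?_
      push_cast
      simp
    have d5 : HasDerivAt (fun s => s ^ 2 * homologousField Z ω (fun t => K * (ω t ^ 3)⁻¹) δ t s
        * homologousField Z ω (deriv ω) (fun x => x) t s) _ r :=
      ((hasDerivAt_pow 2 r).mul d2).mul d3
    simp only [homologousBall]
    rw [d1.hasDerivWithinAt.derivWithin (uniqueDiffOn_Ici 0 t ht), d5.deriv]
    simp only [Pi.mul_apply, homologousField_of_le hr.2.le, d4.deriv, deriv_id'']
    field_simp
    push_cast
    ring
  · -- balance of momentum
    have hw := (hω0 t).ne'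
    have hr0 := hr.1.ne'
    have hx : r / ω t ∈ Ioo 0 Zmax :=
      ⟨div_pos hr.1 (hω0 t), (hin t r (Ioo_subset_Ico_self hr)).2.trans hZ⟩
    have d1 := hasDerivAt_homologousField_time hωd hω0 hω'd hid hZ hr.2
    have d2 := hasDerivAt_homologousField_radius (a := deriv ω) hω0 hid hZ hr.2
    have d3 := hasDerivAt_homologousField_radius (a := fun t => (ω t ^ 4)⁻¹) hω0 hPr hZ hr.2
    have hbal := h.balance hκ hν₁ hν₂ hβ hβ₂ hx
    have hm := enclosedMass_eq hK.ne'
      (homologousField Z ω (fun t => K * (ω t ^ 3)⁻¹) δ) t r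
    rw [hmass t r hr] at hm
    simp only [homologousBall]
    rw [d1.hasDerivWithinAt.derivWithin (uniqueDiffOn_Ici 0 t ht), d2.deriv, d3.deriv, hm]
    simp only [homologousField_of_le hr.2.le, deriv_id'']
    have e := heq t
    have e' : deriv (deriv ω) t = 4 * Real.pi * G / 3 * K * α / ω t ^ 2 := by
      rw [← e]; field_simp
    rw [e']
    have hbal' : deriv (profilePRad κ ν β δ η) (r / ω t)
        = 2 / (r / ω t) * (profilePTan κ ν β δ η (r / ω t) - profilePRad κ ν β δ η (r / ω t))
          - 4 * Real.pi * G / 3 * K ^ 2 * (r / ω t) * δ (r / ω t) * (η (r / ω t) + α) := by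
      linarith
    rw [hbal']
    generalize δ (r / ω t) = D
    generalize η (r / ω t) = H
    generalize profilePTan κ ν β δ η (r / ω t) = P
    generalize profilePRad κ ν β δ η (r / ω t) = Q
    field_simp
    ring
  · simp only [homologousBall]
    rw [homologousField_of_le le_rfl,
      ((hωd t).hasDerivAt.const_mul Z).hasDerivWithinAt.derivWithin (uniqueDiffOn_Ici 0 t ht),
      mul_div_cancel_right₀ _ (hω0 t).ne', mul_comm]
  · simp only [homologousBall]
    rw [homologousField_of_le le_rfl, mul_div_cancel_right₀ _ (hω0 t).ne', profilePRad,
      (add_polyRad_eq_zero_iff hκ hν₁ hν₂ hβ0 hβ₂ (h.delta_pos Z hZ) (h.eta_pos Z hZ)).2 hyZ,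
      mul_zero]
  · simp only [homologousBall]
    rw [homologousField_of_le hr.2, derivWithin_Ici_eq hωd ht]
    ring

end

/-! ### Uniqueness of homologous balls -/

lemma eq_of_hasDerivWithinAt_Ici_zero {f : ℝ → ℝ}
    (h : ∀ t, 0 ≤ t → HasDerivWithinAt f 0 (Ici 0) t) {t : ℝ} (ht : 0 ≤ t) : f t = f 0 := by
  have := (convex_Ici (0 : ℝ)).norm_image_sub_le_of_norm_hasDerivWithin_le (C := 0)
    (fun t ht => h t ht) (fun _ _ => by simp) (mem_Ici.2 le_rfl) (mem_Ici.2 ht)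
  rw [zero_mul] at this
  exact sub_eq_zero.1 (norm_le_zero_iff.1 this)

/-- The partial derivatives of a regular field at an interior point, and its derivative along a
curve of constant `r / w(t)`, in terms of one linear map. -/
lemma IsRegularField.exists_partials {R w : ℝ → ℝ} {f : ℝ → ℝ → ℝ}
    (hf : IsRegularField (Ici 0) R f) (hR : ContinuousOn R (Ici 0)) {t x w' : ℝ} (ht : 0 ≤ t)
    (hw : HasDerivWithinAt w w' (Ici 0) t) (hx : ∀ s, 0 ≤ s → x * w s ∈ Ioo 0 (R s)) :
    ∃ a b : ℝ, HasDerivWithinAt (fun s => f s (x * w t)) a (Ici 0) t ∧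
      HasDerivAt (f t) b (x * w t) ∧
      HasDerivWithinAt (fun s => f s (x * w s)) (a + b * (x * w')) (Ici 0) t := by
  have hmem : (t, x * w t) ∈ innerRegion (Ici 0) R := ⟨ht, (hx t ht).1.le, (hx t ht).2⟩
  obtain ⟨F', hF'⟩ := (hf.2.differentiableOn one_ne_zero) _ hmem
  refine ⟨F' (1, 0), F' (0, 1), ?_, ?_, ?_⟩
  · have hnear : Ici 0 ∩ {s | x * w t < R s} ∈ 𝓝[Ici 0] t :=
      inter_mem self_mem_nhdsWithin ((hR t ht).eventually_const_lt (hx t ht).2)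
    refine (HasFDerivWithinAt.comp_hasDerivWithinAt (f := fun s => (s, x * w t))
      (s := Ici 0 ∩ {s | x * w t < R s}) t hF' ?_ ?_).mono_of_mem_nhdsWithin hnear
    · exact (hasDerivWithinAt_id t _).prodMk (hasDerivWithinAt_const t _ _)
    · exact fun s hs => ⟨hs.1, (hx t ht).1.le, hs.2⟩
  · refine (HasFDerivWithinAt.comp_hasDerivWithinAt (f := fun r => (t, r)) (s := Ioo 0 (R t))
      (x * w t) hF' ?_ ?_).hasDerivAt (isOpen_Ioo.mem_nhds (hx t ht))
    · exact (hasDerivWithinAt_const _ _ _).prodMk (hasDerivWithinAt_id _ _)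
    · exact fun s hs => ⟨ht, hs.1.le, hs.2⟩
  · have h1 := HasFDerivWithinAt.comp_hasDerivWithinAt (f := fun s => (s, x * w s))
      (s := Ici 0) t hF' ((hasDerivWithinAt_id t _).prodMk (hw.const_mul x))
      fun s hs => ⟨hs, (hx s hs).1.le, (hx s hs).2⟩
    refine h1.congr_deriv ?_
    have e : ((1, x * w') : ℝ × ℝ) = (1, 0) + (x * w') • (0, 1) := by
      ext <;> simp
    rw [e, map_add, map_smul, smul_eq_mul]
    ring

lemma IsRegularField.continuousOn_radius {R : ℝ → ℝ} {f : ℝ → ℝ → ℝ}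
    (hf : IsRegularField (Ici 0) R f) {t : ℝ} (ht : 0 ≤ t) : ContinuousOn (f t) (Icc 0 (R t)) :=
  hf.1.comp (f := fun r => (t, r)) (by fun_prop) fun r hr => ⟨ht, hr.1, hr.2⟩

section
variable {G K κ ν α β : ℝ} {R w : ℝ → ℝ} {M : Matter}

lemma IsHomologousBall.radius_eq (hw : IsScaleFactor G K α w)
    (h : IsHomologousBall G K κ ν (4 / 3) β (Ici 0) R w M) {t : ℝ} (ht : 0 ≤ t) :
    R t = R 0 * w t := by
  have hR : ∀ t, 0 ≤ t → HasDerivWithinAt R (derivWithin R (Ici 0) t) (Ici 0) t := fun t ht =>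
    (h.elastic.ball.radius_contDiff.differentiableOn one_ne_zero t ht).hasDerivWithinAt
  have key := eq_of_hasDerivWithinAt_Ici_zero (f := fun t => R t / w t) (fun t ht => by
    have hw0 := (hw.pos t ht).ne'
    refine ((hR t ht).div (hw.hasDerivWithinAt ht) hw0).congr_deriv ?_
    rw [← h.gravitating.boundary_comoving t ht,
      h.homologous.velocity t ht (R t) ⟨(h.elastic.ball.radius_pos t ht).le, le_rfl⟩]
    field_simp
    ring) ht
  simp only [hw.init, div_one] at key
  rwa [div_eq_iff (hw.pos t ht).ne'] at key

/-- Conservation of mass: `ρ w³` is constant along the particle trajectories. -/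
lemma IsHomologousBall.rho_comoving (hw : IsScaleFactor G K α w)
    (h : IsHomologousBall G K κ ν (4 / 3) β (Ici 0) R w M) {x : ℝ} (hx : x ∈ Ioo 0 (R 0))
    {t : ℝ} (ht : 0 ≤ t) : M.rho t (x * w t) * w t ^ 3 = M.rho 0 x := by
  have hmem : ∀ s, 0 ≤ s → x * w s ∈ Ioo 0 (R s) := fun s hs => by
    have := hw.pos s hs
    rw [h.radius_eq hw hs]
    exact ⟨mul_pos hx.1 this, mul_lt_mul_of_pos_right hx.2 this⟩
  have key := eq_of_hasDerivWithinAt_Ici_zero (f := fun t => M.rho t (x * w t) * w t ^ 3)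
    (fun t ht => by
      have hw0 := (hw.pos t ht).ne'
      have hx0 := hx.1.ne'
      obtain ⟨a, b, ha, hb, hab⟩ := h.elastic.ball.rho_reg.exists_partials
        h.elastic.ball.radius_contDiff.continuousOn ht (hw.hasDerivWithinAt ht) hmem
      refine (hab.mul ((hw.hasDerivWithinAt ht).pow 3)).congr_deriv ?_
      have hc := h.gravitating.continuity t ht (x * w t) (hmem t ht)
      have hu : HasDerivAt (M.u t) (derivWithin w (Ici 0) t / w t) (x * w t) := by
        refine (((hasDerivAt_id (x * w t)).const_mul
          (derivWithin w (Ici 0) t / w t)).congr_of_eventuallyEq ?_).congr_deriv (mul_one _)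
        filter_upwards [isOpen_Ioo.mem_nhds (hmem t ht)] with r hr
        exact h.homologous.velocity t ht r ⟨hr.1.le, hr.2.le⟩
      have hflux : HasDerivAt (fun s => s ^ 2 * M.rho t s * M.u t s) _ (x * w t) :=
        ((hasDerivAt_pow 2 (x * w t)).mul hb).mul hu
      rw [ha.derivWithin (uniqueDiffOn_Ici 0 t ht), hflux.deriv] at hc
      simp only [Pi.mul_apply] at hc
      rw [h.homologous.velocity t ht (x * w t) ⟨(hmem t ht).1.le, (hmem t ht).2.le⟩] at hc
      have ha' : a = -(derivWithin w (Ici 0) t / w t) * (3 * M.rho t (x * w t) + x * w t * b) := by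
        rw [eq_neg_of_add_eq_zero_left hc]
        field_simp
        push_cast
        ring
      rw [ha']
      simp only [Pi.pow_apply]
      field_simp
      push_cast
      ring) ht
  simpa [hw.init] using key

/-- The initial state of a homologous ball is a strongly regular solution of the profile system. -/
lemma IsHomologousBall.exists_stronglyRegular (hw : IsScaleFactor G K α w) (hβ : 1 < β)
    (hβ₂ : β ≤ 4 / 3) (h : IsHomologousBall G K κ ν (4 / 3) β (Ici 0) R w M) {d : ℝ}
    (hd : M.rho 0 0 = K * d) :
    ∃ η : ℝ → ℝ, IsStronglyRegularProfile G K κ ν β α d (R 0 : EReal) (fun x => M.rho 0 x / K) η ∧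
      (∀ x ∈ Icc 0 (R 0), η x = ballMean (fun s => M.rho 0 s / K) x) := by
  have hball := h.elastic.ball
  have hK := h.elastic.density_pos
  have hκ := h.elastic.constitutive.bulk_pos
  obtain ⟨hν₁, hν₂⟩ := h.elastic.constitutive.poisson_mem
  have hR0 := hball.radius_pos 0 (mem_Ici.2 le_rfl)
  have h00 : (0 : ℝ) ∈ Ici (0 : ℝ) := mem_Ici.2 le_rfl
  set f := fun s => M.rho 0 (truncate 0 (R 0) s) / K with hf
  have cf : Continuous f :=
    ((hball.rho_reg.continuousOn_radius le_rfl).comp_continuous (continuous_truncate 0 (R 0))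
      fun s => truncate_mem hR0.le s).div_const K
  have hfρ : ∀ s ∈ Icc 0 (R 0), f s = M.rho 0 s / K := fun s hs => by
    simp only [hf, truncate_of_mem hs]
  have hmean : ∀ x ∈ Icc 0 (R 0), ballMean f x = ballMean (fun s => M.rho 0 s / K) x :=
    fun x hx => ballMean_congr hx.1 fun s hs => hfρ s ⟨hs.1, hs.2.trans hx.2⟩
  have hη' : ∀ x ∈ Ioo 0 (R 0),
      HasDerivAt (ballMean f) (-(3 / x) * (ballMean f x - M.rho 0 x / K)) x := fun x hx => by
    have := hasDerivAt_ballMean cf hx.1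
    rwa [hfρ x (Ioo_subset_Icc_self hx)] at this
  have hδpos : ∀ x ∈ Ico 0 (R 0), 0 < M.rho 0 x / K := fun x hx =>
    div_pos (hball.rho_pos 0 h00 x hx) hK
  have hηpos : ∀ x ∈ Ioo 0 (R 0), 0 < ballMean f x := by
    intro x hx
    obtain ⟨y, hy, hmin⟩ := isCompact_Icc.exists_isMinOn (s := Icc 0 x) ⟨0, le_rfl, hx.1.le⟩
      cf.continuousOn
    have hy' : 0 < f y := by
      rw [hfρ y ⟨hy.1, hy.2.trans hx.2.le⟩]
      exact hδpos y ⟨hy.1, hy.2.trans_lt hx.2⟩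
    exact hy'.trans_le (le_ballMean cf hx.1.le fun s hs => hmin hs)
  have hcd : ContDiffOn ℝ 1 (fun x => M.rho 0 x / K) (Ico 0 (R 0)) :=
    (hball.rho_reg.2.comp (f := fun r : ℝ => ((0 : ℝ), r)) (by fun_prop)
      fun r hr => ⟨h00, hr.1, hr.2⟩).div_const K
  have hint : profileInterval (R 0 : EReal) = Ico 0 (R 0) := by
    ext z; rw [mem_profileInterval]; rfl
  refine ⟨ballMean f, ⟨by exact_mod_cast hR0, by rw [hd]; field_simp, ?_, ?_, ?_, ?_,
    (continuous_ballMean cf).continuousOn, ?_, ?_⟩, hmean⟩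
  · rw [ballMean_zero, hfρ 0 ⟨le_rfl, hR0.le⟩, hd]; field_simp
  · rw [hint]; exact hδpos
  · rw [hint]; exact hcd
  · have := (hball.center_rho_r 0 h00).div_const K
    rw [zero_div] at this
    refine this.congr fun x => ?_
    rw [deriv_div_const]
  · rw [hint]
    intro x hx hx0
    have hx' : x ∈ Ioo 0 (R 0) := ⟨hx0, hx.2⟩
    have hδd : HasDerivAt (fun x => M.rho 0 x / K) (deriv (fun x => M.rho 0 x / K) x) x :=
      ((hcd.differentiableOn one_ne_zero).differentiableAt
        (mem_of_superset (isOpen_Ioo.mem_nhds hx') Ioo_subset_Ico_self)).hasDerivAt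
    have hδ0 := hδpos x hx
    have hη0 := hηpos x hx'
    have hratio : ∀ r ∈ Ioo 0 (R 0),
        enclosedMass M.rho 0 r / (4 * Real.pi / 3 * K * r ^ 3) = ballMean f r := fun r hr => by
      rw [enclosedMass_div hK.ne' hr.1.ne', hmean r (Ioo_subset_Icc_self hr)]
    have hp : HasDerivAt (M.pRad 0) _ x :=
      ((hasDerivAt_polyRad (κ := κ) (ν := ν) (γ := 4 / 3) (β := β) hδd (hη' x hx') hδ0
        hη0).const_add (κ / (4 / 3))).congr_of_eventuallyEq (by
          filter_upwards [isOpen_Ioo.mem_nhds hx'] with r hr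
          rw [h.elastic.eos_rad 0 h00 r hr, hratio r hr])
    have hmom := h.gravitating.momentum 0 h00 x hx'
    have hu0 : M.u 0 x = 0 := by
      rw [h.homologous.velocity 0 h00 x ⟨hx0.le, hx.2.le⟩, hw.init_deriv]; simp
    have hut : HasDerivWithinAt (fun s => M.u s x) (4 * Real.pi * G / 3 * K * α * x) (Ici 0) 0 := by
      have h1 := (((hw.hasDerivWithinAt_derivWithin le_rfl).div (hw.hasDerivWithinAt le_rfl)
        (hw.pos 0 le_rfl).ne').mul_const x)
      refine (h1.congr_of_eventuallyEq ?_ ?_).congr_deriv ?_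
      · filter_upwards [self_mem_nhdsWithin,
          (hball.radius_contDiff.continuousOn 0 h00).eventually_const_lt hx.2] with s hs hs'
        exact h.homologous.velocity s hs x ⟨hx0.le, hs'.le⟩
      · exact h.homologous.velocity 0 h00 x ⟨hx0.le, hx.2.le⟩
      · rw [hw.init, hw.init_deriv]; simp
    have hm := enclosedMass_eq hK.ne' M.rho 0 x
    rw [← hmean x ⟨hx0.le, hx.2.le⟩] at hm
    rw [hut.derivWithin (uniqueDiffOn_Ici 0 0 h00), hu0, hp.deriv, hm,
      h.elastic.eos_rad 0 h00 x hx', h.elastic.eos_tan 0 h00 x hx', hratio x hx'] at hmom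
    have hbal := pressure_balance (G := G) (K := K) (α := α)
      (δ' := deriv (fun x => M.rho 0 x / K) x) hκ hν₁ hν₂ hβ hβ₂ hx0 hδ0 hη0
    have hρ : M.rho 0 x = K * (M.rho 0 x / K) := by field_simp
    have hzero : -(3 * κ * (1 - ν) / (1 + ν)) * (ballMean f x) ^ (1 / 3 : ℝ) *
        (M.rho 0 x / K / ballMean f x) ^ (β - 1) * (deriv (fun x => M.rho 0 x / K) x -
          (M.rho 0 x / K / ballMean f x) ^ (1 - β) *
        (3 * (β - 4 / 3) / x * profileB β (M.rho 0 x / K / ballMean f x) * ballMean f x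
          - profileTheta G K κ ν * x * ballMean f x ^ (-(1 / 3) : ℝ) * (M.rho 0 x / K) *
            (ballMean f x + α))) = 0 := by
      rw [← hbal]
      have hgrav : G * (4 * Real.pi / 3 * K * x ^ 3 * ballMean f x) / x ^ 2
          = 4 * Real.pi * G / 3 * K * x * ballMean f x := by field_simp
      rw [hgrav, zero_mul, add_zero] at hmom
      have e1 : M.rho 0 x * (4 * Real.pi * G / 3 * K * α * x)
          = 4 * Real.pi * G / 3 * K ^ 2 * x * (M.rho 0 x / K) * α := by field_simp
      have e2 : M.rho 0 x * (-(4 * Real.pi * G / 3 * K * x * ballMean f x))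
          = -(4 * Real.pi * G / 3 * K ^ 2 * x * (M.rho 0 x / K) * ballMean f x) := by field_simp
      rw [e1, e2, add_sub_add_left_eq_sub] at hmom
      linarith
    have hne : -(3 * κ * (1 - ν) / (1 + ν)) * (ballMean f x) ^ (1 / 3 : ℝ) *
        (M.rho 0 x / K / ballMean f x) ^ (β - 1) ≠ 0 := by
      have h1 : 0 < 1 + ν := by linarith
      have h2 : 0 < 1 - ν := by linarith
      have h3 : 0 < (ballMean f x) ^ (1 / 3 : ℝ) := Real.rpow_pos_of_pos hη0 _
      have h4 : 0 < (M.rho 0 x / K / ballMean f x) ^ (β - 1) :=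
        Real.rpow_pos_of_pos (div_pos hδ0 hη0) _
      have h5 : 0 < 3 * κ * (1 - ν) / (1 + ν) := by positivity
      exact mul_ne_zero (mul_ne_zero (neg_ne_zero.2 h5.ne') h3.ne') h4.ne'
    rw [mul_eq_zero_iff_left hne, sub_eq_zero] at hzero
    rwa [hzero] at hδd
  · rw [hint]
    exact fun x hx hx0 => hη' x ⟨hx0, hx.2⟩

/-- A homologous ball with the central density of the profile `(δ, η)` is determined by that
profile. -/
theorem IsHomologousBall.eq_profile {Z Zmax d : ℝ} {δ η : ℝ → ℝ} (hw : IsScaleFactor G K α w)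
    (hβ : 1 < β) (hβ₂ : β ≤ 4 / 3) (h : IsHomologousBall G K κ ν (4 / 3) β (Ici 0) R w M)
    (hd : M.rho 0 0 = K * d) (hmax : IsMaximalProfile G K κ ν β α d (Zmax : EReal) δ η)
    (hprof : IsSmoothProfile G K κ ν β α Zmax δ η) (hZ0 : 0 < Z) (hZ : Z < Zmax)
    (hyZ : δ Z / η Z = boundaryShear ν (4 / 3) β)
    (hy : ∀ z ∈ Ico 0 Z, boundaryShear ν (4 / 3) β < δ z / η z) {t : ℝ} (ht : 0 ≤ t) :
    R t = Z * w t ∧ ∀ r ∈ Icc 0 (Z * w t),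
      M.rho t r = K * (w t ^ 3)⁻¹ * δ (r / w t) ∧
      M.pRad t r = (w t ^ 4)⁻¹ * profilePRad κ ν β δ η (r / w t) ∧
      M.pTan t r = (w t ^ 4)⁻¹ * profilePTan κ ν β δ η (r / w t) ∧
      M.u t r = derivWithin w (Ici 0) t / w t * r := by
  have hball := h.elastic.ball
  have hK := h.elastic.density_pos
  have hκ := h.elastic.constitutive.bulk_pos
  obtain ⟨hν₁, hν₂⟩ := h.elastic.constitutive.poisson_mem
  have hβ0 : 0 < β := by linarith
  have h00 : (0 : ℝ) ∈ Ici (0 : ℝ) := mem_Ici.2 le_rfl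
  have hR0 := hball.radius_pos 0 h00
  obtain ⟨η', hreg, hmean⟩ := h.exists_stronglyRegular hw hβ hβ₂ hd
  obtain ⟨hle, heq⟩ := hmax.maximal _ _ _ hreg
  have hle : R 0 ≤ Zmax := EReal.coe_le_coe_iff.1 hle
  have heq : ∀ z ∈ Ico 0 (R 0), M.rho 0 z / K = δ z ∧ η' z = η z := fun z hz =>
    heq z (mem_profileInterval.2 hz)
  have hp0 : ∀ z ∈ Ioo 0 (R 0), M.pRad 0 z = profilePRad κ ν β δ η z := by
    intro z hz
    obtain ⟨h1, h2⟩ := heq z (Ioo_subset_Ico_self hz)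
    rw [h.elastic.eos_rad 0 h00 z hz, enclosedMass_div hK.ne' hz.1.ne',
      ← hmean z (Ioo_subset_Icc_self hz), h1, h2, profilePRad]
  -- the pressure is positive inside and vanishes at the boundary, so the radius is the first zero
  have hRZ : R 0 = Z := by
    rcases lt_trichotomy (R 0) Z with hlt | he | hgt
    · have hcl := EqOn.of_subset_closure (s := Ioo 0 (R 0)) (t := Icc 0 (R 0)) hp0
        (hball.pRad_reg.continuousOn_radius le_rfl)
        (hprof.contDiffOn_pRad.continuousOn.mono fun z hz => hz.2.trans_lt (hlt.trans hZ))
        Ioo_subset_Icc_self (by rw [closure_Ioo hR0.ne])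
      have h1 := hcl (⟨hR0.le, le_rfl⟩ : R 0 ∈ Icc 0 (R 0))
      rw [h.gravitating.boundary_vacuum 0 h00, eq_comm, profilePRad,
        add_polyRad_eq_zero_iff hκ hν₁ hν₂ hβ0 hβ₂ (hprof.delta_pos _ (hlt.trans hZ))
          (hprof.eta_pos _ (hlt.trans hZ))] at h1
      exact absurd h1 (hy _ ⟨hR0.le, hlt⟩).ne'
    · exact he
    · have h1 := hball.pRad_pos 0 h00 Z ⟨hZ0.le, hgt⟩
      rw [hp0 Z ⟨hZ0, hgt⟩, profilePRad, add_polyRad_pos_iff hκ hν₁ hν₂ hβ0 hβ₂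
        (hprof.delta_pos _ hZ) (hprof.eta_pos _ hZ)] at h1
      exact absurd hyZ h1.ne'
  have hw0 := hw.pos t ht
  have hRt : R t = Z * w t := by rw [h.radius_eq hw ht, hRZ]
  have hZw : 0 < Z * w t := mul_pos hZ0 hw0
  have hρ : ∀ r ∈ Ioo 0 (Z * w t), M.rho t r = K * (w t ^ 3)⁻¹ * δ (r / w t) := by
    intro r hr
    have hx : r / w t ∈ Ioo 0 (R 0) := ⟨div_pos hr.1 hw0, by
      rw [hRZ, div_lt_iff₀ hw0]; exact hr.2⟩
    have h1 := h.rho_comoving hw hx ht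
    rw [div_mul_cancel₀ _ hw0.ne'] at h1
    rw [← (heq _ (Ioo_subset_Ico_self hx)).1, ← h1]
    field_simp
  have hcont : ∀ g : ℝ → ℝ, ContDiffOn ℝ 1 g (Iio Zmax) → ∀ a : ℝ,
      ContinuousOn (fun r => a * g (r / w t)) (Icc 0 (Z * w t)) := by
    intro g hg a
    refine continuousOn_const.mul (hg.continuousOn.comp (by fun_prop) fun r hr => ?_)
    exact mem_Iio.2 (((div_le_iff₀ hw0).2 hr.2).trans_lt hZ)
  have hcl : Icc 0 (Z * w t) ⊆ closure (Ioo 0 (Z * w t)) := by rw [closure_Ioo hZw.ne]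
  have hext : ∀ {f : ℝ → ℝ → ℝ} {g : ℝ → ℝ} {a : ℝ}, IsRegularField (Ici 0) R f →
      ContDiffOn ℝ 1 g (Iio Zmax) → (∀ r ∈ Ioo 0 (Z * w t), f t r = a * g (r / w t)) →
      ∀ r ∈ Icc 0 (Z * w t), f t r = a * g (r / w t) := by
    intro f g a hf hg hfg
    exact EqOn.of_subset_closure hfg (hRt ▸ hf.continuousOn_radius ht) (hcont g hg a)
      Ioo_subset_Icc_self hcl
  have hρ' := hext hball.rho_reg hprof.delta_contDiff.contDiffOn hρ
  have hδ : ∀ r ∈ Icc 0 (Z * w t), M.rho t r / K = δ (r / w t) * (w t ^ 3)⁻¹ := fun r hr => by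
    rw [hρ' r hr]; field_simp
  have hη : ∀ r ∈ Ioo 0 (Z * w t),
      enclosedMass M.rho t r / (4 * Real.pi / 3 * K * r ^ 3) = η (r / w t) * (w t ^ 3)⁻¹ := by
    intro r hr
    rw [enclosedMass_div hK.ne' hr.1.ne', hprof.eta_eq, ← ballMean_comp_div]
    exact ballMean_congr hr.1.le fun s hs => hδ s ⟨hs.1, hs.2.trans hr.2.le⟩
  have hηpos : ∀ r ∈ Ioo 0 (Z * w t), 0 < η (r / w t) := fun r hr =>
    hprof.eta_pos _ (((div_lt_iff₀ hw0).2 hr.2).trans hZ)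
  have hpr := hext (a := (w t ^ 4)⁻¹) hball.pRad_reg (hprof.contDiffOn_pRad (κ := κ)) fun r hr => by
    rw [h.elastic.eos_rad t ht r (hRt.symm ▸ hr), hδ r (Ioo_subset_Icc_self hr), hη r hr,
      polyRad_scale (hηpos r hr) hw0]
    rfl
  have hpt := hext (a := (w t ^ 4)⁻¹) hball.pTan_reg (hprof.contDiffOn_pTan hβ.ne')
    fun r hr => by
      rw [h.elastic.eos_tan t ht r (hRt.symm ▸ hr), hδ r (Ioo_subset_Icc_self hr), hη r hr,
        polyTan_scale (hηpos r hr) hw0]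
      rfl
  exact ⟨hRt, fun r hr => ⟨hρ' r hr, hpr r hr, hpt r hr,
    h.homologous.velocity t ht r (hRt.symm ▸ hr)⟩⟩

end

theorem theorem2 (G K κ ν α β : ℝ) (hG : 0 < G) (hK : 0 < K) (hκ : 0 < κ)
    (hν₁ : -1 < ν) (hν₂ : ν ≤ 1 / 2) (hα : 0 < α) (hβ₁ : 1 < β) (hβ₂ : β ≤ 4 / 3)
    (δc : ℝ) (hδc : 0 < δc) :
    ∃ (Zmax : ℝ) (δ₀ η₀ : ℝ → ℝ),
      IsMaximalProfile G K κ ν β α δc (Zmax : EReal) δ₀ η₀ ∧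
      (∀ z ∈ Ioo 0 Zmax, 0 < δ₀ z / η₀ z ∧ δ₀ z / η₀ z < 1) ∧
      Tendsto (fun z => δ₀ z / η₀ z) (𝓝[<] Zmax) (𝓝[>] 0) ∧
      (¬ (ν = 1 / 2 ∧ β = 4 / 3) →
        ∃ (ω : ℝ → ℝ) (Z : ℝ) (M : Matter),
          -- the scale factor: existence, uniqueness, expansion
          IsScaleFactor G K α ω ∧
          (∀ ω' : ℝ → ℝ, IsScaleFactor G K α ω' → EqOn ω' ω (Ici 0)) ∧
          StrictMonoOn ω (Ici 0) ∧
          Tendsto (fun t => Z * ω t) atTop atTop ∧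
          -- the radius: `Z` is the first solution of `y₀(Z) = y_b`, and the ball is of type A
          Z ∈ Ioo 0 Zmax ∧
          δ₀ Z / η₀ Z = boundaryShear ν (4 / 3) β ∧
          (∀ z ∈ Ico 0 Z, boundaryShear ν (4 / 3) β < δ₀ z / η₀ z) ∧
          -- the ball
          IsHomologousBall G K κ ν (4 / 3) β (Ici 0) (fun t => Z * ω t) ω M ∧
          (∀ t, 0 ≤ t → M.rho t 0 = K * δc / ω t ^ 3) ∧
          (∀ t, 0 ≤ t → ∀ r ∈ Icc 0 (Z * ω t), M.rho t r = K * δ₀ (r / ω t) / ω t ^ 3) ∧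
          (∀ t, 0 ≤ t → ∀ r ∈ Ico 0 (Z * ω t), M.pRad t r ≤ M.pTan t r) ∧
          -- its uniqueness
          (∀ (ω' R' : ℝ → ℝ) (M' : Matter), IsScaleFactor G K α ω' →
            IsHomologousBall G K κ ν (4 / 3) β (Ici 0) R' ω' M' → M'.rho 0 0 = K * δc →
            ∀ t, 0 ≤ t → R' t = Z * ω t ∧ ∀ r, 0 ≤ r →
              M'.rho t r = M.rho t r ∧ M'.pRad t r = M.pRad t r ∧
              M'.pTan t r = M.pTan t r ∧ M'.u t r = M.u t r)) := by

  have hβ0 : 0 < β := by linarith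
  obtain ⟨Zmax, δ, η, hZmax, hmax, hδc', hηc, hδ0, hη0, hδpos, hηpos, hηeq, hlt, hδZ⟩ :=
    exists_maximalProfile hβ₁ hβ₂ (profileTheta_pos hG hK hκ hν₁ (by linarith)) hα hδc
  have hcy : ContinuousOn (fun z => δ z / η z) (Iic Zmax) :=
    hδc'.continuous.continuousOn.div hηc.continuous.continuousOn fun z hz => (hηpos z hz).ne'
  have hprof : IsSmoothProfile G K κ ν β α Zmax δ η :=
    ⟨hδc', hηc, hδ0, hη0, hδpos, fun z hz => hηpos z hz.le, hηeq, hlt, fun z hz =>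
      hmax.solution.delta_equation z (mem_profileInterval.2 ⟨hz.1.le, hz.2⟩) hz.1⟩
  refine ⟨Zmax, δ, η, hmax, fun z hz => ⟨div_pos (hδpos z hz.2) (hηpos z hz.2.le),
    (div_lt_one (hηpos z hz.2.le)).2 (hlt z hz)⟩, ?_, fun hne => ?_⟩
  · rw [tendsto_nhdsWithin_iff]
    constructor
    · have := (hcy Zmax (mem_Iic.2 le_rfl)).tendsto.mono_left
        (nhdsWithin_mono Zmax (Iio_subset_Iic_self))
      rwa [hδZ, zero_div] at this
    · filter_upwards [self_mem_nhdsWithin] with z hz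
      exact div_pos (hδpos z hz) (hηpos z (le_of_lt hz))
  have hb0 := boundaryShear_pos hν₁ hν₂ hβ₂ hne
  have hb1 := boundaryShear_lt_one hν₁ hν₂ hβ0 hβ₂
  obtain ⟨Z, hZ, hZ0, hZpos⟩ := exists_first_zero (T := Zmax)
    (f := fun z => δ z / η z - boundaryShear ν (4 / 3) β)
    ((hcy.mono fun z hz => hz.2).sub continuousOn_const) hZmax.le
    (by simp only [hprof.eta_zero, div_self (hδpos 0 hZmax).ne']; linarith)
    (by simp only [hδZ, zero_div]; linarith)
  have hZlt : Z < Zmax := by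
    rcases hZ.2.lt_or_eq with h | h
    · exact h
    · rw [h, hδZ, zero_div] at hZ0; linarith
  have hyZ : δ Z / η Z = boundaryShear ν (4 / 3) β := sub_eq_zero.1 hZ0
  have hy : ∀ z ∈ Ico 0 Z, boundaryShear ν (4 / 3) β < δ z / η z := fun z hz =>
    sub_pos.1 (hZpos z hz)
  have hpi := Real.pi_pos
  obtain ⟨ω, hω, hω1, hω0, hω0', hωeq, hωpos, hωtop⟩ :=
    exists_scaleFactor (c := 4 * Real.pi * G / 3 * K * α) (by positivity)
  have hpos : ∀ t, 0 < ω t := fun t => one_pos.trans_le (hω1 t)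
  have hsf : IsScaleFactor G K α ω := isScaleFactor_of_contDiff hω hω1 hω0 hω0' hωeq
  have hδ00 : δ 0 = δc := hmax.solution.delta_center
  refine ⟨ω, Z, homologousBall K κ ν β Z ω δ η, hsf, fun ω' h' => hsf.eqOn h' hG hK hα, ?_,
    hωtop.const_mul_atTop hZ.1, ⟨hZ.1, hZlt⟩, hyZ, hy,
    isHomologousBall_homologousBall hprof hK hκ hν₁ hν₂ hβ₁ hβ₂ hZ.1 hZlt hyZ hy hω hpos hω0 hωeq,
    fun t _ => ?_, fun t _ r hr => ?_, fun t _ r hr => ?_, ?_⟩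
  · refine strictMonoOn_of_deriv_pos (convex_Ici 0) hω.continuous.continuousOn fun t ht => ?_
    rw [interior_Ici] at ht
    exact hωpos t ht
  · simp only [homologousBall]
    rw [homologousField_of_le (mul_pos hZ.1 (hpos t)).le, zero_div, hδ00]
    ring
  · simp only [homologousBall]
    rw [homologousField_of_le hr.2]
    ring
  · simp only [homologousBall]
    rw [homologousField_of_le hr.2.le, homologousField_of_le hr.2.le]
    have h1 := hprof.pRad_le_pTan hκ hν₁ hν₂ hβ₁ hβ₂ (div_nonneg hr.1 (hpos t).le)
      (((div_lt_iff₀ (hpos t)).2 hr.2).trans hZlt)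
    have := hpos t
    gcongr
  · intro ω' R' M' h' hM' hρ t ht
    have hωω' := hsf.eqOn h' hG hK hα
    obtain ⟨hR, hfields⟩ := hM'.eq_profile h' hβ₁ hβ₂ hρ hmax hprof hZ.1 hZlt hyZ hy ht
    rw [hωω' ht] at hR
    refine ⟨hR, fun r hr => ?_⟩
    simp only [homologousBall]
    rcases le_or_gt r (Z * ω t) with hle | hgt
    · rw [hωω' ht, derivWithin_congr hωω' (hωω' ht),
        derivWithin_Ici_eq (hω.differentiable two_ne_zero) ht] at hfields
      obtain ⟨h1, h2, h3, h4⟩ := hfields r ⟨hr, hle⟩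
      simp only [homologousField_of_le hle]
      exact ⟨h1, h2, h3, by rw [h4]; ring⟩
    · simp only [homologousField_of_lt hgt]
      exact hM'.elastic.ball.vacuum t ht r (hR ▸ hgt)
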